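/- Let $d,m,D\ge 1$ be integers and $T>0$. Write $y=(y_1,\dots,y_m)\in(\mathbb R^d)^m$. Assume the hypotheses (H): (K) $K\in C^2(\mathbb R^d;\mathbb R^d)$ is odd and there is $C_K>0$ with $\|K(x)\|<C_K(1+\|x\|)$ for all $x$; (L) $L(y,\mu)=\int_{\mathbb R^d}\ell\bigl(y,x,\int\omega\,d\mu\bigr)\,d\mu(x)$ with $\ell\in C^2((\mathbb R^d)^m\times\mathbb R^d\times\mathbb R^d;\mathbb R)$ and $\omega\in C^2(\mathbb R^d;\mathbb R^d)$; (G) $g\in C^2\bigl((\mathbb R^d)^m;C^2(\mathbb R^d;\mathbb R^d)\bigr)$ and there are constants $G_1,G_2,G_3$ with $g(y)(x)\cdot x\le G_1\|x\|^2+G_2\max_l\|y_l\|^2+G_3$ for all $x,y$; (F) $f_1,\dots,f_m\in C^2((\mathbb R^d)^m;\mathbb R^d)$ and there are constants $F_1,F_2$ with $f_k(y)\cdot y_k\le F_1\max_l\|y_l\|^2+F_2$ for all $k,y$; (U) $\mathcal U\subseteq\mathbb R^D$ is compact and convex; ($\gamma$) $\gamma:\mathcal U\to\mathbb R$ is strictly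 convex and lower semicontinuous. Let $B_1,\dots,B_m$ be real $d\times D$ matrices, $y^0\in(\mathbb R^d)^m$, and let $\mu^0$ be a Borel probability measure on $\mathbb R^d$ with compact support. For every $N\ge1$ let $x^0_N=(x^0_{1,N},\dots,x^0_{N,N})$ with $x^0_{i,N}\in\operatorname{supp}(\mu^0)+\overline{B(0,1)}$ be such that the measures $\mu^0_N=\frac1N\sum_{i=1}^N\delta_{x^0_{i,N}}$ converge to $\mu^0$ weakly$^*$, i.e. $\int\varphi\,d\mu_N^0\to\int\varphi\,d\mu^0$ for every continuous compactly supported $\varphi$. Let $X=L^1([0,T];\mathcal U)$ with the weak topology of $L^1$. For $u\in X$ and $N\ge 1$ consider on $[0,T]$ the system $$\dot y_k=\tfrac1N\sum_{j=1}^N K(y_k-x_j)+f_k(y)+B_ku,\qquad \dot x_i=\tfrac1N\sum_{j=1}^N K(x_i-x_j)+g(y)(x_i)$$ with $(y,x)(0)=(y^0,x^0_N)$ (Carathéodory solutions), and the mean-field system $$\dot y_k=(K\star\mu)(y_k)+f_k(y)+B_ku,\qquad \partial_t\mu=-\nabla_x\cdot\bigl[(K\star\mu+g(y))\mu\bigr]$$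 with $(y,\mu)(0)=(y^0,\mu^0)$, where $(K\star\mu)(x)=\int K(x-x')\,d\mu(x')$. A solution of the latter is a pair $(y,\mu)$ such that $y$ is continuous and is a Carathéodory solution of the first equation, and $\mu$ is a curve of probability measures supported in one common ball, continuous for the Wasserstein distance $\mathcal W_1$, with $\frac{d}{dt}\int\phi\,d\mu(t)=\int\nabla\phi\cdot(K\star\mu(t)+g(y(t)))\,d\mu(t)$ for all $t\in[0,T]$ and $\phi\in C_c^\infty(\mathbb R^d)$. Then for every $u\in X$ both systems have exactly one solution on $[0,T]$, so that $$F_N(u)=\int_0^T\bigl[L(y(t),\mu_N(t))+\gamma(u(t))\bigr]dt,\quad \mu_N(t)=\tfrac1N\sum_{i=1}^N\delta_{x_i(t)},\qquad F(u)=\int_0^T\bigl[L(y(t),\mu(t))+\gamma(u(t))\bigr]dt$$ are well defined in $(-\infty,+\infty]$, where $(y,x)$, respectively $(y,\mu)$, is the solution with control $u$. Moreover $F_N$ $\Gamma$-converges to $F$ on $X$: (i) if $u_N\to u$ in $X$, then $F(u)\le\liminf_{N\to\infty}F_N(u_N)$; (ii) for every $u\in X$ there is a sequence $u_N\to u$ in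 $X$ with $\limsup_{N\to\infty}F_N(u_N)\le F(u)$; the constant sequence $u_N=u$ has this property, and in fact $F_N(u)\to F(u)$. -/

import Mathlib

open MeasureTheory Set Filter Topology
open scoped ENNReal ContDiff Pointwise

noncomputable section

namespace MeanFieldControl

/-- Euclidean space of dimension `d`. -/
abbrev Eu (d : ℕ) : Type := EuclideanSpace ℝ (Fin d)

/-- The space `(ℝ^d)^m` of the states `y = (y_1, …, y_m)` of the leaders. Its norm is
`‖y‖ = max_l ‖y_l‖`, with the Euclidean norm on each `y_l`. -/
abbrev Leaders (d m : ℕ) : Type := Fin m → Eu d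

section General

variable {V W Z : Type*} [NormedAddCommGroup V] [NormedSpace ℝ V]
  [NormedAddCommGroup W] [NormedSpace ℝ W] [NormedAddCommGroup Z] [NormedSpace ℝ Z]

/-- `g ∈ C²(V; C²(W; Z))`, where `C²(W; Z)` carries its usual Fréchet topology, namely uniform
convergence on compact sets of the derivatives of order at most two: each `g y` is of class `C²`
and, for each `j ≤ 2` and each compact set `S`, the map sending `y` to the restriction to `S` of
the `j`-th derivative of `g y`, with values in the Banach space of continuous functions on `S`,
is of class `C²`. -/
def IsC2IntoC2 (g : V → W → Z) : Prop :=
  (∀ y, ContDiff ℝ 2 (g y)) ∧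
    ∀ j : ℕ, j ≤ 2 → ∀ S : TopologicalSpace.Compacts W,
      ∃ Φ : V → C(S, W [×j]→L[ℝ] Z), ContDiff ℝ 2 Φ ∧
        ∀ (y : V) (x : S), Φ y x = iteratedFDeriv ℝ j (g y) (x : W)

end General

/-- The Wasserstein distance `W_1`, as an infimum of transport costs over all couplings. -/
def W1 {d : ℕ} (μ ν : Measure (Eu d)) : ℝ≥0∞ :=
  ⨅ (ρ : Measure (Eu d × Eu d)) (_ : ρ.map Prod.fst = μ ∧ ρ.map Prod.snd = ν),
    ∫⁻ p, edist p.1 p.2 ∂ρ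

/-- The empirical measure `(1/N) ∑ δ_{x_i}`. -/
def empirical {d N : ℕ} (x : Fin N → Eu d) : Measure (Eu d) :=
  (N : ℝ≥0∞)⁻¹ • ∑ i, Measure.dirac (x i)

/-- The integral of a real function with values in the extended reals: integral of the positive
part minus integral of the negative part. -/
def extIntegral {α : Type*} [MeasurableSpace α] (μ : Measure α) (f : α → ℝ) : EReal :=
  ((∫⁻ a, ENNReal.ofReal (f a) ∂μ : ℝ≥0∞) : EReal) -
    ((∫⁻ a, ENNReal.ofReal (-f a) ∂μ : ℝ≥0∞) : EReal)

/-- The convolution `(K ⋆ μ)(x) = ∫ K (x - x') dμ(x')`. -/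
def conv {d : ℕ} (K : Eu d → Eu d) (μ : Measure (Eu d)) (x : Eu d) : Eu d :=
  ∫ x', K (x - x') ∂μ

/-- The data of the control problem: interaction kernel `K`, running cost density `ℓ(η, ξ, ς)`
with the weight `ω`, drifts `g` and `f_k`, control matrices `B_k` (as linear maps `ℝ^D → ℝ^d`),
set of admissible control values `U` and control cost `γ` (only its values on `U` matter). -/
structure Data (d m D : ℕ) where
  K : Eu d → Eu d
  ell : Leaders d m × Eu d × Eu d → ℝ
  omega : Eu d → Eu d
  g : Leaders d m → Eu d → Eu d
  f : Fin m → Leaders d m → Eu d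
  B : Fin m → Eu D →L[ℝ] Eu d
  U : Set (Eu D)
  gamma : Eu D → ℝ

variable {d m D : ℕ}

/-- The standing hypotheses (H). Recall that `‖y‖ ^ 2 = max_l ‖y_l‖ ^ 2` for `y` in
`Leaders d m`. The control cost is a lower semicontinuous strictly convex function on `U`. -/
structure Data.HypH (S : Data d m D) : Prop where
  K_smooth : ContDiff ℝ 2 S.K
  K_odd : ∀ x, S.K (-x) = -S.K x
  K_sublinear : ∃ C : ℝ, 0 < C ∧ ∀ x, ‖S.K x‖ < C * (1 + ‖x‖)
  ell_smooth : ContDiff ℝ 2 S.ell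
  omega_smooth : ContDiff ℝ 2 S.omega
  g_smooth : IsC2IntoC2 S.g
  g_growth : ∃ G₁ G₂ G₃ : ℝ, ∀ (y : Leaders d m) (x : Eu d),
    inner ℝ (S.g y x) x ≤ G₁ * ‖x‖ ^ 2 + G₂ * ‖y‖ ^ 2 + G₃
  f_smooth : ∀ k, ContDiff ℝ 2 (S.f k)
  f_growth : ∃ F₁ F₂ : ℝ, ∀ (k : Fin m) (y : Leaders d m),
    inner ℝ (S.f k y) (y k) ≤ F₁ * ‖y‖ ^ 2 + F₂
  U_compact : IsCompact S.U
  U_convex : Convex ℝ S.U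
  gamma_strictConvex : StrictConvexOn ℝ S.U S.gamma
  gamma_lsc : LowerSemicontinuousOn S.gamma S.U

/-- Lebesgue measure on the time interval `[0, T]`. -/
abbrev timeMeasure (T : ℝ) : Measure ℝ := volume.restrict (Icc 0 T)

/-- The space `L¹([0, T]; U)` of controls: classes of integrable functions with values in `U`
almost everywhere. -/
def Control (D : ℕ) (T : ℝ) (U : Set (Eu D)) : Type :=
  {u : Lp (Eu D) 1 (timeMeasure T) // ∀ᵐ t ∂(timeMeasure T), u t ∈ U}

/-- `L¹([0, T]; U)` carries the weak topology of `L¹`. -/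
instance (T : ℝ) (U : Set (Eu D)) : TopologicalSpace (Control D T U) :=
  TopologicalSpace.induced
    (fun u => toWeakSpace ℝ (Lp (Eu D) 1 (timeMeasure T)) u.1) inferInstance

/-- The running state cost `L(y, μ) = ∫ ℓ(y, x, ∫ ω dμ) dμ(x)`. -/
def Data.L (S : Data d m D) (y : Leaders d m) (μ : Measure (Eu d)) : ℝ :=
  ∫ x, S.ell (y, x, ∫ z, S.omega z ∂μ) ∂μ

/-- The cost `∫_0^T [L(y(t), μ(t)) + γ(u(t))] dt` of a control together with a trajectory. -/
def Data.cost (S : Data d m D) (T : ℝ) (u : Control D T S.U) (y : ℝ → Leaders d m)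
    (μ : ℝ → Measure (Eu d)) : EReal :=
  extIntegral (timeMeasure T) (fun t => S.L (y t) (μ t) + S.gamma (u.1 t))

/-- Solutions on `[0, T]` of the mean-field system
`y_k' = (K ⋆ μ)(y_k) + f_k(y) + B_k u`, `∂_t μ = -∇·((K ⋆ μ + g(y)) μ)` with initial datum
`(y⁰, μ⁰)`. Only the values at times in `[0, T]` are relevant. -/
structure Data.IsMeanFieldSol (S : Data d m D) (T : ℝ) (y0 : Leaders d m)
    (mu0 : ProbabilityMeasure (Eu d)) (u : Control D T S.U)
    (y : ℝ → Leaders d m) (μ : ℝ → ProbabilityMeasure (Eu d)) : Prop where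
  init_y : y 0 = y0
  init_mu : μ 0 = mu0
  y_cont : ContinuousOn y (Icc 0 T)
  mu_cont : ∀ t ∈ Icc 0 T,
    Tendsto (fun s => W1 (μ s : Measure (Eu d)) (μ t : Measure (Eu d))) (𝓝[Icc 0 T] t) (𝓝 0)
  mu_supp : ∃ R : ℝ, ∀ t ∈ Icc 0 T, (μ t : Measure (Eu d)).support ⊆ Metric.ball 0 R
  /-- The leaders form a Carathéodory solution, written in integral form. -/
  y_eq : ∀ t ∈ Icc 0 T, ∀ k, y t k = y0 k +
    ∫ s in (0 : ℝ)..t, (conv S.K (μ s : Measure (Eu d)) (y s k) + S.f k (y s) + S.B k (u.1 s))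
  /-- The continuity equation holds in the weak sense. -/
  mu_eq : ∀ φ : Eu d → ℝ, ContDiff ℝ ∞ φ → HasCompactSupport φ → ∀ t ∈ Icc 0 T,
    HasDerivWithinAt (fun s => ∫ x, φ x ∂(μ s : Measure (Eu d)))
      (∫ x, fderiv ℝ φ x (conv S.K (μ t : Measure (Eu d)) x + S.g (y t) x)
        ∂(μ t : Measure (Eu d)))
      (Icc 0 T) t

/-- (Carathéodory) solutions on `[0, T]` of the system with `m` leaders and `N` followers
`y_k' = (1/N) ∑_j K(y_k - x_j) + f_k(y) + B_k u`, `x_i' = (1/N) ∑_j K(x_i - x_j) + g(y)(x_i)`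
with initial datum `(y⁰, x⁰)`, written in integral form. -/
structure Data.IsParticleSol (S : Data d m D) (T : ℝ) {N : ℕ} (y0 : Leaders d m)
    (x0 : Fin N → Eu d) (u : Control D T S.U)
    (y : ℝ → Leaders d m) (x : ℝ → Fin N → Eu d) : Prop where
  y_cont : ContinuousOn y (Icc 0 T)
  x_cont : ContinuousOn x (Icc 0 T)
  y_eq : ∀ t ∈ Icc 0 T, ∀ k, y t k = y0 k +
    ∫ s in (0 : ℝ)..t,
      ((N : ℝ)⁻¹ • (∑ j, S.K (y s k - x s j)) + S.f k (y s) + S.B k (u.1 s))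
  x_eq : ∀ t ∈ Icc 0 T, ∀ i, x t i = x0 i +
    ∫ s in (0 : ℝ)..t, ((N : ℝ)⁻¹ • (∑ j, S.K (x s i - x s j)) + S.g (y s) (x s i))

open Classical in
/-- The mean-field cost `F(u)`: the cost of the solution of the mean-field system with control
`u` (a conventional value if there were none). -/
def Data.F (S : Data d m D) (T : ℝ) (y0 : Leaders d m) (mu0 : ProbabilityMeasure (Eu d))
    (u : Control D T S.U) : EReal :=
  if h : ∃ p : (ℝ → Leaders d m) × (ℝ → ProbabilityMeasure (Eu d)),
      S.IsMeanFieldSol T y0 mu0 u p.1 p.2 then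
    S.cost T u h.choose.1 (fun t => (h.choose.2 t : Measure (Eu d)))
  else ⊤

open Classical in
/-- The finite-dimensional cost `F_N(u)`: the cost of the solution of the system with `N`
followers and control `u`, its measure component being the empirical measure of the followers
(a conventional value if there were no solution). -/
def Data.FN (S : Data d m D) (T : ℝ) {N : ℕ} (y0 : Leaders d m) (x0 : Fin N → Eu d)
    (u : Control D T S.U) : EReal :=
  if h : ∃ p : (ℝ → Leaders d m) × (ℝ → Fin N → Eu d),
      S.IsParticleSol T y0 x0 u p.1 p.2 then
    S.cost T u h.choose.1 (fun t => empirical (h.choose.2 t))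
  else ⊤

/-- (Sequential) `Γ`-convergence of a sequence of functionals with values in `(-∞, ∞]`. -/
structure GammaConverges {X : Type*} [TopologicalSpace X] (F : ℕ → X → EReal) (G : X → EReal) :
    Prop where
  ne_bot_seq : ∀ N u, F N u ≠ ⊥
  ne_bot_lim : ∀ u, G u ≠ ⊥
  liminf_ineq : ∀ (u : X) (v : ℕ → X), Tendsto v atTop (𝓝 u) →
    G u ≤ liminf (fun N => F N (v N)) atTop
  limsup_ineq : ∀ u : X, ∃ v : ℕ → X, Tendsto v atTop (𝓝 u) ∧
    limsup (fun N => F N (v N)) atTop ≤ G u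

end MeanFieldControl

end

/-!
Both systems are the same ordinary differential equation in a Banach space. Label the followers by
a compact set `Ω` containing all initial positions and describe them by a flow `X ∈ C(Ω, ℝ^d)`,
`X(θ)` being the position of the follower that started at `θ`. For a probability measure `P` on `Ω`
the pair `z = (y, X)` obeys the integral equation with vector field `meanField hS P`, where the
interaction is `K ⋆ (P.map X)`; the control enters through its primitive only (`Data.forcing`).
If `P` is uniform on `N` labels this is the particle system (`IsSol.isParticleSol`), and if `P` is
`μ⁰` itself it is the characteristic system of the mean-field equation (`IsSol.isMeanFieldSol`).

The field is Lipschitz on balls, uniformly in `P`. The growth hypotheses are one-sided, so they give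
no linear bound on the field; they do bound the growth of `√(1 + ‖z‖²)` along solutions, even for the
sup norm of `C(Ω, ℝ^d)`, because `‖z + h v‖²` can be estimated label by label (`OutwardBound`,
`OutwardBound.prod`). This gives global solutions (`exists_isSol`), bounds that are uniform in the
control and in `P`, and a Grönwall estimate for the dependence on field and forcing
(`IsSol.norm_sub_le`).

That every solution of the mean-field system comes from a flow is the uniqueness for the continuity
equation: given a solution `(y, μ)`, its velocity field generates a flow, and `μ` and the image of
`μ⁰` under that flow solve the same linear continuity equation. Solutions of such an equation are
unique (`IsWeakSol.unique`): testing at time `s + h` with `ψ` amounts to testing at time `s` with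
`ψ ∘ (id + h b(s))`, up to an error `o(h)` that is controlled by `C²` bounds for `ψ`, and
these bounds grow under the composition by a factor `1 + O(h)` only (`C2Bound.comp_add_smul`).

For the `Γ`-convergence, `P_N → P` narrowly on `Ω` and `u_N → u` weakly make fields and forcings
converge, uniformly where needed because they are equi-Lipschitz on compact sets
(`tendsto_meanField`, `tendstoUniformlyOn_forcing`). Hence the solutions converge uniformly
(`tendstoUniformlyOn_isSol`) and the state costs converge (`tendsto_integral_L`). The control cost
does not depend on `N` and is weakly lower semicontinuous, its sublevel sets being convex and, by
Fatou's lemma, closed (`lintegral_le_liminf_of_tendsto_weak`). A continuously convergent sequence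
plus a fixed lower semicontinuous functional `Γ`-converges, with constant recovery sequences
(`gammaConverges_add`).
-/

open scoped NNReal

noncomputable section

set_option linter.unusedSectionVars false

namespace MeanFieldControl

/-! ### Integral equations in Banach spaces -/

section Banach

variable {Z : Type*} [NormedAddCommGroup Z] [NormedSpace ℝ Z]

theorem hasDerivWithinAt_integral_Icc [CompleteSpace Z] {T : ℝ} {f : ℝ → Z}
    (hf : ContinuousOn f (Icc 0 T)) {t : ℝ} (ht : t ∈ Icc 0 T) :
    HasDerivWithinAt (fun t => ∫ s in (0 : ℝ)..t, f s) (f t) (Icc 0 T) t := by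
  have hT : 0 ≤ T := ht.1.trans ht.2
  have hg : Continuous (fun s => f (projIcc 0 T hT s)) :=
    hf.comp_continuous (continuous_subtype_val.comp continuous_projIcc) fun s => (projIcc 0 T hT s).2
  have heq : ∀ s ∈ Icc 0 T, f (projIcc 0 T hT s) = f s := fun s hs => by
    rw [projIcc_of_mem hT hs]
  have h1 := (hg.integral_hasStrictDerivAt 0 t).hasDerivAt.hasDerivWithinAt (s := Icc 0 T)
  rw [heq t ht] at h1
  refine h1.congr_of_mem (fun r hr => ?_) ht
  refine intervalIntegral.integral_congr fun s hs => ?_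
  rw [uIcc_of_le hr.1] at hs
  exact (heq s ⟨hs.1, hs.2.trans hr.2⟩).symm

/-- `z` solves on `[0, T]` the integral equation `z(t) = z₀ + ∫_0^t A(s, z(s)) ds + β(t)`. -/
structure IsSol (A : ℝ → Z → Z) (β : ℝ → Z) (z0 : Z) (T : ℝ) (z : ℝ → Z) : Prop where
  cont : ContinuousOn z (Icc 0 T)
  eq : ∀ t ∈ Icc 0 T, z t = z0 + (∫ s in (0 : ℝ)..t, A s (z s)) + β t

/-- Uniform convergence on a compact set follows from pointwise convergence for functions with a
common Lipschitz constant. -/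
theorem tendstoUniformlyOn_of_lipschitz {X Y : Type*} [PseudoMetricSpace X] [PseudoMetricSpace Y]
    {s : Set X} (hs : IsCompact s) {F : ℕ → X → Y} {f : X → Y} {C : ℝ≥0}
    (hF : ∀ n, LipschitzOnWith C (F n) s) (hf : LipschitzOnWith C f s)
    (h : ∀ x ∈ s, Tendsto (fun n => F n x) atTop (𝓝 (f x))) :
    TendstoUniformlyOn F f atTop s := by
  rw [Metric.tendstoUniformlyOn_iff]
  intro ε hε
  have hδ : 0 < ε / (3 * (C + 1)) := by positivity
  obtain ⟨t, hts, htf, hcov⟩ := Metric.finite_approx_of_totallyBounded hs.totallyBounded _ hδ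
  have hall : ∀ᶠ n in atTop, ∀ y ∈ t, dist (F n y) (f y) < ε / 3 :=
    (htf.eventually_all).2 fun y hy => Metric.tendsto_nhds.1 (h y (hts hy)) _ (by positivity)
  filter_upwards [hall] with n hn x hx
  obtain ⟨y, hy, hxy⟩ := mem_iUnion₂.1 (hcov hx)
  rw [Metric.mem_ball] at hxy
  have hC : (C : ℝ) * dist x y ≤ ε / 3 := by
    have h1 : (C : ℝ) * dist x y ≤ (C + 1) * (ε / (3 * (C + 1))) := by gcongr; linarith
    have h2 : ((C : ℝ) + 1) * (ε / (3 * (C + 1))) = ε / 3 := by field_simp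
    linarith
  have h1 := hf.dist_le_mul x hx y (hts hy)
  have h2 := (hF n).dist_le_mul x hx y (hts hy)
  have h3 := hn y hy
  have h4 := dist_triangle4 (f x) (f y) (F n y) (F n x)
  rw [dist_comm (f y) (F n y), dist_comm (F n y) (F n x)] at h4
  linarith

/-- The direction `v` at `z` points outwards at a rate of at most `C (1 + ‖z‖²)`. In an inner
product space this is `⟪v, z⟫ ≤ C (1 + ‖z‖²)`; the present form makes sense for a supremum norm. -/
def OutwardBound (C : ℝ) (z v : Z) : Prop :=
  ∀ h : ℝ, 0 ≤ h → 1 + ‖z + h • v‖ ^ 2 ≤ (1 + 2 * h * C) * (1 + ‖z‖ ^ 2) + h ^ 2 * ‖v‖ ^ 2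

theorem OutwardBound.smul {C : ℝ} (hC : 0 ≤ C) {z v : Z} (h : OutwardBound C z v) {c : ℝ}
    (hc : 0 ≤ c) (hc1 : c ≤ 1) : OutwardBound C z (c • v) := by
  intro k hk
  have h1 := h (k * c) (by positivity)
  rw [smul_smul, norm_smul, Real.norm_of_nonneg hc]
  have h2 : 2 * (k * c) * C * (1 + ‖z‖ ^ 2) ≤ 2 * k * C * (1 + ‖z‖ ^ 2) := by
    have : k * c ≤ k * 1 := by gcongr
    have : k * c ≤ k := by linarith
    gcongr
  nlinarith [h1, h2]

theorem sqrt_one_add_norm_sq_le {V : Type*} [NormedAddCommGroup V] (a b : V) :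
    √(1 + ‖a + b‖ ^ 2) ≤ √(1 + ‖a‖ ^ 2) + ‖b‖ := by
  have h0 : 0 ≤ √(1 + ‖a‖ ^ 2) := Real.sqrt_nonneg _
  have h1 : √(1 + ‖a‖ ^ 2) ^ 2 = 1 + ‖a‖ ^ 2 := Real.sq_sqrt (by positivity)
  have h2 : ‖a‖ ≤ √(1 + ‖a‖ ^ 2) := Real.le_sqrt_of_sq_le (by linarith)
  have h3 := norm_add_le a b
  rw [Real.sqrt_le_left (by positivity)]
  have h4 : ‖a + b‖ ^ 2 ≤ (‖a‖ + ‖b‖) ^ 2 := by gcongr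
  nlinarith [norm_nonneg b, mul_le_mul_of_nonneg_right h2 (norm_nonneg b)]

/-- A priori bound: outward growth controls the solutions, whatever the (Lipschitz) forcing. The
function `√(1 + ‖z‖²)` need not be differentiable, but its upper right difference quotients are at
most `C √(1 + ‖z‖²) + M`. -/
theorem IsSol.sqrt_le_gronwallBound [CompleteSpace Z] {A : ℝ → Z → Z} {β : ℝ → Z} {z0 : Z}
    {T : ℝ} {z : ℝ → Z} {C M : ℝ} (hz : IsSol A β z0 T z)
    (hβ0 : β 0 = 0) (hβ : ∀ s ∈ Icc 0 T, ∀ t ∈ Icc 0 T, ‖β t - β s‖ ≤ M * |t - s|)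
    (hA : ContinuousOn (fun s => A s (z s)) (Icc 0 T))
    (hC : 0 ≤ C) (hO : ∀ s ∈ Icc 0 T, OutwardBound C (z s) (A s (z s))) :
    ∀ t ∈ Icc 0 T, √(1 + ‖z t‖ ^ 2) ≤ gronwallBound (√(1 + ‖z0‖ ^ 2)) C M t := by
  intro t ht
  have hT : 0 ≤ T := ht.1.trans ht.2
  have key := le_gronwallBound_of_liminf_deriv_right_le (f := fun s => √(1 + ‖z s‖ ^ 2))
    (f' := fun s => C * √(1 + ‖z s‖ ^ 2) + M) (δ := √(1 + ‖z0‖ ^ 2)) (K := C) (ε := M)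
    (a := 0) (b := T) ?_ ?_ ?_ (fun x _ => le_rfl) t ht
  · simpa using key
  · exact ((continuousOn_const.add (hz.cont.norm.pow 2))).sqrt
  · intro x hx r hr
    have hxI : x ∈ Icc 0 T := Ico_subset_Icc_self hx
    set q := √(1 + ‖z x‖ ^ 2) with hq
    set a := A x (z x) with ha
    have hq1 : 1 ≤ q := Real.le_sqrt_of_sq_le (by nlinarith [sq_nonneg ‖z x‖])
    have hq2 : q ^ 2 = 1 + ‖z x‖ ^ 2 := Real.sq_sqrt (by positivity)
    set η := r - (C * q + M) with hη
    have hηpos : 0 < η := sub_pos.2 hr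
    have hder := (hasDerivWithinAt_integral_Icc hA hxI).mono_of_mem_nhdsWithin
      (Icc_mem_nhdsGT_of_mem hx)
    have hlo := (hasDerivWithinAt_iff_isLittleO.1 hder).def (c := η / 3) (by positivity)
    have hsmall : ∀ᶠ y in 𝓝[>] x, (y - x) * ‖a‖ ^ 2 < η / 3 := by
      have : Tendsto (fun y => (y - x) * ‖a‖ ^ 2) (𝓝[>] x) (𝓝 ((x - x) * ‖a‖ ^ 2)) :=
        ((continuous_id.sub continuous_const).mul continuous_const).continuousWithinAt
      rw [sub_self, zero_mul] at this
      exact this.eventually (gt_mem_nhds (by positivity))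
    -- The outward bound estimates one Euler step from `z x`; the rest is `o(y - x)` or forcing.
    refine Eventually.frequently ?_
    filter_upwards [hlo, hsmall, self_mem_nhdsWithin, Icc_mem_nhdsGT_of_mem hx] with y h1 h2 h3 h4
    have hy : 0 < y - x := sub_pos.2 h3
    rw [Real.norm_of_nonneg hy.le] at h1
    have e1 : z y = (z x + (y - x) • a) + (((∫ s in (0 : ℝ)..y, A s (z s)) -
        (∫ s in (0 : ℝ)..x, A s (z s)) - (y - x) • a) + (β y - β x)) := by
      rw [hz.eq y h4, hz.eq x hxI]; abel
    have e2 := hβ x hxI y h4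
    rw [abs_of_pos hy] at e2
    have e3 : √(1 + ‖z y‖ ^ 2) ≤ √(1 + ‖z x + (y - x) • a‖ ^ 2)
        + (η / 3 * (y - x) + M * (y - x)) := by
      rw [e1]
      refine (sqrt_one_add_norm_sq_le _ _).trans ?_
      gcongr
      exact (norm_add_le _ _).trans (add_le_add h1 e2)
    have e4 : √(1 + ‖z x + (y - x) • a‖ ^ 2) ≤ q + (y - x) * C * q + (y - x) ^ 2 * ‖a‖ ^ 2 := by
      have h0 := hO x hxI (y - x) hy.le
      rw [Real.sqrt_le_left (by positivity)]
      rw [← hq2] at h0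
      have h5 : 0 ≤ (y - x) * C * q := by positivity
      have h6 : 0 ≤ (y - x) ^ 2 * ‖a‖ ^ 2 := by positivity
      have h7 : (y - x) ^ 2 * ‖a‖ ^ 2 ≤ q * ((y - x) ^ 2 * ‖a‖ ^ 2) := le_mul_of_one_le_left h6 hq1
      nlinarith [mul_nonneg h5 h6, mul_nonneg h5 h5, mul_nonneg h6 h6]
    have e5 : √(1 + ‖z y‖ ^ 2) - q < r * (y - x) := by
      have : (y - x) * ((y - x) * ‖a‖ ^ 2) < (y - x) * (η / 3) := by gcongr
      have : r = η + (C * q + M) := by rw [hη]; ring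
      rw [this]
      nlinarith
    rw [inv_mul_lt_iff₀ hy]
    linarith
  · have h0 := hz.eq 0 ⟨le_rfl, hT⟩
    simp only [intervalIntegral.integral_same, hβ0, add_zero] at h0
    rw [h0]

/-- Time-dependent vector fields on `[0, T]` with global solutions: continuous in time, Lipschitz
on bounded sets, and with controlled outward growth. -/
structure IsTame (A : ℝ → Z → Z) (T C : ℝ) : Prop where
  cont : ∀ z, ContinuousOn (fun t => A t z) (Icc 0 T)
  lip : ∀ R, ∃ L : ℝ≥0, ∀ t ∈ Icc 0 T, LipschitzOnWith L (A t) (Metric.closedBall 0 R)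
  nonneg : 0 ≤ C
  outward : ∀ t ∈ Icc 0 T, ∀ z, OutwardBound C z (A t z)

theorem exists_norm_le_of_continuousOn {V : Type*} [NormedAddCommGroup V] {T : ℝ} {z : ℝ → V}
    (hz : ContinuousOn z (Icc 0 T)) : ∃ R, ∀ t ∈ Icc 0 T, ‖z t‖ ≤ R :=
  isCompact_Icc.exists_bound_of_continuousOn hz

theorem IsTame.continuousOn_comp {A : ℝ → Z → Z} {T C : ℝ} (hA : IsTame A T C) {z : ℝ → Z}
    (hz : ContinuousOn z (Icc 0 T)) : ContinuousOn (fun s => A s (z s)) (Icc 0 T) := by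
  obtain ⟨R, hR⟩ := exists_norm_le_of_continuousOn hz
  obtain ⟨L, hL⟩ := hA.lip R
  intro s hs
  have h1 : Tendsto (fun r => L * dist (z r) (z s) + dist (A r (z s)) (A s (z s)))
      (𝓝[Icc 0 T] s) (𝓝 (L * dist (z s) (z s) + dist (A s (z s)) (A s (z s)))) :=
    ((tendsto_const_nhds.mul ((hz s hs).tendsto.dist tendsto_const_nhds))).add
      ((hA.cont (z s) s hs).tendsto.dist tendsto_const_nhds)
  simp only [dist_self, mul_zero, add_zero] at h1
  refine tendsto_iff_dist_tendsto_zero.2 (squeeze_zero' (Eventually.of_forall fun _ => dist_nonneg)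
    ?_ h1)
  filter_upwards [self_mem_nhdsWithin] with r hr
  refine (dist_triangle _ (A r (z s)) _).trans ?_
  gcongr
  exact (hL r hr).dist_le_mul _ (by simpa using hR r hr) _ (by simpa using hR s hs)

theorem lipschitzWith_cutoff {V : Type*} [NormedAddCommGroup V] (R : ℝ) :
    LipschitzWith 1 (fun z : V => max 0 (min 1 (R + 1 - ‖z‖))) := by
  have : LipschitzWith 1 (fun z : V => R + 1 - ‖z‖) := by
    refine LipschitzWith.of_dist_le_mul fun x y => ?_
    rw [Real.dist_eq, dist_eq_norm]
    simpa [abs_sub_comm] using abs_norm_sub_norm_le x y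
  exact (this.const_min 1).const_max 0

/-- Truncation outside a ball turns a field which is Lipschitz on bounded sets into a globally
Lipschitz bounded one. -/
theorem lipschitzWith_cutoff_smul {R M : ℝ} {L : ℝ≥0} {A : Z → Z} (hM : 0 ≤ M)
    (hL : LipschitzOnWith L A (Metric.closedBall 0 (R + 1)))
    (hb : ∀ z ∈ Metric.closedBall (0 : Z) (R + 1), ‖A z‖ ≤ M) :
    LipschitzWith (M.toNNReal + L) (fun z => max 0 (min 1 (R + 1 - ‖z‖)) • A z) := by
  have key : ∀ x y : Z, ‖y‖ ≤ ‖x‖ → ‖max 0 (min 1 (R + 1 - ‖x‖)) • A x -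
      max 0 (min 1 (R + 1 - ‖y‖)) • A y‖ ≤ (M + L) * ‖x - y‖ := by
    intro x y hxy
    have hc := (lipschitzWith_cutoff (V := Z) R).dist_le_mul x y
    rw [Real.dist_eq, dist_eq_norm, NNReal.coe_one, one_mul] at hc
    have hLn : 0 ≤ (L : ℝ) * ‖x - y‖ := by positivity
    by_cases hx : ‖x‖ ≤ R + 1
    · have hy : ‖y‖ ≤ R + 1 := hxy.trans hx
      have e : max 0 (min 1 (R + 1 - ‖x‖)) • A x - max 0 (min 1 (R + 1 - ‖y‖)) • A y =
          max 0 (min 1 (R + 1 - ‖x‖)) • (A x - A y) +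
          (max 0 (min 1 (R + 1 - ‖x‖)) - max 0 (min 1 (R + 1 - ‖y‖))) • A y := by
        rw [smul_sub, sub_smul]; abel
      rw [e]
      refine (norm_add_le _ _).trans ?_
      rw [norm_smul, norm_smul, Real.norm_of_nonneg (le_max_left _ _), Real.norm_eq_abs]
      have h1 : max 0 (min 1 (R + 1 - ‖x‖)) ≤ 1 := max_le zero_le_one (min_le_left _ _)
      have h2 := hL.dist_le_mul x (by simpa using hx) y (by simpa using hy)
      rw [dist_eq_norm, dist_eq_norm] at h2
      have h3 := hb y (by simpa using hy)
      have h4 : max 0 (min 1 (R + 1 - ‖x‖)) * ‖A x - A y‖ ≤ 1 * (L * ‖x - y‖) := by gcongr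
      have h5 : |max 0 (min 1 (R + 1 - ‖x‖)) - max 0 (min 1 (R + 1 - ‖y‖))| * ‖A y‖ ≤
          ‖x - y‖ * M := by gcongr
      linarith
    · have hx0 : max 0 (min 1 (R + 1 - ‖x‖)) = 0 :=
        max_eq_left (min_le_of_right_le (by linarith))
      rw [hx0] at hc ⊢
      by_cases hy : ‖y‖ ≤ R + 1
      · rw [zero_smul, zero_sub, norm_neg, norm_smul, Real.norm_of_nonneg (le_max_left _ _)]
        rw [zero_sub, abs_neg, abs_of_nonneg (le_max_left _ _)] at hc
        have h3 := hb y (by simpa using hy)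
        have : max 0 (min 1 (R + 1 - ‖y‖)) * ‖A y‖ ≤ ‖x - y‖ * M := by gcongr
        linarith
      · have hy0 : max 0 (min 1 (R + 1 - ‖y‖)) = 0 :=
          max_eq_left (min_le_of_right_le (by linarith))
        rw [hy0]
        simp only [zero_smul, sub_self, norm_zero]
        positivity
  refine LipschitzWith.of_dist_le_mul fun x y => ?_
  rw [NNReal.coe_add, Real.coe_toNNReal _ hM]
  rcases le_total ‖y‖ ‖x‖ with h | h
  · simpa only [dist_eq_norm] using key x y h
  · rw [dist_comm, dist_comm x y]
    simpa only [dist_eq_norm] using key y x h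

theorem gronwallBound_le_of_mem_Icc {δ K ε T t : ℝ} (hδ : 0 ≤ δ) (hε : 0 ≤ ε) (hK : 0 ≤ K)
    (ht : t ∈ Icc 0 T) : gronwallBound δ K ε t ≤ gronwallBound δ K ε T :=
  gronwallBound_mono hδ hε hK ht.2

theorem norm_le_sqrt_one_add_sq {V : Type*} [NormedAddCommGroup V] (z : V) :
    ‖z‖ ≤ √(1 + ‖z‖ ^ 2) :=
  Real.le_sqrt_of_sq_le (by linarith)

theorem IsSol.norm_le [CompleteSpace Z] {A : ℝ → Z → Z} {β : ℝ → Z} {z0 : Z}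
    {T : ℝ} {z : ℝ → Z} {C M : ℝ} (hA : IsTame A T C) (hM : 0 ≤ M) (hz : IsSol A β z0 T z)
    (hβ0 : β 0 = 0) (hβ : ∀ s ∈ Icc 0 T, ∀ t ∈ Icc 0 T, ‖β t - β s‖ ≤ M * |t - s|) :
    ∀ t ∈ Icc 0 T, ‖z t‖ ≤ gronwallBound (√(1 + ‖z0‖ ^ 2)) C M T := fun t ht =>
  (norm_le_sqrt_one_add_sq _).trans <|
    (hz.sqrt_le_gronwallBound hβ0 hβ (hA.continuousOn_comp hz.cont) hA.nonneg
      (fun s hs => hA.outward s hs _) t ht).trans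
      (gronwallBound_le_of_mem_Icc (Real.sqrt_nonneg _) hM hA.nonneg ht)

/-- Global existence: the field is truncated outside the ball given by the a priori bound, the
forcing `β` is removed by the substitution `z = w + β`, and the equation for `w` is solved by the
Picard–Lindelöf theorem. -/
theorem exists_isSol [CompleteSpace Z] {A : ℝ → Z → Z} {β : ℝ → Z} (z0 : Z)
    {T : ℝ} {C M : ℝ} (hT : 0 ≤ T) (hA : IsTame A T C) (hM : 0 ≤ M)
    (hβ0 : β 0 = 0) (hβ : ∀ s ∈ Icc 0 T, ∀ t ∈ Icc 0 T, ‖β t - β s‖ ≤ M * |t - s|) :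
    ∃ z, IsSol A β z0 T z := by
  set R := gronwallBound (√(1 + ‖z0‖ ^ 2)) C M T with hR
  obtain ⟨L, hL⟩ := hA.lip (R + 1)
  have h0T : (0 : ℝ) ∈ Icc 0 T := ⟨le_rfl, hT⟩
  have hR0 : 0 ≤ R := (Real.sqrt_nonneg _).trans <| by
    have := gronwallBound_le_of_mem_Icc (Real.sqrt_nonneg (1 + ‖z0‖ ^ 2)) hM hA.nonneg h0T
    rwa [gronwallBound_x0] at this
  obtain ⟨M0, hM0⟩ := isCompact_Icc.exists_bound_of_continuousOn (hA.cont 0)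
  have hM00 : 0 ≤ M0 := (norm_nonneg _).trans (hM0 0 h0T)
  have hbd : ∀ t ∈ Icc 0 T, ∀ z ∈ Metric.closedBall (0 : Z) (R + 1),
      ‖A t z‖ ≤ M0 + L * (R + 1) := by
    intro t ht z hz
    have h1 := (hL t ht).dist_le_mul z hz 0 (by simp; linarith)
    rw [dist_eq_norm, dist_zero_right] at h1
    have h2 : (L : ℝ) * ‖z‖ ≤ L * (R + 1) := by
      gcongr; simpa using hz
    have h3 := norm_le_insert' (A t z) (A t 0)
    linarith [hM0 t ht]
  set B := M0 + L * (R + 1) with hB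
  have hB0 : 0 ≤ B := by positivity
  set χ : Z → ℝ := fun z => max 0 (min 1 (R + 1 - ‖z‖)) with hχ
  have hχ0 : ∀ z, 0 ≤ χ z := fun z => le_max_left _ _
  have hχ1 : ∀ z, χ z ≤ 1 := fun z => max_le zero_le_one (min_le_left _ _)
  set A' : ℝ → Z → Z := fun t z => χ z • A t z with hA'
  have hA'lip : ∀ t ∈ Icc 0 T, LipschitzWith (B.toNNReal + L) (A' t) := fun t ht =>
    lipschitzWith_cutoff_smul hB0 (hL t ht) (hbd t ht)
  have hA'bd : ∀ t ∈ Icc 0 T, ∀ z, ‖A' t z‖ ≤ B := by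
    intro t ht z
    by_cases hz : ‖z‖ ≤ R + 1
    · rw [hA', norm_smul, Real.norm_of_nonneg (hχ0 z)]
      have := hbd t ht z (by simpa using hz)
      have h2 : χ z * ‖A t z‖ ≤ 1 * B := by gcongr; exact hχ1 z
      linarith
    · have : χ z = 0 := max_eq_left (min_le_of_right_le (by linarith))
      simp only [hA', this, zero_smul, norm_zero, hB0]
  have hA't : IsTame A' T C :=
    { cont := fun z => (hA.cont z).const_smul (χ z)
      lip := fun _ => ⟨_, fun t ht => (hA'lip t ht).lipschitzOnWith⟩
      nonneg := hA.nonneg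
      outward := fun t ht z => (hA.outward t ht z).smul hA.nonneg (hχ0 z) (hχ1 z) }
  have hβc : ContinuousOn β (Icc 0 T) := by
    refine (LipschitzOnWith.of_dist_le_mul (K := M.toNNReal) fun x hx y hy => ?_).continuousOn
    rw [Real.coe_toNNReal _ hM, dist_eq_norm, Real.dist_eq]
    exact hβ y hy x hx
  have hPL : IsPicardLindelof (fun t w => A' t (w + β t)) (tmin := 0) (tmax := T) ⟨0, h0T⟩ z0
      (B * T).toNNReal 0 B.toNNReal (B.toNNReal + L) :=
    { lipschitzOnWith := fun t ht => by
        have := ((hA'lip t ht).comp (LipschitzWith.id.add (LipschitzWith.const (β t))))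
        simpa [Function.comp_def] using this.lipschitzOnWith
      continuousOn := fun x _ => hA't.continuousOn_comp (continuousOn_const.add hβc)
      norm_le := fun t ht x _ => by
        rw [Real.coe_toNNReal _ hB0]; exact hA'bd t ht _
      mul_max_le := by
        have : 0 ≤ B * T := by positivity
        simp [Real.coe_toNNReal _ hB0, Real.coe_toNNReal _ this, hT] }
  obtain ⟨w, hw0, hw⟩ := hPL.exists_eq_forall_mem_Icc_hasDerivWithinAt₀
  have hwc : ContinuousOn w (Icc 0 T) := fun t ht => (hw t ht).continuousWithinAt
  have hzc : ContinuousOn (fun t => w t + β t) (Icc 0 T) := hwc.add hβc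
  have hz' : IsSol A' β z0 T (fun t => w t + β t) := by
    refine ⟨hzc, fun t ht => ?_⟩
    have hsub : Icc 0 t ⊆ Icc 0 T := Icc_subset_Icc_right ht.2
    have := intervalIntegral.integral_eq_sub_of_hasDeriv_right_of_le (a := 0) (b := t) (f := w)
      (f' := fun s => A' s (w s + β s)) ht.1 (hwc.mono hsub)
      (fun s hs => ((hw s (hsub (Ioo_subset_Icc_self hs))).mono_of_mem_nhdsWithin
        (Icc_mem_nhdsGT_of_mem ⟨hs.1.le, hs.2.trans_le ht.2⟩)))
      (((hA't.continuousOn_comp hzc).mono hsub).intervalIntegrable_of_Icc ht.1)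
    rw [this, show w 0 = z0 from hw0]; abel
  -- The a priori bound also holds for the truncated field, so the truncation is never active.
  refine ⟨fun t => w t + β t, hzc, fun t ht => ?_⟩
  rw [hz'.eq t ht]
  congr 2
  refine intervalIntegral.integral_congr fun s hs => ?_
  rw [uIcc_of_le ht.1] at hs
  have hn := hz'.norm_le hA't hM hβ0 hβ s ⟨hs.1, hs.2.trans ht.2⟩
  have : χ (w s + β s) = 1 := by
    simp only [hχ]
    rw [min_eq_left (by linarith), max_eq_right zero_le_one]
  simp only [hA', this, one_smul]

/-- Stability: two solutions stay close if the second one almost solves the first equation and the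
forcings are close. -/
theorem IsSol.norm_sub_le [CompleteSpace Z] {A A' : ℝ → Z → Z} {β β' : ℝ → Z} {z0 : Z}
    {T R ε ε' : ℝ} {L : ℝ≥0} {z z' : ℝ → Z} (hz : IsSol A β z0 T z) (hz' : IsSol A' β' z0 T z')
    (hAc : ContinuousOn (fun s => A s (z s)) (Icc 0 T))
    (hAc' : ContinuousOn (fun s => A' s (z' s)) (Icc 0 T))
    (hR : ∀ t ∈ Icc 0 T, ‖z t‖ ≤ R) (hR' : ∀ t ∈ Icc 0 T, ‖z' t‖ ≤ R)
    (hL : ∀ t ∈ Icc 0 T, LipschitzOnWith L (A t) (Metric.closedBall 0 R))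
    (hε : ∀ t ∈ Icc 0 T, ‖A t (z' t) - A' t (z' t)‖ ≤ ε)
    (hε' : ∀ t ∈ Icc 0 T, ‖β t - β' t‖ ≤ ε') :
    ∀ t ∈ Icc 0 T, ‖z t - z' t‖ ≤ gronwallBound 0 L (L * ε' + ε) t + ε' := by
  intro t ht
  -- Grönwall is applied to the difference without forcings, which is differentiable.
  set w : ℝ → Z := fun t => (∫ s in (0 : ℝ)..t, A s (z s)) - ∫ s in (0 : ℝ)..t, A' s (z' s) with hw
  have hdiff : ∀ s ∈ Icc 0 T, z s - z' s = w s + (β s - β' s) := fun s hs => by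
    simp only [hz.eq s hs, hz'.eq s hs, hw]; abel
  have hwd : ∀ s ∈ Icc 0 T, HasDerivWithinAt w (A s (z s) - A' s (z' s)) (Icc 0 T) s := fun s hs =>
    (hasDerivWithinAt_integral_Icc hAc hs).sub (hasDerivWithinAt_integral_Icc hAc' hs)
  have key := norm_le_gronwallBound_of_norm_deriv_right_le (f := w)
    (f' := fun s => A s (z s) - A' s (z' s)) (δ := 0) (K := L) (ε := L * ε' + ε) (a := 0) (b := T)
    (fun s hs => (hwd s hs).continuousWithinAt)
    (fun s hs => (hwd s (Ico_subset_Icc_self hs)).mono_of_mem_nhdsWithin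
      (Icc_mem_nhdsGE_of_mem hs)) (by simp [hw]) (fun s hs => ?_) t ht
  · rw [hdiff t ht]
    rw [sub_zero] at key
    exact (norm_add_le _ _).trans (add_le_add key (hε' t ht))
  · have hs' := Ico_subset_Icc_self hs
    have h1 := (hL s hs').dist_le_mul (z s) (by simpa using hR s hs') (z' s)
      (by simpa using hR' s hs')
    rw [dist_eq_norm, dist_eq_norm, hdiff s hs'] at h1
    have h2 : (L : ℝ) * ‖w s + (β s - β' s)‖ ≤ L * (‖w s‖ + ε') := by
      gcongr
      exact (norm_add_le _ _).trans (by gcongr; exact hε' s hs')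
    have h3 := norm_sub_le_norm_sub_add_norm_sub (A s (z s)) (A s (z' s)) (A' s (z' s))
    have h4 := hε s hs'
    linarith

theorem IsSol.eq_of_isTame [CompleteSpace Z] {A : ℝ → Z → Z} {β : ℝ → Z} {z0 : Z}
    {T C : ℝ} {z z' : ℝ → Z} (hA : IsTame A T C) (hz : IsSol A β z0 T z)
    (hz' : IsSol A β z0 T z') : ∀ t ∈ Icc 0 T, z t = z' t := by
  intro t ht
  obtain ⟨R, hR⟩ := exists_norm_le_of_continuousOn hz.cont
  obtain ⟨R', hR'⟩ := exists_norm_le_of_continuousOn hz'.cont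
  obtain ⟨L, hL⟩ := hA.lip (max R R')
  have := hz.norm_sub_le (ε := 0) (ε' := 0) hz' (hA.continuousOn_comp hz.cont)
    (hA.continuousOn_comp hz'.cont)
    (fun s hs => (hR s hs).trans (le_max_left _ _)) (fun s hs => (hR' s hs).trans (le_max_right _ _))
    hL (by simp) (by simp) t ht
  simp only [mul_zero, add_zero, gronwallBound_ε0_δ0] at this
  exact sub_eq_zero.1 (norm_le_zero_iff.1 this)

end Banach

/-! ### Regularity of the data on bounded sets -/

section Regularity

variable {V W F : Type*} [NormedAddCommGroup V] [NormedSpace ℝ V] [ProperSpace V]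
  [NormedAddCommGroup W] [NormedSpace ℝ W] [ProperSpace W]
  [NormedAddCommGroup F] [NormedSpace ℝ F]

theorem exists_lipschitzOnWith_closedBall {f : V → F} {n : WithTop ℕ∞} (hf : ContDiff ℝ n f)
    (hn : n ≠ 0) (R : ℝ) : ∃ L : ℝ≥0, LipschitzOnWith L f (Metric.closedBall 0 R) :=
  hf.contDiffOn.exists_lipschitzOnWith hn (convex_closedBall _ _) (isCompact_closedBall _ _)

theorem continuous_of_lipschitzOnWith_closedBall {V F : Type*} [NormedAddCommGroup V]
    [NormedAddCommGroup F] {f : V → F}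
    (hf : ∀ R, ∃ L : ℝ≥0, LipschitzOnWith L f (Metric.closedBall 0 R)) : Continuous f := by
  refine continuous_iff_continuousAt.2 fun x => ?_
  obtain ⟨L, hL⟩ := hf (‖x‖ + 1)
  refine hL.continuousOn.continuousAt (mem_of_superset (Metric.ball_mem_nhds x one_pos) fun y hy => ?_)
  have h1 := norm_le_insert' y x
  rw [mem_ball_iff_norm] at hy
  simp only [Metric.mem_closedBall, dist_zero_right]
  linarith

theorem exists_norm_apply_le_of_continuous (S : TopologicalSpace.Compacts W) {Φ : V → C(S, F)}
    (hΦ : Continuous Φ) (R : ℝ) : ∃ C, ∀ y, ‖y‖ ≤ R → ∀ x, ‖Φ y x‖ ≤ C := by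
  obtain ⟨C, hC⟩ := (isCompact_closedBall (0 : V) R).exists_bound_of_continuousOn hΦ.continuousOn
  exact ⟨C, fun y hy x => ((Φ y).norm_coe_le_norm x).trans (hC y (by simpa using hy))⟩

theorem IsC2IntoC2.exists_iteratedFDeriv_le {g : V → W → F} (hg : IsC2IntoC2 g) (R : ℝ) :
    ∃ C : ℝ, 0 ≤ C ∧ ∀ j ≤ 2, ∀ y, ‖y‖ ≤ R → ∀ x, ‖x‖ ≤ R → ‖iteratedFDeriv ℝ j (g y) x‖ ≤ C := by
  have key : ∀ j : ℕ, ∃ C : ℝ, 0 ≤ C ∧ (j ≤ 2 → ∀ y, ‖y‖ ≤ R → ∀ x, ‖x‖ ≤ R →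
      ‖iteratedFDeriv ℝ j (g y) x‖ ≤ C) := by
    intro j
    by_cases hj : j ≤ 2
    · obtain ⟨Φ, hΦ, he⟩ := hg.2 j hj ⟨Metric.closedBall 0 R, isCompact_closedBall _ _⟩
      obtain ⟨C, hC⟩ := exists_norm_apply_le_of_continuous _ hΦ.continuous R
      refine ⟨max C 0, le_max_right _ _, fun _ y hy x hx => ?_⟩
      rw [← he y ⟨x, mem_closedBall_zero_iff.2 hx⟩]
      exact (hC y hy _).trans (le_max_left _ _)
    · exact ⟨0, le_rfl, fun h => absurd h hj⟩
  choose C hC0 hC using key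
  refine ⟨∑ j ∈ Finset.range 3, C j, Finset.sum_nonneg fun _ _ => hC0 _, fun j hj y hy x hx => ?_⟩
  exact (hC j hj y hy x hx).trans (Finset.single_le_sum (f := C) (fun _ _ => hC0 _)
    (Finset.mem_range.2 (by omega)))

theorem IsC2IntoC2.exists_lipschitzOnWith {g : V → W → F} (hg : IsC2IntoC2 g) (R : ℝ) :
    ∃ L : ℝ≥0, LipschitzOnWith L (fun p : V × W => g p.1 p.2) (Metric.closedBall 0 R) := by
  obtain ⟨C, hC0, hC⟩ := hg.exists_iteratedFDeriv_le R
  obtain ⟨Φ, hΦ, he⟩ := hg.2 0 (by norm_num) ⟨Metric.closedBall 0 R, isCompact_closedBall _ _⟩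
  obtain ⟨L, hL⟩ := exists_lipschitzOnWith_closedBall hΦ two_ne_zero R
  refine ⟨L + C.toNNReal, LipschitzOnWith.of_dist_le_mul fun p hp q hq => ?_⟩
  simp only [Metric.mem_closedBall, dist_zero_right, Prod.norm_def, max_le_iff] at hp hq
  have h1 : ‖g p.1 p.2 - g q.1 p.2‖ ≤ L * ‖p.1 - q.1‖ := by
    have e1 := he p.1 ⟨p.2, mem_closedBall_zero_iff.2 hp.2⟩
    have e2 := he q.1 ⟨p.2, mem_closedBall_zero_iff.2 hp.2⟩
    have e3 := hL.dist_le_mul p.1 (by simpa using hp.1) q.1 (by simpa using hq.1)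
    rw [dist_eq_norm, dist_eq_norm] at e3
    refine le_trans ?_ (((Φ p.1 - Φ q.1).norm_coe_le_norm
      ⟨p.2, mem_closedBall_zero_iff.2 hp.2⟩).trans e3)
    rw [ContinuousMap.sub_apply, e1, e2]
    have : ∀ (f : W → F) (x : W), f x = iteratedFDeriv ℝ 0 f x 0 := fun f x => by simp
    rw [this (g p.1) p.2, this (g q.1) p.2, ← sub_apply]
    simpa using (iteratedFDeriv ℝ 0 (g p.1) p.2 - iteratedFDeriv ℝ 0 (g q.1) p.2).le_opNorm 0
  have h2 : ‖g q.1 p.2 - g q.1 q.2‖ ≤ C * ‖p.2 - q.2‖ := by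
    refine (convex_closedBall (0 : W) R).norm_image_sub_le_of_norm_fderiv_le (𝕜 := ℝ)
      (fun x _ => ((hg.1 q.1).differentiable two_ne_zero) x) (fun x hx => ?_)
      (by simpa using hq.2) (by simpa using hp.2)
    rw [← norm_iteratedFDeriv_one]
    exact hC 1 (by norm_num) q.1 hq.1 x (by simpa using hx)
  have h3 := norm_sub_le_norm_sub_add_norm_sub (g p.1 p.2) (g q.1 p.2) (g q.1 q.2)
  rw [dist_eq_norm, dist_eq_norm, NNReal.coe_add, Real.coe_toNNReal _ hC0]
  have h4 : ‖p.1 - q.1‖ ≤ ‖p - q‖ := norm_fst_le (p - q)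
  have h5 : ‖p.2 - q.2‖ ≤ ‖p - q‖ := norm_snd_le (p - q)
  have h6 : (L : ℝ) * ‖p.1 - q.1‖ ≤ L * ‖p - q‖ := by gcongr
  have h7 : C * ‖p.2 - q.2‖ ≤ C * ‖p - q‖ := by gcongr
  linarith

end Regularity

/-! ### Convolutions with measures of bounded support -/

section Conv

variable {d : ℕ}

theorem integrable_of_ae_norm_le {V F : Type*} [NormedAddCommGroup V] [ProperSpace V]
    [MeasurableSpace V] [BorelSpace V] [NormedAddCommGroup F] {μ : Measure V} [IsFiniteMeasure μ]
    {f : V → F} (hf : Continuous f) {R : ℝ} (hR : ∀ᵐ x ∂μ, ‖x‖ ≤ R) : Integrable f μ := by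
  obtain ⟨C, hC⟩ := (isCompact_closedBall (0 : V) R).exists_bound_of_continuousOn hf.continuousOn
  exact Integrable.of_bound hf.aestronglyMeasurable C
    (hR.mono fun x hx => hC x (by simpa using hx))

variable {K : Eu d → Eu d} {μ : Measure (Eu d)} [IsProbabilityMeasure μ] {R R' : ℝ}

theorem integrable_conv (hK : Continuous K) (hμ : ∀ᵐ x ∂μ, ‖x‖ ≤ R) (p : Eu d) :
    Integrable (fun x => K (p - x)) μ :=
  integrable_of_ae_norm_le (hK.comp (continuous_const.sub continuous_id)) hμ

theorem norm_conv_sub_le (hK : Continuous K) {L : ℝ≥0}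
    (hL : LipschitzOnWith L K (Metric.closedBall 0 (R' + R))) (hμ : ∀ᵐ x ∂μ, ‖x‖ ≤ R)
    {p q : Eu d} (hp : ‖p‖ ≤ R') (hq : ‖q‖ ≤ R') : ‖conv K μ p - conv K μ q‖ ≤ L * ‖p - q‖ := by
  rw [conv, conv, ← integral_sub (integrable_conv hK hμ p) (integrable_conv hK hμ q)]
  refine (norm_integral_le_of_norm_le_const (C := L * ‖p - q‖) ?_).trans (by simp)
  filter_upwards [hμ] with x hx
  have := hL.dist_le_mul (p - x) (by simpa using (norm_sub_le p x).trans (add_le_add hp hx))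
    (q - x) (by simpa using (norm_sub_le q x).trans (add_le_add hq hx))
  simpa [dist_eq_norm] using this

theorem norm_conv_le {C : ℝ} (hC0 : 0 ≤ C) (hC : ∀ x, ‖K x‖ ≤ C * (1 + ‖x‖))
    (hμ : ∀ᵐ x ∂μ, ‖x‖ ≤ R) (p : Eu d) : ‖conv K μ p‖ ≤ C * (1 + ‖p‖ + R) := by
  refine (norm_integral_le_of_norm_le_const (C := C * (1 + ‖p‖ + R)) ?_).trans (by simp)
  filter_upwards [hμ] with x hx
  refine (hC _).trans ?_
  have := norm_sub_le p x
  exact mul_le_mul_of_nonneg_left (by linarith) hC0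

end Conv

/-! ### The Lagrangian form of the systems -/

section Lagrangian

variable {d m D : ℕ} {Ω : Type*} [TopologicalSpace Ω] [CompactSpace Ω] [MeasurableSpace Ω]
  [BorelSpace Ω]

/-- Integration against a probability measure, as a continuous linear map on `C(Ω, F)`. -/
def integralC {F : Type*} [NormedAddCommGroup F] [NormedSpace ℝ F] (P : Measure Ω)
    [IsProbabilityMeasure P] : C(Ω, F) →L[ℝ] F :=
  LinearMap.mkContinuous
    { toFun := fun f => ∫ θ, f θ ∂P
      map_add' := fun f g => integral_add
        (f.continuous.integrable_of_hasCompactSupport (HasCompactSupport.of_compactSpace f))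
        (g.continuous.integrable_of_hasCompactSupport (HasCompactSupport.of_compactSpace g))
      map_smul' := fun c f => integral_smul c f } 1 fun f => by
    refine (norm_integral_le_of_norm_le_const
      (Eventually.of_forall fun θ => f.norm_coe_le_norm θ)).trans (by simp)

variable {P : Measure Ω} [IsProbabilityMeasure P]

@[simp]
theorem integralC_apply {F : Type*} [NormedAddCommGroup F] [NormedSpace ℝ F] (f : C(Ω, F)) :
    integralC P f = ∫ θ, f θ ∂P := rfl

theorem norm_integralC_apply_le {F : Type*} [NormedAddCommGroup F] [NormedSpace ℝ F]
    (f : C(Ω, F)) : ‖integralC P f‖ ≤ ‖f‖ := by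
  rw [integralC_apply]
  exact (norm_integral_le_of_norm_le_const
      (Eventually.of_forall fun θ => f.norm_coe_le_norm θ)).trans (by simp)

instance (X : C(Ω, Eu d)) : IsProbabilityMeasure (P.map X) :=
  Measure.isProbabilityMeasure_map X.continuous.aemeasurable

theorem ae_map_norm_le (X : C(Ω, Eu d)) : ∀ᵐ x ∂(P.map X), ‖x‖ ≤ ‖X‖ := by
  refine (ae_map_iff X.continuous.aemeasurable
    (measurableSet_le measurable_norm measurable_const)).2 ?_
  exact Eventually.of_forall fun θ => X.norm_coe_le_norm θ

theorem integral_map_continuousMap {F : Type*} [NormedAddCommGroup F] [NormedSpace ℝ F]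
    (X : C(Ω, Eu d)) {φ : Eu d → F} (hφ : Continuous φ) :
    ∫ x, φ x ∂(P.map X) = ∫ θ, φ (X θ) ∂P :=
  integral_map X.continuous.aemeasurable hφ.aestronglyMeasurable

/-- The function `θ ↦ K (p - X(θ))`. -/
def kernelAt {K : Eu d → Eu d} (hK : Continuous K) (X : C(Ω, Eu d)) (p : Eu d) : C(Ω, Eu d) :=
  ⟨fun θ => K (p - X θ), hK.comp (continuous_const.sub X.continuous)⟩

theorem conv_map {K : Eu d → Eu d} (hK : Continuous K) (X : C(Ω, Eu d)) (p : Eu d) :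
    conv K (P.map X) p = integralC P (kernelAt hK X p) :=
  integral_map_continuousMap X (hK.comp (continuous_const.sub continuous_id))

theorem norm_conv_map_sub_le {K : Eu d → Eu d} (hK : Continuous K) {L : ℝ≥0} {R : ℝ}
    (hL : LipschitzOnWith L K (Metric.closedBall 0 (R + R))) {X Y : C(Ω, Eu d)} {p q : Eu d}
    (hX : ‖X‖ ≤ R) (hY : ‖Y‖ ≤ R) (hp : ‖p‖ ≤ R) (hq : ‖q‖ ≤ R) :
    ‖conv K (P.map X) p - conv K (P.map Y) q‖ ≤ L * (‖p - q‖ + ‖X - Y‖) := by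
  rw [conv_map hK, conv_map hK, ← map_sub]
  refine (norm_integralC_apply_le _).trans ((ContinuousMap.norm_le _ (by positivity)).2 fun θ => ?_)
  have hXθ := (X.norm_coe_le_norm θ).trans hX
  have hYθ := (Y.norm_coe_le_norm θ).trans hY
  have := hL.dist_le_mul (p - X θ) (by simpa using (norm_sub_le p _).trans (add_le_add hp hXθ))
    (q - Y θ) (by simpa using (norm_sub_le q _).trans (add_le_add hq hYθ))
  rw [dist_eq_norm, dist_eq_norm] at this
  refine this.trans ?_
  gcongr
  have e : p - X θ - (q - Y θ) = (p - q) - (X - Y) θ := by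
    rw [ContinuousMap.sub_apply]; abel
  rw [e]
  exact (norm_sub_le _ _).trans (by gcongr; exact (X - Y).norm_coe_le_norm θ)

variable {S : Data d m D}

theorem Data.HypH.continuous_conv_map (hS : S.HypH) (X : C(Ω, Eu d)) :
    Continuous (conv S.K (P.map X)) := by
  refine continuous_of_lipschitzOnWith_closedBall fun R => ?_
  obtain ⟨L, hL⟩ := exists_lipschitzOnWith_closedBall hS.K_smooth two_ne_zero (R + ‖X‖)
  refine ⟨L, LipschitzOnWith.of_dist_le_mul fun p hp q hq => ?_⟩
  rw [dist_eq_norm, dist_eq_norm]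
  exact norm_conv_sub_le hS.K_smooth.continuous hL (ae_map_norm_le X) (by simpa using hp)
    (by simpa using hq)

theorem Data.HypH.continuous_g (hS : S.HypH) :
    Continuous (fun p : Leaders d m × Eu d => S.g p.1 p.2) :=
  continuous_of_lipschitzOnWith_closedBall hS.g_smooth.exists_lipschitzOnWith

/-- The right-hand side (without control) of the system for leaders and followers, as a vector
field on `Leaders d m × C(Ω, Eu d)`. The followers are labelled by the points of `Ω`, with
distribution `P`, and `z.2 θ` is the position of the follower with label `θ`. -/
def meanField (hS : S.HypH) (P : Measure Ω) [IsProbabilityMeasure P]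
    (z : Leaders d m × C(Ω, Eu d)) : Leaders d m × C(Ω, Eu d) :=
  (fun k => conv S.K (P.map z.2) (z.1 k) + S.f k z.1,
    ⟨fun θ => conv S.K (P.map z.2) (z.2 θ) + S.g z.1 (z.2 θ),
      ((hS.continuous_conv_map z.2).comp z.2.continuous).add
        (hS.continuous_g.comp (continuous_const.prodMk z.2.continuous))⟩)

/-- The constant does not depend on the label distribution; this is what makes particle systems of
all sizes and the mean-field system comparable. -/
theorem exists_lipschitzOnWith_meanField (hS : S.HypH) (R : ℝ) :
    ∃ L : ℝ≥0, ∀ (P : Measure Ω) [IsProbabilityMeasure P],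
      LipschitzOnWith L (meanField hS P) (Metric.closedBall 0 R) := by
  obtain ⟨LK, hLK⟩ := exists_lipschitzOnWith_closedBall hS.K_smooth two_ne_zero (R + R)
  obtain ⟨Lg, hLg⟩ := hS.g_smooth.exists_lipschitzOnWith R
  choose Lf hLf using fun k => exists_lipschitzOnWith_closedBall (hS.f_smooth k) two_ne_zero R
  refine ⟨2 * LK + Lg + ∑ k, Lf k, fun P _ => LipschitzOnWith.of_dist_le_mul fun z hz w hw => ?_⟩
  rw [mem_closedBall_zero_iff] at hz hw
  have hz1 : ‖z.1‖ ≤ R := (norm_fst_le z).trans hz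
  have hz2 : ‖z.2‖ ≤ R := (norm_snd_le z).trans hz
  have hw1 : ‖w.1‖ ≤ R := (norm_fst_le w).trans hw
  have hw2 : ‖w.2‖ ≤ R := (norm_snd_le w).trans hw
  have h1 : ‖z.1 - w.1‖ ≤ ‖z - w‖ := norm_fst_le (z - w)
  have h2 : ‖z.2 - w.2‖ ≤ ‖z - w‖ := norm_snd_le (z - w)
  have hK : ∀ p q : Eu d, ‖p‖ ≤ R → ‖q‖ ≤ R → ‖p - q‖ ≤ ‖z - w‖ →
      ‖conv S.K (P.map z.2) p - conv S.K (P.map w.2) q‖ ≤ 2 * LK * ‖z - w‖ := fun p q hp hq hpq => by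
    have := norm_conv_map_sub_le (P := P) hS.K_smooth.continuous hLK hz2 hw2 hp hq
    have h3 : (LK : ℝ) * (‖p - q‖ + ‖z.2 - w.2‖) ≤ LK * (‖z - w‖ + ‖z - w‖) := by gcongr
    linarith
  have hsum : ∀ k, (Lf k : ℝ) ≤ ∑ k, (Lf k : ℝ) := fun k =>
    Finset.single_le_sum (f := fun k => (Lf k : ℝ)) (fun _ _ => NNReal.coe_nonneg _)
      (Finset.mem_univ k)
  have hsum0 : 0 ≤ ∑ k, (Lf k : ℝ) := Finset.sum_nonneg fun _ _ => NNReal.coe_nonneg _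
  rw [dist_eq_norm, dist_eq_norm]
  push_cast
  refine (norm_prod_le_iff).2 ⟨(pi_norm_le_iff_of_nonneg (by positivity)).2 fun k => ?_,
    (ContinuousMap.norm_le _ (by positivity)).2 fun θ => ?_⟩
  · have e : (meanField hS P z - meanField hS P w).1 k =
        (conv S.K (P.map z.2) (z.1 k) - conv S.K (P.map w.2) (w.1 k)) +
          (S.f k z.1 - S.f k w.1) := by
      simp only [meanField, Prod.fst_sub, Pi.sub_apply]; abel
    rw [e]
    refine (norm_add_le _ _).trans ?_
    have h3 := hK (z.1 k) (w.1 k) ((norm_le_pi_norm _ k).trans hz1) ((norm_le_pi_norm _ k).trans hw1)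
      ((norm_le_pi_norm (z.1 - w.1) k).trans h1)
    have h4 := (hLf k).dist_le_mul z.1 (by simpa using hz1) w.1 (by simpa using hw1)
    rw [dist_eq_norm, dist_eq_norm] at h4
    have h5 : (Lf k : ℝ) * ‖z.1 - w.1‖ ≤ (∑ k, (Lf k : ℝ)) * ‖z - w‖ := by gcongr; exact hsum k
    have h6 : 0 ≤ (Lg : ℝ) * ‖z - w‖ := by positivity
    linarith
  · have e : (meanField hS P z - meanField hS P w).2 θ =
        (conv S.K (P.map z.2) (z.2 θ) - conv S.K (P.map w.2) (w.2 θ)) +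
          (S.g z.1 (z.2 θ) - S.g w.1 (w.2 θ)) := by
      simp only [meanField, Prod.snd_sub, ContinuousMap.sub_apply, ContinuousMap.coe_mk]; abel
    rw [e]
    refine (norm_add_le _ _).trans ?_
    have hzθ := (z.2.norm_coe_le_norm θ).trans hz2
    have hwθ := (w.2.norm_coe_le_norm θ).trans hw2
    have hθ := ((z.2 - w.2).norm_coe_le_norm θ).trans h2
    have h3 := hK (z.2 θ) (w.2 θ) hzθ hwθ hθ
    have h4 := hLg.dist_le_mul (z.1, z.2 θ) (by simp [Prod.norm_def, hz1, hzθ])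
      (w.1, w.2 θ) (by simp [Prod.norm_def, hw1, hwθ])
    rw [dist_eq_norm, dist_eq_norm] at h4
    have h5 : (Lg : ℝ) * ‖(z.1, z.2 θ) - (w.1, w.2 θ)‖ ≤ Lg * ‖z - w‖ := by
      gcongr
      exact norm_prod_le_iff.2 ⟨h1, hθ⟩
    have h6 : 0 ≤ (∑ k, (Lf k : ℝ)) * ‖z - w‖ := by positivity
    simp only at h4
    linarith

theorem norm_add_smul_sq_le {x v : Eu d} {N C M h : ℝ} (hh : 0 ≤ h) (hx : ‖x‖ ≤ N) (hv : ‖v‖ ≤ M)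
    (hi : inner ℝ v x ≤ C * (1 + N ^ 2)) :
    ‖x + h • v‖ ^ 2 ≤ (1 + 2 * h * C) * (1 + N ^ 2) + h ^ 2 * M ^ 2 - 1 := by
  rw [norm_add_sq_real, inner_smul_right, norm_smul, Real.norm_of_nonneg hh, real_inner_comm]
  have h1 : ‖x‖ ^ 2 ≤ N ^ 2 := by gcongr
  have h2 : (h * ‖v‖) ^ 2 ≤ (h * M) ^ 2 := by gcongr
  have h3 : h * inner ℝ v x ≤ h * (C * (1 + N ^ 2)) := by gcongr
  nlinarith

/-- Reformulation of `OutwardBound` through all upper bounds `b` of the norm, the form in which a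
supremum norm can be estimated pointwise. -/
theorem OutwardBound.of_forall_sq_le {Z : Type*} [NormedAddCommGroup Z] [NormedSpace ℝ Z] {C : ℝ}
    {z v : Z} (H : ∀ h : ℝ, 0 ≤ h → ∀ b : ℝ, 0 ≤ b →
      b ^ 2 = (1 + 2 * h * C) * (1 + ‖z‖ ^ 2) + h ^ 2 * ‖v‖ ^ 2 - 1 → ‖z + h • v‖ ≤ b) (hC : 0 ≤ C) :
    OutwardBound C z v := by
  intro h hh
  have hpos : 0 ≤ (1 + 2 * h * C) * (1 + ‖z‖ ^ 2) + h ^ 2 * ‖v‖ ^ 2 - 1 := by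
    have : 0 ≤ 2 * h * C * (1 + ‖z‖ ^ 2) := by positivity
    nlinarith [sq_nonneg ‖z‖, mul_nonneg (sq_nonneg h) (sq_nonneg ‖v‖)]
  have h1 := H h hh _ (Real.sqrt_nonneg _) (Real.sq_sqrt hpos)
  have h2 : ‖z + h • v‖ ^ 2 ≤ √((1 + 2 * h * C) * (1 + ‖z‖ ^ 2) + h ^ 2 * ‖v‖ ^ 2 - 1) ^ 2 := by
    gcongr
  rw [Real.sq_sqrt hpos] at h2
  linarith

theorem OutwardBound.continuousMap {C : ℝ} (hC : 0 ≤ C) {X V : C(Ω, Eu d)}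
    (h : ∀ θ, inner ℝ (V θ) (X θ) ≤ C * (1 + ‖X‖ ^ 2)) : OutwardBound C X V :=
  .of_forall_sq_le (fun _ hs _ hb hb2 => (ContinuousMap.norm_le _ hb).2 fun θ =>
    le_of_sq_le_sq (hb2 ▸ norm_add_smul_sq_le hs (X.norm_coe_le_norm θ) (V.norm_coe_le_norm θ) (h θ))
      hb) hC

theorem OutwardBound.prod {C : ℝ} (hC : 0 ≤ C) {z v : Leaders d m × C(Ω, Eu d)}
    (h1 : ∀ k, inner ℝ (v.1 k) (z.1 k) ≤ C * (1 + ‖z‖ ^ 2))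
    (h2 : ∀ θ, inner ℝ (v.2 θ) (z.2 θ) ≤ C * (1 + ‖z‖ ^ 2)) : OutwardBound C z v :=
  .of_forall_sq_le (fun _ hs _ hb hb2 => norm_prod_le_iff.2
    ⟨(pi_norm_le_iff_of_nonneg hb).2 fun k => le_of_sq_le_sq (hb2 ▸ norm_add_smul_sq_le hs
      ((norm_le_pi_norm _ k).trans (norm_fst_le z)) ((norm_le_pi_norm _ k).trans (norm_fst_le v))
      (h1 k)) hb,
    (ContinuousMap.norm_le _ hb).2 fun θ => le_of_sq_le_sq (hb2 ▸ norm_add_smul_sq_le hs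
      ((z.2.norm_coe_le_norm θ).trans (norm_snd_le z))
      ((v.2.norm_coe_le_norm θ).trans (norm_snd_le v)) (h2 θ)) hb⟩) hC

theorem exists_outwardBound_meanField (hS : S.HypH) :
    ∃ C : ℝ, 0 ≤ C ∧ ∀ (P : Measure Ω) [IsProbabilityMeasure P] (z : Leaders d m × C(Ω, Eu d)),
      OutwardBound C z (meanField hS P z) := by
  obtain ⟨CK, hCK, hK⟩ := hS.K_sublinear
  obtain ⟨G₁, G₂, G₃, hG⟩ := hS.g_growth
  obtain ⟨F₁, F₂, hF⟩ := hS.f_growth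
  refine ⟨3 * CK + |F₁| + |F₂| + |G₁| + |G₂| + |G₃|, by positivity, fun P _ z => ?_⟩
  have hconv : ∀ p : Eu d, ‖p‖ ≤ ‖z‖ →
      inner ℝ (conv S.K (P.map z.2) p) p ≤ 3 * CK * (1 + ‖z‖ ^ 2) := by
    intro p hp
    have h1 := norm_conv_le (μ := P.map z.2) hCK.le (fun x => (hK x).le) (ae_map_norm_le z.2) p
    have h2 : ‖conv S.K (P.map z.2) p‖ * ‖p‖ ≤ CK * (1 + ‖z‖ + ‖z‖) * ‖z‖ := by
      gcongr
      exact h1.trans (by gcongr; exact norm_snd_le z)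
    have h3 := real_inner_le_norm (conv S.K (P.map z.2) p) p
    have h4 : (1 + ‖z‖ + ‖z‖) * ‖z‖ ≤ 3 * (1 + ‖z‖ ^ 2) := by nlinarith [sq_nonneg (‖z‖ - 1)]
    nlinarith
  have habs : ∀ a b c : ℝ, 0 ≤ b → b ≤ c → a * b ≤ |a| * c := fun a b c hb hbc =>
    mul_le_mul (le_abs_self a) hbc hb (abs_nonneg a)
  have hz2 : 0 ≤ ‖z‖ ^ 2 := sq_nonneg _
  have hab : ∀ a : ℝ, a ≤ |a| * (1 + ‖z‖ ^ 2) := fun a => by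
    have := habs a 1 (1 + ‖z‖ ^ 2) zero_le_one (by linarith)
    linarith
  have hab0 : ∀ a : ℝ, 0 ≤ |a| * (1 + ‖z‖ ^ 2) := fun a => by positivity
  refine OutwardBound.prod (by positivity) (fun k => ?_) fun θ => ?_
  · have hk : ‖z.1 k‖ ≤ ‖z‖ := (norm_le_pi_norm _ k).trans (norm_fst_le z)
    have h0 : ‖z.1‖ ^ 2 ≤ 1 + ‖z‖ ^ 2 := by
      have : ‖z.1‖ ^ 2 ≤ ‖z‖ ^ 2 := by gcongr; exact norm_fst_le z
      linarith
    have h1 := hF k z.1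
    have h2 := habs F₁ (‖z.1‖ ^ 2) _ (sq_nonneg _) h0
    have h3 := hconv (z.1 k) hk
    change inner ℝ (conv S.K (P.map z.2) (z.1 k) + S.f k z.1) (z.1 k) ≤ _
    rw [inner_add_left]
    linarith [hab F₂, hab0 G₁, hab0 G₂, hab0 G₃]
  · have hk : ‖z.2 θ‖ ≤ ‖z‖ := (z.2.norm_coe_le_norm θ).trans (norm_snd_le z)
    have h0 : ‖z.1‖ ^ 2 ≤ 1 + ‖z‖ ^ 2 := by
      have : ‖z.1‖ ^ 2 ≤ ‖z‖ ^ 2 := by gcongr; exact norm_fst_le z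
      linarith
    have h0' : ‖z.2 θ‖ ^ 2 ≤ 1 + ‖z‖ ^ 2 := by
      have : ‖z.2 θ‖ ^ 2 ≤ ‖z‖ ^ 2 := by gcongr
      linarith
    have h1 := hG z.1 (z.2 θ)
    have h2 := habs G₂ (‖z.1‖ ^ 2) _ (sq_nonneg _) h0
    have h2' := habs G₁ (‖z.2 θ‖ ^ 2) _ (sq_nonneg _) h0'
    have h3 := hconv (z.2 θ) hk
    change inner ℝ (conv S.K (P.map z.2) (z.2 θ) + S.g z.1 (z.2 θ)) (z.2 θ) ≤ _
    rw [inner_add_left]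
    linarith [hab G₃, hab0 F₁, hab0 F₂]

theorem exists_isTame_meanField (Ω : Type*) [TopologicalSpace Ω] [CompactSpace Ω]
    [MeasurableSpace Ω] [BorelSpace Ω] (hS : S.HypH) (T : ℝ) :
    ∃ C : ℝ, ∀ (P : Measure Ω) [IsProbabilityMeasure P],
      IsTame (fun _ => meanField hS P) T C := by
  obtain ⟨C, hC0, hC⟩ := exists_outwardBound_meanField (Ω := Ω) hS
  refine ⟨C, fun P _ => ⟨fun _ => continuousOn_const, fun R => ?_, hC0, fun _ _ z => hC P z⟩⟩
  obtain ⟨L, hL⟩ := exists_lipschitzOnWith_meanField (Ω := Ω) hS R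
  exact ⟨L, fun _ _ => hL P⟩

end Lagrangian

section Systems

variable {d m D : ℕ} {Ω : Type*} [TopologicalSpace Ω] [CompactSpace Ω] [MeasurableSpace Ω]
  [BorelSpace Ω] {P : Measure Ω} [IsProbabilityMeasure P] {S : Data d m D} {T : ℝ}

/-! ### Controls -/

theorem Control.integrableOn {U : Set (Eu D)} (u : Control D T U) :
    IntegrableOn (fun s => u.1 s) (Icc 0 T) :=
  L1.integrable_coeFn u.1

theorem Control.intervalIntegrable_clm {U : Set (Eu D)} (u : Control D T U) (B : Eu D →L[ℝ] Eu d)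
    {s t : ℝ} (hs : s ∈ Icc 0 T) (ht : t ∈ Icc 0 T) :
    IntervalIntegrable (fun r => B (u.1 r)) volume s t := by
  have h : IntegrableOn (fun r => B (u.1 r)) (Icc 0 T) := B.integrable_comp u.integrableOn
  exact (h.mono_set (ordConnected_Icc.uIcc_subset hs ht)).intervalIntegrable

/-- The displacement of the leaders due to the control up to time `t`. -/
def Data.forcing (S : Data d m D) (u : Control D T S.U) (t : ℝ) : Leaders d m × C(Ω, Eu d) :=
  (fun k => ∫ s in (0 : ℝ)..t, S.B k (u.1 s), 0)

theorem Data.forcing_zero (u : Control D T S.U) : S.forcing (Ω := Ω) u 0 = 0 := by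
  ext <;> simp [Data.forcing]

theorem Data.HypH.exists_forcing_lipschitz (Ω : Type*) [TopologicalSpace Ω] [CompactSpace Ω]
    (hS : S.HypH) (T : ℝ) :
    ∃ M : ℝ, 0 ≤ M ∧ ∀ u : Control D T S.U, ∀ s ∈ Icc 0 T, ∀ t ∈ Icc 0 T,
      ‖S.forcing (Ω := Ω) u t - S.forcing u s‖ ≤ M * |t - s| := by
  obtain ⟨R, hR⟩ := hS.U_compact.isBounded.exists_norm_le
  refine ⟨(∑ k, ‖S.B k‖) * max R 0, by positivity, fun u s hs t ht => ?_⟩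
  refine norm_prod_le_iff.2 ⟨(pi_norm_le_iff_of_nonneg (by positivity)).2 fun k => ?_, ?_⟩
  · simp only [Data.forcing, Prod.fst_sub, Pi.sub_apply]
    have h0 : (0 : ℝ) ∈ Icc 0 T := ⟨le_rfl, hs.1.trans hs.2⟩
    rw [intervalIntegral.integral_interval_sub_left (u.intervalIntegrable_clm _ h0 ht)
      (u.intervalIntegrable_clm _ h0 hs)]
    refine intervalIntegral.norm_integral_le_of_norm_le_const_ae ?_
    have h1 := (ae_restrict_iff' measurableSet_Icc).1 u.2
    filter_upwards [h1] with r hr hr'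
    have h2 := hR _ (hr (ordConnected_Icc.uIcc_subset hs ht (uIoc_subset_uIcc hr')))
    refine ((S.B k).le_opNorm _).trans ?_
    have h3 : ‖S.B k‖ ≤ ∑ k, ‖S.B k‖ :=
      Finset.single_le_sum (f := fun k => ‖S.B k‖) (fun _ _ => norm_nonneg _) (Finset.mem_univ k)
    have h4 := h2.trans (le_max_left R 0)
    gcongr
  · simp only [Data.forcing, Prod.snd_sub, sub_zero, norm_zero]
    positivity

/-! ### Solutions in components -/

theorem IsSol.fst_apply {hS : S.HypH} {u : Control D T S.U} {z0 : Leaders d m × C(Ω, Eu d)}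
    {z : ℝ → Leaders d m × C(Ω, Eu d)}
    (hz : IsSol (fun _ => meanField hS P) (S.forcing u) z0 T z) {t : ℝ} (ht : t ∈ Icc 0 T)
    (k : Fin m) : (z t).1 k = z0.1 k + ∫ s in (0 : ℝ)..t,
      (conv S.K (P.map (z s).2) ((z s).1 k) + S.f k (z s).1 + S.B k (u.1 s)) := by
  have h0 : (0 : ℝ) ∈ Icc 0 T := ⟨le_rfl, ht.1.trans ht.2⟩
  obtain ⟨C, hC⟩ := exists_isTame_meanField Ω hS T
  have hc : IntervalIntegrable (fun s => meanField hS P (z s)) volume 0 t :=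
    (((hC P).continuousOn_comp hz.cont).mono (Icc_subset_Icc_right ht.2)).intervalIntegrable_of_Icc
      ht.1
  let Λ : Leaders d m × C(Ω, Eu d) →L[ℝ] Eu d :=
    (ContinuousLinearMap.proj k).comp (ContinuousLinearMap.fst ℝ _ _)
  have h1 := congrArg Λ (hz.eq t ht)
  rw [map_add, map_add, ← Λ.intervalIntegral_comp_comm hc] at h1
  have hi : IntervalIntegrable (fun s => Λ (meanField hS P (z s))) volume 0 t :=
    ⟨Λ.integrable_comp hc.1, Λ.integrable_comp hc.2⟩
  have h2 := intervalIntegral.integral_add hi (u.intervalIntegrable_clm (S.B k) h0 ht)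
  change (z t).1 k = _ at h1
  rw [h1, add_assoc]
  exact congrArg (z0.1 k + ·) h2.symm

theorem IsSol.snd_eq {hS : S.HypH} {u : Control D T S.U} {z0 : Leaders d m × C(Ω, Eu d)}
    {z : ℝ → Leaders d m × C(Ω, Eu d)}
    (hz : IsSol (fun _ => meanField hS P) (S.forcing u) z0 T z) {t : ℝ} (ht : t ∈ Icc 0 T) :
    (z t).2 = z0.2 + ∫ s in (0 : ℝ)..t, (meanField hS P (z s)).2 := by
  obtain ⟨C, hC⟩ := exists_isTame_meanField Ω hS T
  have hc : IntervalIntegrable (fun s => meanField hS P (z s)) volume 0 t :=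
    (((hC P).continuousOn_comp hz.cont).mono (Icc_subset_Icc_right ht.2)).intervalIntegrable_of_Icc
      ht.1
  let Λ := ContinuousLinearMap.snd ℝ (Leaders d m) C(Ω, Eu d)
  have h1 := congrArg Λ (hz.eq t ht)
  rw [map_add, map_add, ← Λ.intervalIntegral_comp_comm hc] at h1
  change (z t).2 = _ at h1
  rw [h1]
  exact add_zero _

theorem IsSol.continuousOn_meanField_snd {hS : S.HypH} {β : ℝ → Leaders d m × C(Ω, Eu d)}
    {z0 : Leaders d m × C(Ω, Eu d)} {z : ℝ → Leaders d m × C(Ω, Eu d)}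
    (hz : IsSol (fun _ => meanField hS P) β z0 T z) :
    ContinuousOn (fun s => (meanField hS P (z s)).2) (Icc 0 T) := by
  obtain ⟨C, hC⟩ := exists_isTame_meanField Ω hS T
  exact continuous_snd.comp_continuousOn ((hC P).continuousOn_comp hz.cont)

theorem IsSol.snd_apply {hS : S.HypH} {u : Control D T S.U} {z0 : Leaders d m × C(Ω, Eu d)}
    {z : ℝ → Leaders d m × C(Ω, Eu d)}
    (hz : IsSol (fun _ => meanField hS P) (S.forcing u) z0 T z) {t : ℝ} (ht : t ∈ Icc 0 T)
    (θ : Ω) : (z t).2 θ = z0.2 θ + ∫ s in (0 : ℝ)..t,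
      (conv S.K (P.map (z s).2) ((z s).2 θ) + S.g (z s).1 ((z s).2 θ)) := by
  have hi : IntervalIntegrable (fun s => (meanField hS P (z s)).2) volume 0 t :=
    (hz.continuousOn_meanField_snd.mono (Icc_subset_Icc_right ht.2)).intervalIntegrable_of_Icc ht.1
  have h1 := congrArg (ContinuousMap.evalCLM ℝ θ : C(Ω, Eu d) →L[ℝ] Eu d) (hz.snd_eq ht)
  rw [map_add, ← ContinuousLinearMap.intervalIntegral_comp_comm _ hi] at h1
  exact h1

/-- Conversely, the equations of the components give a solution in the Banach space. -/
theorem isSol_of_components (hS : S.HypH) {u : Control D T S.U} {z0 : Leaders d m × C(Ω, Eu d)}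
    {z : ℝ → Leaders d m × C(Ω, Eu d)} (hz : ContinuousOn z (Icc 0 T))
    (h1 : ∀ t ∈ Icc 0 T, ∀ k, (z t).1 k = z0.1 k + ∫ s in (0 : ℝ)..t,
      (conv S.K (P.map (z s).2) ((z s).1 k) + S.f k (z s).1 + S.B k (u.1 s)))
    (h2 : ∀ t ∈ Icc 0 T, ∀ θ, (z t).2 θ = z0.2 θ + ∫ s in (0 : ℝ)..t,
      (conv S.K (P.map (z s).2) ((z s).2 θ) + S.g (z s).1 ((z s).2 θ))) :
    IsSol (fun _ => meanField hS P) (S.forcing u) z0 T z := by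
  refine ⟨hz, fun t ht => ?_⟩
  have h0 : (0 : ℝ) ∈ Icc 0 T := ⟨le_rfl, ht.1.trans ht.2⟩
  obtain ⟨C, hC⟩ := exists_isTame_meanField Ω hS T
  have hc : IntervalIntegrable (fun s => meanField hS P (z s)) volume 0 t :=
    (((hC P).continuousOn_comp hz).mono (Icc_subset_Icc_right ht.2)).intervalIntegrable_of_Icc ht.1
  refine Prod.ext (funext fun k => ?_) (ContinuousMap.ext fun θ => ?_)
  · let Λ : Leaders d m × C(Ω, Eu d) →L[ℝ] Eu d :=
      (ContinuousLinearMap.proj k).comp (ContinuousLinearMap.fst ℝ _ _)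
    have hi : IntervalIntegrable (fun s => Λ (meanField hS P (z s))) volume 0 t :=
      ⟨Λ.integrable_comp hc.1, Λ.integrable_comp hc.2⟩
    have e := intervalIntegral.integral_add hi (u.intervalIntegrable_clm (S.B k) h0 ht)
    change (z t).1 k = Λ (z0 + (∫ s in (0 : ℝ)..t, meanField hS P (z s)) + S.forcing u t)
    rw [map_add, map_add, ← Λ.intervalIntegral_comp_comm hc, h1 t ht k, add_assoc]
    exact congrArg (z0.1 k + ·) e
  · let Λ : Leaders d m × C(Ω, Eu d) →L[ℝ] Eu d :=
      (ContinuousMap.evalCLM ℝ θ).comp (ContinuousLinearMap.snd ℝ _ _)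
    change (z t).2 θ = Λ (z0 + (∫ s in (0 : ℝ)..t, meanField hS P (z s)) + S.forcing u t)
    rw [map_add, map_add, ← Λ.intervalIntegral_comp_comm hc, h2 t ht θ]
    exact (add_zero _).symm

/-- The system for leaders and followers has a global solution. -/
theorem exists_isSol_meanField (hS : S.HypH) (hT : 0 ≤ T) (P : Measure Ω)
    [IsProbabilityMeasure P] (u : Control D T S.U) (z0 : Leaders d m × C(Ω, Eu d)) :
    ∃ z, IsSol (fun _ => meanField hS P) (S.forcing u) z0 T z := by
  obtain ⟨C, hC⟩ := exists_isTame_meanField Ω hS T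
  obtain ⟨M, hM, hβ⟩ := hS.exists_forcing_lipschitz Ω T
  exact exists_isSol z0 hT (hC P) hM (S.forcing_zero u) (hβ u)

/-! ### The particle system -/

/-- The uniform probability measure on `Fin N`. -/
def unif (N : ℕ) : Measure (Fin N) := (N : ℝ≥0∞)⁻¹ • ∑ i, Measure.dirac i

instance (N : ℕ) [NeZero N] : IsProbabilityMeasure (unif N) := by
  refine ⟨?_⟩
  simp only [unif, Measure.smul_apply, Measure.finsetSum_apply, measure_univ, Finset.sum_const,
    Finset.card_univ, Fintype.card_fin, nsmul_eq_mul, mul_one, smul_eq_mul]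
  exact ENNReal.inv_mul_cancel (by simp [NeZero.ne]) (ENNReal.natCast_ne_top N)

theorem map_unif {N : ℕ} (x : Fin N → Eu d) : (unif N).map x = empirical x := by
  have hx : Measurable x := measurable_of_finite x
  rw [unif, empirical, Measure.map_smul, ← Measure.mapₗ_apply_of_measurable hx, map_sum]
  simp [Measure.mapₗ_apply_of_measurable hx, Measure.map_dirac' hx]

theorem integral_empirical {F : Type*} [NormedAddCommGroup F] [NormedSpace ℝ F] [CompleteSpace F]
    {N : ℕ} (x : Fin N → Eu d) (f : Eu d → F) :
    ∫ p, f p ∂(empirical x) = (N : ℝ)⁻¹ • ∑ i, f (x i) := by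
  rw [empirical, integral_smul_measure,
    integral_finsetSum_measure fun i _ => integrable_dirac (by simp)]
  simp

theorem conv_empirical {N : ℕ} (K : Eu d → Eu d) (x : Fin N → Eu d) (p : Eu d) :
    conv K (empirical x) p = (N : ℝ)⁻¹ • ∑ j, K (p - x j) :=
  integral_empirical x _

theorem map_map_unif {N : ℕ} (ι : Fin N → Ω) (X : C(Ω, Eu d)) :
    ((unif N).map ι).map X = empirical (fun i => X (ι i)) := by
  rw [Measure.map_map X.continuous.measurable (measurable_of_finite ι), ← map_unif]
  rfl

/-- Followers labelled by `Ω`, with the empirical measure of finitely many labels, restrict to a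
solution of the particle system. -/
theorem IsSol.isParticleSol {N : ℕ} [NeZero N] {ι : Fin N → Ω}
    [IsProbabilityMeasure ((unif N).map ι)] {hS : S.HypH} {u : Control D T S.U}
    {y0 : Leaders d m} {ξ : C(Ω, Eu d)} {z : ℝ → Leaders d m × C(Ω, Eu d)}
    (hz : IsSol (fun _ => meanField hS ((unif N).map ι)) (S.forcing u) (y0, ξ) T z) :
    S.IsParticleSol T y0 (fun i => ξ (ι i)) u (fun t => (z t).1) (fun t i => (z t).2 (ι i)) where
  y_cont := continuous_fst.comp_continuousOn hz.cont
  x_cont := continuousOn_pi.2 fun i => (ContinuousMap.evalCLM ℝ (ι i)).continuous.comp_continuousOn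
    (continuous_snd.comp_continuousOn hz.cont)
  y_eq t ht k := by
    simpa only [map_map_unif, conv_empirical] using hz.fst_apply ht k
  x_eq t ht i := by
    simpa only [map_map_unif, conv_empirical] using hz.snd_apply ht (ι i)

/-- A solution of the particle system is a flow labelled by `Fin N` itself. -/
theorem Data.IsParticleSol.isSol {N : ℕ} [NeZero N] (hS : S.HypH) {u : Control D T S.U}
    {y0 : Leaders d m} {x0 : Fin N → Eu d} {y : ℝ → Leaders d m} {x : ℝ → Fin N → Eu d}
    (h : S.IsParticleSol T y0 x0 u y x) :
    IsSol (fun _ => meanField hS (unif N)) (S.forcing u)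
      (y0, ⟨x0, continuous_of_discreteTopology⟩) T
      (fun t => (y t, ⟨x t, continuous_of_discreteTopology⟩)) := by
  have hx : ContinuousOn (fun t => (⟨x t, continuous_of_discreteTopology⟩ : C(Fin N, Eu d)))
      (Icc 0 T) := by
    intro t ht
    rw [ContinuousWithinAt, tendsto_iff_norm_sub_tendsto_zero]
    refine squeeze_zero (fun _ => norm_nonneg _) (fun s => ?_)
      (tendsto_iff_norm_sub_tendsto_zero.1 (h.x_cont t ht))
    exact (ContinuousMap.norm_le _ (norm_nonneg _)).2 fun i => norm_le_pi_norm (x s - x t) i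
  refine isSol_of_components hS (h.y_cont.prodMk hx) (fun t ht k => ?_) fun t ht θ => ?_
  · simpa only [ContinuousMap.coe_mk, map_unif, conv_empirical] using h.y_eq t ht k
  · simpa only [ContinuousMap.coe_mk, map_unif, conv_empirical] using h.x_eq t ht θ

theorem Data.IsParticleSol.unique {N : ℕ} [NeZero N] (hS : S.HypH) {u : Control D T S.U}
    {y0 : Leaders d m} {x0 : Fin N → Eu d} {y y' : ℝ → Leaders d m} {x x' : ℝ → Fin N → Eu d}
    (h : S.IsParticleSol T y0 x0 u y x) (h' : S.IsParticleSol T y0 x0 u y' x') :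
    ∀ t ∈ Icc 0 T, y t = y' t ∧ x t = x' t := by
  intro t ht
  obtain ⟨C, hC⟩ := exists_isTame_meanField (Fin N) hS T
  have := (h.isSol hS).eq_of_isTame (hC (unif N)) (h'.isSol hS) t ht
  simp only [Prod.mk.injEq, ContinuousMap.mk.injEq] at this
  exact this

/-! ### The mean-field system -/

theorem W1_map_le (X Y : C(Ω, Eu d)) : W1 (P.map X) (P.map Y) ≤ ENNReal.ofReal ‖X - Y‖ := by
  have hXY : Measurable (fun θ => (X θ, Y θ)) :=
    X.continuous.measurable.prodMk Y.continuous.measurable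
  refine (iInf₂_le (P.map fun θ => (X θ, Y θ)) ⟨?_, ?_⟩).trans ?_
  · rw [lintegral_map measurable_edist hXY]
    refine (lintegral_mono (g := fun _ => ENNReal.ofReal ‖X - Y‖) fun θ => ?_).trans (by simp)
    rw [edist_dist, dist_eq_norm]
    exact ENNReal.ofReal_le_ofReal ((X - Y).norm_coe_le_norm θ)
  · rw [Measure.map_map measurable_fst hXY]; rfl
  · rw [Measure.map_map measurable_snd hXY]; rfl

theorem support_map_subset {X : C(Ω, Eu d)} {R : ℝ} (hR : ‖X‖ < R) :
    (P.map X).support ⊆ Metric.ball 0 R := by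
  refine (Measure.support_subset_of_isClosed (t := Metric.closedBall 0 ‖X‖) Metric.isClosed_closedBall
    ?_).trans (Metric.closedBall_subset_ball hR)
  filter_upwards [ae_map_norm_le (P := P) X] with x hx
  simpa using hx

/-- Transport of a measure along differentiable curves of maps gives the weak form of the
continuity equation. -/
theorem hasDerivWithinAt_integral_map [T2Space Ω] {X V : ℝ → C(Ω, Eu d)}
    (hX : ∀ t ∈ Icc 0 T, HasDerivWithinAt X (V t) (Icc 0 T) t) (hV : ContinuousOn V (Icc 0 T))
    {φ : Eu d → ℝ} (hφ : ContDiff ℝ 1 φ) {t : ℝ} (ht : t ∈ Icc 0 T) :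
    HasDerivWithinAt (fun s => ∫ x, φ x ∂(P.map (X s)))
      (∫ θ, fderiv ℝ φ (X t θ) (V t θ) ∂P) (Icc 0 T) t := by
  have hXc : ContinuousOn X (Icc 0 T) := fun t ht => (hX t ht).continuousWithinAt
  have hφ' := hφ.continuous_fderiv one_ne_zero
  let G : ℝ → C(Ω, ℝ) := fun s => ⟨fun θ => fderiv ℝ φ (X s θ) (V s θ),
    (hφ'.comp (X s).continuous).clm_apply (V s).continuous⟩
  have hG : ContinuousOn G (Icc 0 T) := by
    rw [continuousOn_iff_continuous_domRestrict] at hXc hV ⊢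
    refine ContinuousMap.continuous_of_continuous_uncurry _ ?_
    have h1 : Continuous (fun p : Icc 0 T × Ω => X p.1 p.2) :=
      (hXc.comp continuous_fst).eval continuous_snd
    have h2 : Continuous (fun p : Icc 0 T × Ω => V p.1 p.2) :=
      (hV.comp continuous_fst).eval continuous_snd
    exact (hφ'.comp h1).clm_apply h2
  let Φ : ℝ → C(Ω, ℝ) := fun s => ⟨fun θ => φ (X s θ), hφ.continuous.comp (X s).continuous⟩
  have hΦ : ∀ s ∈ Icc 0 T, Φ s = Φ 0 + ∫ r in (0 : ℝ)..s, G r := by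
    intro s hs
    have hsub : Icc 0 s ⊆ Icc 0 T := Icc_subset_Icc_right hs.2
    have hGi : IntervalIntegrable G volume 0 s := (hG.mono hsub).intervalIntegrable_of_Icc hs.1
    ext θ
    let e : C(Ω, ℝ) →L[ℝ] ℝ := ContinuousMap.evalCLM ℝ θ
    let eX : C(Ω, Eu d) →L[ℝ] Eu d := ContinuousMap.evalCLM ℝ θ
    change φ (X s θ) = φ (X 0 θ) + e (∫ r in (0 : ℝ)..s, G r)
    rw [← e.intervalIntegral_comp_comm hGi]
    have hd : ∀ r ∈ Icc 0 T, HasDerivWithinAt (fun r => φ (X r θ)) (e (G r)) (Icc 0 T) r := by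
      intro r hr
      have h1 : HasDerivWithinAt (fun r => X r θ) (V r θ) (Icc 0 T) r :=
        eX.hasFDerivAt.comp_hasDerivWithinAt r (hX r hr)
      exact ((hφ.differentiable one_ne_zero) (X r θ)).hasFDerivAt.comp_hasDerivWithinAt r h1
    rw [intervalIntegral.integral_eq_sub_of_hasDeriv_right_of_le (f := fun r => φ (X r θ)) hs.1
      (fun r hr => (hd r (hsub hr)).continuousWithinAt.mono hsub)
      (fun r hr => (hd r (hsub (Ioo_subset_Icc_self hr))).mono_of_mem_nhdsWithin
        (Icc_mem_nhdsGT_of_mem ⟨hr.1.le, hr.2.trans_le hs.2⟩))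
      ⟨e.integrable_comp hGi.1, e.integrable_comp hGi.2⟩]
    ring
  have hder : HasDerivWithinAt Φ (G t) (Icc 0 T) t :=
    ((hasDerivWithinAt_integral_Icc hG ht).const_add (Φ 0)).congr_of_mem hΦ ht
  have := (integralC P : C(Ω, ℝ) →L[ℝ] ℝ).hasFDerivAt.comp_hasDerivWithinAt t hder
  refine this.congr_of_mem (fun s _ => ?_) ht
  exact integral_map_continuousMap (X s) hφ.continuous

/-- If the initial positions are distributed according to `μ⁰`, the image of `P` under the flow
solves the mean-field system. -/
theorem IsSol.isMeanFieldSol [T2Space Ω] {hS : S.HypH} {u : Control D T S.U} {y0 : Leaders d m}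
    {ξ : C(Ω, Eu d)} {z : ℝ → Leaders d m × C(Ω, Eu d)} (hT : 0 ≤ T)
    (hz : IsSol (fun _ => meanField hS P) (S.forcing u) (y0, ξ) T z)
    {mu0 : ProbabilityMeasure (Eu d)} (h0 : P.map ξ = mu0) :
    S.IsMeanFieldSol T y0 mu0 u (fun t => (z t).1) (fun t => ⟨P.map (z t).2, inferInstance⟩) := by
  have hz0 : z 0 = (y0, ξ) := by
    have := hz.eq 0 ⟨le_rfl, hT⟩
    simpa [S.forcing_zero u] using this
  have hXc : ContinuousOn (fun t => (z t).2) (Icc 0 T) := continuous_snd.comp_continuousOn hz.cont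
  have hX : ∀ t ∈ Icc 0 T, HasDerivWithinAt (fun t => (z t).2) (meanField hS P (z t)).2
      (Icc 0 T) t := fun t ht =>
    ((hasDerivWithinAt_integral_Icc hz.continuousOn_meanField_snd ht).const_add ξ).congr_of_mem
      (fun s hs => hz.snd_eq hs) ht
  refine ⟨by simp [hz0], ?_, continuous_fst.comp_continuousOn hz.cont, fun t ht => ?_, ?_,
    fun t ht k => hz.fst_apply ht k, fun φ hφ _ t ht => ?_⟩
  · refine Subtype.ext ?_
    change P.map (z 0).2 = _
    rw [hz0, h0]; rfl
  · have h1 : Tendsto (fun s => ENNReal.ofReal ‖(z s).2 - (z t).2‖) (𝓝[Icc 0 T] t) (𝓝 0) := by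
      have := (tendsto_iff_norm_sub_tendsto_zero.1 (hXc t ht))
      simpa using ENNReal.tendsto_ofReal this
    exact tendsto_of_tendsto_of_tendsto_of_le_of_le tendsto_const_nhds h1 (fun _ => zero_le)
      fun s => W1_map_le _ _
  · obtain ⟨R, hR⟩ := exists_norm_le_of_continuousOn hXc
    exact ⟨R + 1, fun t ht => support_map_subset ((hR t ht).trans_lt (lt_add_one R))⟩
  · have h1 := hasDerivWithinAt_integral_map (P := P) hX hz.continuousOn_meanField_snd
      (hφ.of_le (by exact_mod_cast le_top)) ht
    convert! h1 using 1
    refine integral_map_continuousMap (z t).2 ?_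
    exact (hφ.continuous_fderiv (by simp)).clm_apply ((hS.continuous_conv_map _).add
      (hS.continuous_g.comp (continuous_const.prodMk continuous_id)))

end Systems

variable {d : ℕ}

/-! ### Uniqueness for the linear continuity equation -/

/-- A `C¹` function is approximated on a ball, together with its derivative, by test functions. -/
theorem exists_testFunction_approx {ψ : Eu d → ℝ} (hψ : ContDiff ℝ 1 ψ) (R : ℝ) {ε : ℝ}
    (hε : 0 < ε) : ∃ φ : Eu d → ℝ, ContDiff ℝ ∞ φ ∧ HasCompactSupport φ ∧
      ∀ x, ‖x‖ ≤ R → |φ x - ψ x| ≤ ε ∧ ‖fderiv ℝ φ x - fderiv ℝ ψ x‖ ≤ ε := by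
  let χ : ContDiffBump (0 : Eu d) := ⟨max R 0 + 1, max R 0 + 2, by positivity, by linarith⟩
  set ψ₁ : Eu d → ℝ := fun x => χ x * ψ x with hψ₁
  have h1 : ContDiff ℝ 1 ψ₁ := χ.contDiff.mul hψ
  have h1c : HasCompactSupport ψ₁ := χ.hasCompactSupport.mul_right
  have heq : ∀ x, ‖x‖ ≤ R → ψ₁ =ᶠ[𝓝 x] ψ := fun x hx => by
    have hmem : x ∈ Metric.ball (0 : Eu d) χ.rIn := by
      rw [mem_ball_zero_iff]
      exact (hx.trans (le_max_left R 0)).trans_lt (lt_add_one _)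
    filter_upwards [Metric.isOpen_ball.mem_nhds hmem] with y hy
    rw [hψ₁]
    simp only
    rw [χ.one_of_mem_closedBall (Metric.ball_subset_closedBall hy), one_mul]
  have hf1 := h1.continuous_fderiv one_ne_zero
  obtain ⟨δ₁, hδ₁, hu₁⟩ := Metric.uniformContinuous_iff.1
    (h1.continuous.uniformContinuous_of_tendsto_cocompact h1c.is_zero_at_infty) ε hε
  obtain ⟨δ₂, hδ₂, hu₂⟩ := Metric.uniformContinuous_iff.1
    (hf1.uniformContinuous_of_tendsto_cocompact (h1c.fderiv ℝ).is_zero_at_infty) ε hε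
  have hδ : 0 < min δ₁ δ₂ := lt_min hδ₁ hδ₂
  let ρ : ContDiffBump (0 : Eu d) := ⟨min δ₁ δ₂ / 2, min δ₁ δ₂, half_pos hδ, half_lt_self hδ⟩
  set φ : Eu d → ℝ :=
    MeasureTheory.convolution (ρ.normed volume) ψ₁ (ContinuousLinearMap.lsmul ℝ ℝ) volume with hφ
  have hρi : LocallyIntegrable (ρ.normed volume : Eu d → ℝ) volume :=
    ρ.continuous_normed.locallyIntegrable
  have hder : ∀ x, fderiv ℝ φ x = MeasureTheory.convolution (ρ.normed volume) (fderiv ℝ ψ₁)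
      (ContinuousLinearMap.lsmul ℝ ℝ) volume x := fun x => by
    rw [(h1c.hasFDerivAt_convolution_right (ContinuousLinearMap.lsmul ℝ ℝ) hρi h1 x).fderiv]
    rfl
  refine ⟨φ, ?_, ?_, fun x hx => ⟨?_, ?_⟩⟩
  · exact ρ.hasCompactSupport_normed.contDiff_convolution_left _ ρ.contDiff_normed
      h1.continuous.locallyIntegrable
  · exact ρ.hasCompactSupport_normed.convolution _ h1c
  · rw [← (heq x hx).eq_of_nhds, ← Real.dist_eq]
    exact ρ.dist_normed_convolution_le h1.continuous.aestronglyMeasurable fun y hy =>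
      (hu₁ ((Metric.mem_ball.1 hy).trans_le (min_le_left _ _))).le
  · rw [← (heq x hx).fderiv_eq, hder, ← dist_eq_norm]
    exact ρ.dist_normed_convolution_le hf1.aestronglyMeasurable fun y hy =>
      (hu₂ ((Metric.mem_ball.1 hy).trans_le (min_le_right _ _))).le

/-- A curve of probability measures on a ball which solves `∂_t μ = -∇·(b μ)` weakly. -/
structure IsWeakSol (b : ℝ → Eu d → Eu d) (T R : ℝ) (μ : ℝ → Measure (Eu d)) : Prop where
  prob : ∀ t, IsProbabilityMeasure (μ t)
  supp : ∀ t ∈ Icc 0 T, ∀ᵐ x ∂(μ t), ‖x‖ ≤ R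
  eq : ∀ φ : Eu d → ℝ, ContDiff ℝ ∞ φ → HasCompactSupport φ → ∀ t ∈ Icc 0 T,
    HasDerivWithinAt (fun s => ∫ x, φ x ∂(μ s)) (∫ x, fderiv ℝ φ x (b t x) ∂(μ t)) (Icc 0 T) t

section

variable {b : ℝ → Eu d → Eu d} {T R B : ℝ} {μ ν : ℝ → Measure (Eu d)}

theorem abs_integral_le_of_ae_norm_le {μ : Measure (Eu d)} [IsProbabilityMeasure μ] {R C : ℝ}
    (hμ : ∀ᵐ x ∂μ, ‖x‖ ≤ R) {f : Eu d → ℝ} (hf : ∀ x, ‖x‖ ≤ R → |f x| ≤ C) :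
    |∫ x, f x ∂μ| ≤ C := by
  have := norm_integral_le_of_norm_le_const (μ := μ) (f := f) (C := C)
    (hμ.mono fun x hx => by simpa using hf x hx)
  simpa using this

theorem abs_integral_sub_le_of_ae_norm_le {μ : Measure (Eu d)} [IsProbabilityMeasure μ] {R C : ℝ}
    (hμ : ∀ᵐ x ∂μ, ‖x‖ ≤ R) {f g : Eu d → ℝ} (hfc : Continuous f) (hgc : Continuous g)
    (hf : ∀ x, ‖x‖ ≤ R → |f x - g x| ≤ C) : |∫ x, f x ∂μ - ∫ x, g x ∂μ| ≤ C := by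
  rw [← integral_sub (integrable_of_ae_norm_le hfc hμ) (integrable_of_ae_norm_le hgc hμ)]
  exact abs_integral_le_of_ae_norm_le hμ hf

theorem le_of_forall_pos_le_add_mul {a c k : ℝ} (h : ∀ ε > 0, a ≤ c + ε * k) : a ≤ c := by
  refine le_of_forall_pos_le_add fun ε hε => (h (ε / (|k| + 1)) (by positivity)).trans ?_
  gcongr
  rw [div_mul_eq_mul_div, div_le_iff₀ (by positivity)]
  have := le_abs_self k
  nlinarith

/-- Weak solutions are Lipschitz in time when tested with `C¹` functions. -/
theorem IsWeakSol.abs_integral_sub_le (h : IsWeakSol b T R μ)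
    (hB : ∀ t ∈ Icc 0 T, ∀ x, ‖x‖ ≤ R → ‖b t x‖ ≤ B) {ψ : Eu d → ℝ} (hψ : ContDiff ℝ 1 ψ) {κ : ℝ}
    (hκ0 : 0 ≤ κ) (hκ : ∀ x, ‖x‖ ≤ R → ‖fderiv ℝ ψ x‖ ≤ κ) {s t : ℝ} (hs : s ∈ Icc 0 T)
    (ht : t ∈ Icc 0 T) : |∫ x, ψ x ∂(μ t) - ∫ x, ψ x ∂(μ s)| ≤ κ * B * |t - s| := by
  have := h.prob
  refine le_of_forall_pos_le_add_mul (k := 2 + B * |t - s|) fun ε hε => ?_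
  obtain ⟨φ, hφ, hφc, hφψ⟩ := exists_testFunction_approx hψ R hε
  have h1 : |∫ x, φ x ∂(μ t) - ∫ x, φ x ∂(μ s)| ≤ (κ + ε) * B * |t - s| := by
    refine (convex_Icc 0 T).norm_image_sub_le_of_norm_hasDerivWithin_le (C := (κ + ε) * B)
      (fun r hr => h.eq φ hφ hφc r hr) (fun r hr => ?_) hs ht
    refine abs_integral_le_of_ae_norm_le (h.supp r hr) fun x hx => ?_
    have h2 : ‖fderiv ℝ φ x‖ ≤ κ + ε :=
      (norm_le_insert' _ (fderiv ℝ ψ x)).trans (add_le_add (hκ x hx) (hφψ x hx).2)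
    exact ((fderiv ℝ φ x).le_opNorm _).trans (by gcongr; exact hB r hr x hx)
  have h3 := abs_integral_sub_le_of_ae_norm_le (h.supp t ht) hφ.continuous hψ.continuous
    fun x hx => (hφψ x hx).1
  have h4 := abs_integral_sub_le_of_ae_norm_le (h.supp s hs) hφ.continuous hψ.continuous
    fun x hx => (hφψ x hx).1
  rw [abs_le] at *
  constructor <;> nlinarith

/-- First-order expansion in time of a weak solution tested with a `C¹` function `ψ` for which
`Dψ · b(s)` is `C¹`. -/
theorem IsWeakSol.abs_expansion_le (h : IsWeakSol b T R μ) (hB0 : 0 ≤ B)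
    (hbc : ∀ t ∈ Icc 0 T, Continuous (b t))
    (hB : ∀ t ∈ Icc 0 T, ∀ x, ‖x‖ ≤ R → ‖b t x‖ ≤ B) {ψ : Eu d → ℝ} (hψ : ContDiff ℝ 1 ψ) {κ κ' : ℝ}
    (hκ0 : 0 ≤ κ) (hκ : ∀ x, ‖x‖ ≤ R → ‖fderiv ℝ ψ x‖ ≤ κ) {s t η : ℝ} (hs : s ∈ Icc 0 T)
    (ht : t ∈ Icc 0 T) (hst : s ≤ t) (hF : ContDiff ℝ 1 (fun x => fderiv ℝ ψ x (b s x)))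
    (hκ'0 : 0 ≤ κ') (hκ' : ∀ x, ‖x‖ ≤ R → ‖fderiv ℝ (fun x => fderiv ℝ ψ x (b s x)) x‖ ≤ κ')
    (hη : ∀ r ∈ Icc s t, ∀ x, ‖x‖ ≤ R → ‖b r x - b s x‖ ≤ η) :
    |∫ x, ψ x ∂(μ t) - ∫ x, ψ x ∂(μ s) - (t - s) * ∫ x, fderiv ℝ ψ x (b s x) ∂(μ s)| ≤
      (κ * η + κ' * B * (t - s)) * (t - s) := by
  have := h.prob
  have hts : 0 ≤ t - s := sub_nonneg.2 hst
  refine le_of_forall_pos_le_add_mul (k := 2 + B * (t - s)) fun ε hε => ?_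
  obtain ⟨φ, hφ, hφc, hφψ⟩ := exists_testFunction_approx hψ R hε
  set c := ∫ x, fderiv ℝ ψ x (b s x) ∂(μ s) with hc
  have hsub : Icc s t ⊆ Icc 0 T := Icc_subset_Icc hs.1 ht.2
  have h1 : |(∫ x, φ x ∂(μ t) - t * c) - (∫ x, φ x ∂(μ s) - s * c)| ≤
      (ε * B + κ * η + κ' * B * (t - s)) * |t - s| := by
    refine (convex_Icc s t).norm_image_sub_le_of_norm_hasDerivWithin_le
      (f := fun r => ∫ x, φ x ∂(μ r) - r * c)
      (f' := fun r => ∫ x, fderiv ℝ φ x (b r x) ∂(μ r) - 1 * c)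
      (fun r hr => (((h.eq φ hφ hφc r (hsub hr)).mono hsub).sub
        ((hasDerivWithinAt_id r _).mul_const c))) (fun r hr => ?_) (left_mem_Icc.2 hst)
      (right_mem_Icc.2 hst)
    have hr' := hsub hr
    have e1 : |∫ x, fderiv ℝ φ x (b r x) ∂(μ r) - ∫ x, fderiv ℝ ψ x (b s x) ∂(μ r)| ≤
        ε * B + κ * η := by
      refine abs_integral_sub_le_of_ae_norm_le (h.supp r hr')
        ((hφ.continuous_fderiv (by simp)).clm_apply (hbc r hr')) hF.continuous fun x hx => ?_
      have e : fderiv ℝ φ x (b r x) - fderiv ℝ ψ x (b s x) =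
          (fderiv ℝ φ x - fderiv ℝ ψ x) (b r x) + fderiv ℝ ψ x (b r x - b s x) := by
        rw [map_sub, sub_apply]; ring
      rw [e]
      refine (abs_add_le _ _).trans (add_le_add ?_ ?_)
      · exact ((fderiv ℝ φ x - fderiv ℝ ψ x).le_opNorm _).trans
          (mul_le_mul (hφψ x hx).2 (hB r hr' x hx) (norm_nonneg _) hε.le)
      · exact ((fderiv ℝ ψ x).le_opNorm _).trans
          (mul_le_mul (hκ x hx) (hη r hr x hx) (norm_nonneg _) hκ0)
    have e2 := h.abs_integral_sub_le hB hF hκ'0 hκ' hs hr'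
    rw [abs_of_nonneg (sub_nonneg.2 hr.1), ← hc] at e2
    have e3 : κ' * B * (r - s) ≤ κ' * B * (t - s) := by gcongr; exact hr.2
    rw [Real.norm_eq_abs]
    rw [abs_le] at *
    constructor <;> linarith
  have h3 := abs_integral_sub_le_of_ae_norm_le (h.supp t ht) hφ.continuous hψ.continuous
    fun x hx => (hφψ x hx).1
  have h4 := abs_integral_sub_le_of_ae_norm_le (h.supp s hs) hφ.continuous hψ.continuous
    fun x hx => (hφψ x hx).1
  rw [abs_of_nonneg hts] at h1
  rw [abs_le] at *
  constructor <;> nlinarith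

/-- `C²` functions whose first derivative is bounded by `κ` and `κ`-Lipschitz. -/
structure C2Bound {F : Type*} [NormedAddCommGroup F] [NormedSpace ℝ F] (κ : ℝ) (ψ : Eu d → F) :
    Prop where
  contDiff : ContDiff ℝ 2 ψ
  norm_le : ∀ x, ‖fderiv ℝ ψ x‖ ≤ κ
  lip : ∀ x y, ‖fderiv ℝ ψ x - fderiv ℝ ψ y‖ ≤ κ * ‖x - y‖

theorem C2Bound.nonneg {F : Type*} [NormedAddCommGroup F] [NormedSpace ℝ F] {κ : ℝ} {ψ : Eu d → F}
    (h : C2Bound κ ψ) : 0 ≤ κ := (norm_nonneg _).trans (h.norm_le 0)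

theorem C2Bound.differentiable {F : Type*} [NormedAddCommGroup F] [NormedSpace ℝ F] {κ : ℝ}
    {ψ : Eu d → F} (h : C2Bound κ ψ) : Differentiable ℝ ψ := h.contDiff.differentiable two_ne_zero

theorem C2Bound.norm_sub_le {F : Type*} [NormedAddCommGroup F] [NormedSpace ℝ F] {κ : ℝ}
    {ψ : Eu d → F} (h : C2Bound κ ψ) (x y : Eu d) : ‖ψ x - ψ y‖ ≤ κ * ‖x - y‖ :=
  convex_univ.norm_image_sub_le_of_norm_fderiv_le (𝕜 := ℝ) (fun x _ => h.differentiable x)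
    (fun x _ => h.norm_le x) (mem_univ y) (mem_univ x)

theorem C2Bound.norm_taylor_le {κ : ℝ} {ψ : Eu d → ℝ} (h : C2Bound κ ψ) (x v : Eu d) :
    |ψ (x + v) - ψ x - fderiv ℝ ψ x v| ≤ κ * ‖v‖ ^ 2 := by
  have key := (convex_closedBall x ‖v‖).norm_image_sub_le_of_norm_hasFDerivWithin_le'
    (𝕜 := ℝ) (f := ψ) (f' := fun y => fderiv ℝ ψ y) (φ := fderiv ℝ ψ x) (C := κ * ‖v‖)
    (x := x) (y := x + v) (fun y _ => (h.differentiable y).hasFDerivAt.hasFDerivWithinAt)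
    (fun y hy => (h.lip y x).trans (by
      rw [mem_closedBall_iff_norm] at hy
      exact mul_le_mul_of_nonneg_left hy h.nonneg)) (Metric.mem_closedBall_self (norm_nonneg v))
    (by simp)
  rw [add_sub_cancel_left, mul_assoc, ← sq] at key
  exact key

theorem C2Bound.contDiff_fderiv_apply {κ : ℝ} {ψ : Eu d → ℝ} (h : C2Bound κ ψ)
    {c : Eu d → Eu d} (hc : ContDiff ℝ 1 c) : ContDiff ℝ 1 (fun x => fderiv ℝ ψ x (c x)) :=
  (h.contDiff.fderiv_right (m := 1) (by norm_num)).clm_apply hc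

theorem C2Bound.norm_fderiv_fderiv_apply_le {κ L B : ℝ} {ψ : Eu d → ℝ} (h : C2Bound κ ψ)
    {c : Eu d → Eu d} (hc : C2Bound L c) {R : ℝ} (hB : ∀ x, ‖x‖ ≤ R → ‖c x‖ ≤ B) (x : Eu d)
    (hx : ‖x‖ ≤ R) : ‖fderiv ℝ (fun x => fderiv ℝ ψ x (c x)) x‖ ≤ κ * (B + L) := by
  have hψ' : Differentiable ℝ (fderiv ℝ ψ) :=
    (h.contDiff.fderiv_right (m := 1) (by norm_num)).differentiable one_ne_zero
  rw [((hψ' x).hasFDerivAt.clm_apply (hc.differentiable x).hasFDerivAt).fderiv]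
  have h2 : ‖fderiv ℝ (fderiv ℝ ψ) x‖ ≤ κ := by
    refine norm_fderiv_le_of_lip' ℝ h.nonneg (Eventually.of_forall fun y => ?_)
    exact h.lip y x
  refine ContinuousLinearMap.opNorm_le_bound _ (by
    have := h.nonneg; have := hc.nonneg
    have := (norm_nonneg _).trans (hB x hx); positivity) fun v => ?_
  have e1 : ‖fderiv ℝ ψ x (fderiv ℝ c x v)‖ ≤ κ * (L * ‖v‖) :=
    ((fderiv ℝ ψ x).le_opNorm _).trans (mul_le_mul (h.norm_le x)
      (((fderiv ℝ c x).le_opNorm v).trans (by gcongr; exact hc.norm_le x)) (norm_nonneg _) h.nonneg)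
  have e2 : ‖fderiv ℝ (fderiv ℝ ψ) x v (c x)‖ ≤ κ * ‖v‖ * B :=
    ((fderiv ℝ (fderiv ℝ ψ) x v).le_opNorm _).trans (mul_le_mul
      (((fderiv ℝ (fderiv ℝ ψ) x).le_opNorm v).trans (by gcongr)) (hB x hx) (norm_nonneg _)
      (by have := h.nonneg; positivity))
  refine (norm_add_le _ _).trans ?_
  refine (add_le_add e1 e2).trans_eq ?_
  ring

/-- One step of the backward Euler scheme: composition with `id + h b` preserves the class of
test functions, with a constant growing by a factor `1 + O(h)`. -/
theorem C2Bound.comp_add_smul {κ L h : ℝ} {ψ : Eu d → ℝ} (hψ : C2Bound κ ψ)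
    {c : Eu d → Eu d} (hc : C2Bound L c) (hh : 0 ≤ h) :
    C2Bound (κ * ((1 + h * L) ^ 2 + h * L)) (fun x => ψ (x + h • c x)) := by
  have hκ := hψ.nonneg
  have hL := hc.nonneg
  have hD : ∀ x, HasFDerivAt (fun x => ψ (x + h • c x))
      ((fderiv ℝ ψ (x + h • c x)).comp (ContinuousLinearMap.id ℝ (Eu d) + h • fderiv ℝ c x)) x :=
    fun x => (hψ.differentiable _).hasFDerivAt.comp x
      ((hasFDerivAt_id x).add ((hc.differentiable x).hasFDerivAt.const_smul h))
  have hA : ∀ x, ‖ContinuousLinearMap.id ℝ (Eu d) + h • fderiv ℝ c x‖ ≤ 1 + h * L := fun x => by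
    refine (norm_add_le _ _).trans (add_le_add ContinuousLinearMap.norm_id_le ?_)
    rw [norm_smul, Real.norm_of_nonneg hh]
    gcongr
    exact hc.norm_le x
  refine ⟨hψ.contDiff.comp (contDiff_id.add (hc.contDiff.const_smul h)), fun x => ?_,
    fun x y => ?_⟩
  · rw [(hD x).fderiv]
    refine (ContinuousLinearMap.opNorm_comp_le _ _).trans
      (mul_le_mul (hψ.norm_le _) ?_ (norm_nonneg _) hκ)
    have : 0 ≤ h * L := by positivity
    exact (hA x).trans (by nlinarith)
  · rw [(hD x).fderiv, (hD y).fderiv]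
    set Ax := ContinuousLinearMap.id ℝ (Eu d) + h • fderiv ℝ c x
    set Ay := ContinuousLinearMap.id ℝ (Eu d) + h • fderiv ℝ c y with hAy
    have e : (fderiv ℝ ψ (x + h • c x)).comp Ax - (fderiv ℝ ψ (y + h • c y)).comp Ay =
        (fderiv ℝ ψ (x + h • c x) - fderiv ℝ ψ (y + h • c y)).comp Ax +
          (fderiv ℝ ψ (y + h • c y)).comp (Ax - Ay) := by
      rw [ContinuousLinearMap.sub_comp, ContinuousLinearMap.comp_sub]; abel
    rw [e]
    have e1 : ‖x + h • c x - (y + h • c y)‖ ≤ (1 + h * L) * ‖x - y‖ := by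
      have : x + h • c x - (y + h • c y) = (x - y) + h • (c x - c y) := by
        rw [smul_sub]; abel
      rw [this]
      refine (norm_add_le _ _).trans ?_
      rw [norm_smul, Real.norm_of_nonneg hh]
      have := mul_le_mul_of_nonneg_left (hc.norm_sub_le x y) hh
      linarith
    have e2 : ‖Ax - Ay‖ ≤ h * L * ‖x - y‖ := by
      have : Ax - Ay = h • (fderiv ℝ c x - fderiv ℝ c y) := by
        rw [smul_sub, hAy]; simp only [Ax]; abel
      rw [this, norm_smul, Real.norm_of_nonneg hh, mul_assoc]
      exact mul_le_mul_of_nonneg_left (hc.lip x y) hh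
    have e3 : ‖(fderiv ℝ ψ (x + h • c x) - fderiv ℝ ψ (y + h • c y)).comp Ax‖ ≤
        κ * ((1 + h * L) * ‖x - y‖) * (1 + h * L) :=
      (ContinuousLinearMap.opNorm_comp_le _ _).trans (mul_le_mul ((hψ.lip _ _).trans
        (by gcongr)) (hA x) (norm_nonneg _) (by positivity))
    have e4 : ‖(fderiv ℝ ψ (y + h • c y)).comp (Ax - Ay)‖ ≤ κ * (h * L * ‖x - y‖) :=
      (ContinuousLinearMap.opNorm_comp_le _ _).trans
        (mul_le_mul (hψ.norm_le _) e2 (norm_nonneg _) hκ)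
    refine (norm_add_le _ _).trans ((add_le_add e3 e4).trans_eq ?_)
    ring

/-- Testing a weak solution at time `s + h` with `ψ` amounts, up to `o(h)`, to testing it at time
`s` with `ψ ∘ (id + h b(s))`. -/
theorem IsWeakSol.abs_step_le (hμ : IsWeakSol b T R μ) {L : ℝ} (hB0 : 0 ≤ B)
    (hb : ∀ t ∈ Icc 0 T, C2Bound L (b t))
    (hB : ∀ t ∈ Icc 0 T, ∀ x, ‖x‖ ≤ R → ‖b t x‖ ≤ B) {ψ : Eu d → ℝ} {κ : ℝ} (hψ : C2Bound κ ψ)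
    {s h η : ℝ} (hs : s ∈ Icc 0 T) (hsh : s + h ∈ Icc 0 T) (hh : 0 ≤ h)
    (hη : ∀ r ∈ Icc s (s + h), ∀ x, ‖x‖ ≤ R → ‖b r x - b s x‖ ≤ η) :
    |∫ x, ψ x ∂(μ (s + h)) - ∫ x, ψ (x + h • b s x) ∂(μ s)| ≤
      κ * h * (η + h * (B * (B + L) + B ^ 2)) := by
  have := hμ.prob
  have hκ := hψ.nonneg
  have hL := (hb s hs).nonneg
  have hF := hψ.contDiff_fderiv_apply ((hb s hs).contDiff.of_le one_le_two)
  have h1 := hμ.abs_expansion_le hB0 (fun t ht => (hb t ht).contDiff.continuous) hB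
    (hψ.contDiff.of_le one_le_two) hκ (fun x _ => hψ.norm_le x) hs hsh (le_add_of_nonneg_right hh)
    hF (κ' := κ * (B + L)) (by positivity)
    (fun x hx => hψ.norm_fderiv_fderiv_apply_le (hb s hs) (hB s hs) x hx) hη
  rw [add_sub_cancel_left] at h1
  have hbc := (hb s hs).contDiff.continuous
  have hFc : Continuous (fun x => h * fderiv ℝ ψ x (b s x)) := continuous_const.mul hF.continuous
  have h2 : |∫ x, ψ (x + h • b s x) ∂(μ s) - ∫ x, (ψ x + h * fderiv ℝ ψ x (b s x)) ∂(μ s)| ≤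
      κ * (h * B) ^ 2 := by
    refine abs_integral_sub_le_of_ae_norm_le (hμ.supp s hs)
      (hψ.contDiff.continuous.comp (continuous_id.add (hbc.const_smul h)))
      (hψ.contDiff.continuous.add hFc) fun x hx => ?_
    have := hψ.norm_taylor_le x (h • b s x)
    rw [map_smul, smul_eq_mul, norm_smul, Real.norm_of_nonneg hh] at this
    rw [← sub_sub]
    refine this.trans ?_
    gcongr
    exact hB s hs x hx
  rw [integral_add (integrable_of_ae_norm_le hψ.contDiff.continuous (hμ.supp s hs))
    (integrable_of_ae_norm_le hFc (hμ.supp s hs)),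
    integral_const_mul] at h2
  rw [abs_le] at *
  constructor <;> nlinarith

/-- Discrete duality: after `j` steps of length `h`, the integrals of `ψ` against two solutions with
the same initial value are compared by moving `ψ` back to time `0` by Euler steps. The constant of
`ψ` grows by a bounded factor over all steps, and the errors sum up to `O(η + h)`. -/
theorem abs_integral_sub_le_of_isWeakSol (hμ : IsWeakSol b T R μ) (hν : IsWeakSol b T R ν) {L : ℝ}
    (h0 : μ 0 = ν 0) (hB0 : 0 ≤ B) (hb : ∀ t ∈ Icc 0 T, C2Bound L (b t))
    (hB : ∀ t ∈ Icc 0 T, ∀ x, ‖x‖ ≤ R → ‖b t x‖ ≤ B) {h η : ℝ} (hh : 0 ≤ h)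
    (hη0 : 0 ≤ η) (hL : 0 ≤ L)
    (hη : ∀ r ∈ Icc 0 T, ∀ s ∈ Icc 0 T, |r - s| ≤ h → ∀ x, ‖x‖ ≤ R → ‖b r x - b s x‖ ≤ η)
    (j : ℕ) : j * h ≤ T → ∀ (κ : ℝ) (ψ : Eu d → ℝ), C2Bound κ ψ →
      |∫ x, ψ x ∂(μ (j * h)) - ∫ x, ψ x ∂(ν (j * h))| ≤
        2 * (j * h) * κ * ((1 + h * L) ^ 2 + h * L) ^ j *
          (η + h * (B * (B + L) + B ^ 2)) := by
  induction j with
  | zero => intro _ κ ψ _; simp [h0]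
  | succ j ih =>
    intro hj κ ψ hψ
    push_cast at hj ⊢
    have hjh : 0 ≤ (j : ℝ) * h := by positivity
    have hj' : (j : ℝ) * h ≤ T := by nlinarith
    have hs : (j : ℝ) * h ∈ Icc 0 T := ⟨hjh, hj'⟩
    have e : ((j : ℝ) + 1) * h = j * h + h := by ring
    rw [e] at hj ⊢
    have hsh : (j : ℝ) * h + h ∈ Icc 0 T := ⟨by positivity, hj⟩
    have hη' : ∀ r ∈ Icc ((j : ℝ) * h) (j * h + h), ∀ x, ‖x‖ ≤ R →
        ‖b r x - b (j * h) x‖ ≤ η := fun r hr => hη r ⟨hjh.trans hr.1, hr.2.trans hj⟩ _ hs (by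
      rw [abs_of_nonneg (sub_nonneg.2 hr.1)]; linarith [hr.2])
    have h1 := hμ.abs_step_le hB0 hb hB hψ hs hsh hh hη'
    have h2 := hν.abs_step_le hB0 hb hB hψ hs hsh hh hη'
    have h3 := ih hj' _ _ (hψ.comp_add_smul (hb _ hs) hh)
    set q := (1 + h * L) ^ 2 + h * L with hq
    set δ := η + h * (B * (B + L) + B ^ 2) with hδ
    have hκ := hψ.nonneg
    have hhL : 0 ≤ h * L := by positivity
    have hq1 : 1 ≤ q := by rw [hq]; nlinarith
    have hqj : 1 ≤ q ^ (j + 1) := one_le_pow₀ hq1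
    have hδ0 : 0 ≤ δ := by positivity
    have h4 : κ * h * δ ≤ κ * h * δ * q ^ (j + 1) := le_mul_of_one_le_right (by positivity) hqj
    have e2 : 2 * (j * h) * (κ * q) * q ^ j * δ = 2 * (j * h) * κ * q ^ (j + 1) * δ := by ring
    rw [e2] at h3
    have e3 : 2 * (j * h + h) * κ * q ^ (j + 1) * δ =
        2 * (j * h) * κ * q ^ (j + 1) * δ + 2 * (κ * h * δ * q ^ (j + 1)) := by ring
    rw [e3]
    rw [abs_le] at *
    constructor <;> linarith

/-- The number of Euler steps tends to infinity. -/
theorem integral_eq_of_isWeakSol (hμ : IsWeakSol b T R μ) (hν : IsWeakSol b T R ν) {L : ℝ}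
    (h0 : μ 0 = ν 0) (hB0 : 0 ≤ B) (hb : ∀ t ∈ Icc 0 T, C2Bound L (b t))
    (hB : ∀ t ∈ Icc 0 T, ∀ x, ‖x‖ ≤ R → ‖b t x‖ ≤ B)
    (hcont : ∀ η > 0, ∃ δ > 0, ∀ r ∈ Icc 0 T, ∀ s ∈ Icc 0 T, |r - s| ≤ δ → ∀ x, ‖x‖ ≤ R →
      ‖b r x - b s x‖ ≤ η) {t : ℝ} (ht : t ∈ Icc 0 T) {κ : ℝ} {ψ : Eu d → ℝ} (hψ : C2Bound κ ψ) :
    ∫ x, ψ x ∂(μ t) = ∫ x, ψ x ∂(ν t) := by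
  have hκ := hψ.nonneg
  have hL := (hb t ht).nonneg
  have ht0 := ht.1
  set c := B * (B + L) + B ^ 2 with hc
  have hc0 : 0 ≤ c := by positivity
  rw [← sub_eq_zero, ← abs_nonpos_iff]
  refine le_of_forall_pos_le_add_mul
    (k := 2 * t * κ * Real.exp (t * (3 * L + L ^ 2)) * (1 + c)) fun η hη => ?_
  obtain ⟨δ, hδ, hδη⟩ := hcont η hη
  obtain ⟨n, hn⟩ := exists_nat_gt (max (t / δ) (max t (t / η)))
  simp only [max_lt_iff] at hn
  obtain ⟨hn1, hn2, hn3⟩ := hn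
  have hn0 : (0 : ℝ) < n := ht0.trans_lt hn2
  have hnt : (n : ℝ) * (t / n) = t := by field_simp
  set h := t / n with hh
  have hh0 : 0 ≤ h := by positivity
  have hhδ : h ≤ δ := by
    rw [div_lt_iff₀ hδ] at hn1; rw [hh, div_le_iff₀ hn0]; linarith
  have hhη : h ≤ η := by
    rw [div_lt_iff₀ hη] at hn3; rw [hh, div_le_iff₀ hn0]; linarith
  have hh1 : h ≤ 1 := by rw [hh, div_le_iff₀ hn0]; linarith
  have key := abs_integral_sub_le_of_isWeakSol hμ hν h0 hB0 hb hB hh0 hη.le hL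
    (fun r hr s hs hrs => hδη r hr s hs (hrs.trans hhδ)) n (by rw [hnt]; exact ht.2) κ ψ hψ
  rw [hnt] at key
  have hq : ((1 + h * L) ^ 2 + h * L) ^ n ≤ Real.exp (t * (3 * L + L ^ 2)) := by
    have e1 : (1 + h * L) ^ 2 + h * L ≤ Real.exp (h * (3 * L + L ^ 2)) := by
      have := Real.add_one_le_exp (h * (3 * L + L ^ 2))
      have e2 : (h * L) ^ 2 ≤ h * L ^ 2 := by
        have : h ^ 2 ≤ h := by nlinarith
        nlinarith [mul_le_mul_of_nonneg_right this (sq_nonneg L)]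
      nlinarith
    have : t * (3 * L + L ^ 2) = n * (h * (3 * L + L ^ 2)) := by rw [← mul_assoc, hnt]
    rw [this, Real.exp_nat_mul]
    exact pow_le_pow_left₀ (by positivity) e1 n
  have hδ' : η + h * c ≤ η * (1 + c) := by nlinarith
  rw [zero_add]
  refine key.trans ?_
  calc 2 * t * κ * ((1 + h * L) ^ 2 + h * L) ^ n * (η + h * c)
      ≤ 2 * t * κ * Real.exp (t * (3 * L + L ^ 2)) * (η * (1 + c)) := by gcongr
    _ = _ := by ring

/-- Applied to `cos` and `sin`: real and imaginary parts of characters are admissible test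
functions. -/
theorem c2Bound_comp_inner {f f' : ℝ → ℝ} (hf : ContDiff ℝ 2 f) (hf' : ∀ r, HasDerivAt f (f' r) r)
    (hb : ∀ r, |f' r| ≤ 1) (hl : ∀ r s, |f' r - f' s| ≤ |r - s|) (ξ : Eu d) :
    C2Bound (‖ξ‖ + ‖ξ‖ ^ 2) (fun x => f (inner ℝ x ξ)) := by
  have hD : ∀ x, HasFDerivAt (fun x : Eu d => f (inner ℝ x ξ))
      (f' (inner ℝ x ξ) • innerSL ℝ ξ) x := by
    intro x
    have h1 : HasFDerivAt (fun x : Eu d => inner ℝ x ξ) (innerSL ℝ ξ) x := by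
      simp_rw [real_inner_comm ξ]
      exact (innerSL ℝ ξ).hasFDerivAt
    exact (hf' _).comp_hasFDerivAt x h1
  refine ⟨hf.comp (contDiff_id.inner ℝ contDiff_const), fun x => ?_, fun x y => ?_⟩
  · rw [(hD x).fderiv, norm_smul, innerSL_apply_norm, Real.norm_eq_abs]
    nlinarith [hb (inner ℝ x ξ), norm_nonneg ξ, sq_nonneg ‖ξ‖]
  · rw [(hD x).fderiv, (hD y).fderiv, ← sub_smul, norm_smul, innerSL_apply_norm, Real.norm_eq_abs]
    have h1 := hl (inner ℝ x ξ) (inner ℝ y ξ)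
    rw [← inner_sub_left] at h1
    have h2 := h1.trans (abs_real_inner_le_norm (x - y) ξ)
    have h3 := mul_le_mul_of_nonneg_right h2 (norm_nonneg ξ)
    have h4 : 0 ≤ ‖ξ‖ * ‖x - y‖ := by positivity
    nlinarith

/-- Weak solutions of the continuity equation of a `C²` field are determined by their initial
value, since their characteristic functions are. -/
theorem IsWeakSol.unique (hμ : IsWeakSol b T R μ) (hν : IsWeakSol b T R ν) {L : ℝ}
    (h0 : μ 0 = ν 0) (hB0 : 0 ≤ B) (hb : ∀ t ∈ Icc 0 T, C2Bound L (b t))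
    (hB : ∀ t ∈ Icc 0 T, ∀ x, ‖x‖ ≤ R → ‖b t x‖ ≤ B)
    (hcont : ∀ η > 0, ∃ δ > 0, ∀ r ∈ Icc 0 T, ∀ s ∈ Icc 0 T, |r - s| ≤ δ → ∀ x, ‖x‖ ≤ R →
      ‖b r x - b s x‖ ≤ η) {t : ℝ} (ht : t ∈ Icc 0 T) : μ t = ν t := by
  have := hμ.prob t
  have := hν.prob t
  have hcos : ∀ ξ : Eu d, ∫ x, Real.cos (inner ℝ x ξ) ∂(μ t) = ∫ x, Real.cos (inner ℝ x ξ) ∂(ν t) :=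
    fun ξ => integral_eq_of_isWeakSol hμ hν h0 hB0 hb hB hcont ht (c2Bound_comp_inner
      Real.contDiff_cos Real.hasDerivAt_cos (fun r => by rw [abs_neg]; exact Real.abs_sin_le_one r)
      (fun r s => by
        rw [← neg_sub', abs_neg]; exact Real.abs_sin_sub_sin_le r s) ξ)
  have hsin : ∀ ξ : Eu d, ∫ x, Real.sin (inner ℝ x ξ) ∂(μ t) = ∫ x, Real.sin (inner ℝ x ξ) ∂(ν t) :=
    fun ξ => integral_eq_of_isWeakSol hμ hν h0 hB0 hb hB hcont ht (c2Bound_comp_inner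
      Real.contDiff_sin Real.hasDerivAt_sin Real.abs_cos_le_one
      (fun r s => Real.abs_cos_sub_cos_le r s) ξ)
  refine Measure.ext_of_charFun (funext fun ξ => ?_)
  have key : ∀ (ρ : Measure (Eu d)) [IsProbabilityMeasure ρ], charFun ρ ξ =
      ((∫ x, Real.cos (inner ℝ x ξ) ∂ρ : ℝ) : ℂ) + ((∫ x, Real.sin (inner ℝ x ξ) ∂ρ : ℝ) : ℂ) *
        Complex.I := by
    intro ρ _
    have hi : Continuous (fun x : Eu d => (inner ℝ x ξ : ℝ)) := continuous_id.inner continuous_const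
    have h1 : Integrable (fun x : Eu d => Real.cos (inner ℝ x ξ)) ρ :=
      Integrable.of_bound (Real.continuous_cos.comp hi).aestronglyMeasurable 1
        (Eventually.of_forall fun x => Real.abs_cos_le_one _)
    have h2 : Integrable (fun x : Eu d => Real.sin (inner ℝ x ξ)) ρ :=
      Integrable.of_bound (Real.continuous_sin.comp hi).aestronglyMeasurable 1
        (Eventually.of_forall fun x => Real.abs_sin_le_one _)
    rw [charFun_apply, ← integral_complex_ofReal, ← integral_complex_ofReal, ← integral_mul_const,
      ← integral_add h1.ofReal (h2.ofReal.mul_const _)]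
    refine integral_congr_ae (Eventually.of_forall fun x => ?_)
    simp only [Complex.exp_mul_I, Complex.ofReal_cos, Complex.ofReal_sin]
  rw [key, key, hcos, hsin]

end

/-! ### Truncation of `C²` fields -/

section Truncation

variable {d : ℕ} {F : Type*} [NormedAddCommGroup F] [NormedSpace ℝ F]

theorem norm_fderiv_fderiv_eq (f : Eu d → F) (x : Eu d) :
    ‖fderiv ℝ (fderiv ℝ f) x‖ = ‖iteratedFDeriv ℝ 2 f x‖ := by
  rw [← norm_iteratedFDeriv_fderiv, norm_iteratedFDeriv_one]

theorem hasFDerivAt_integral_sub [CompleteSpace F] {k : Eu d → F} (hk : ContDiff ℝ 1 k)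
    (hc : HasCompactSupport k) (μ : Measure (Eu d)) [IsProbabilityMeasure μ] (x : Eu d) :
    HasFDerivAt (fun x => ∫ x', k (x - x') ∂μ) (∫ x', fderiv ℝ k (x - x') ∂μ) x := by
  have hk' := hk.continuous_fderiv one_ne_zero
  obtain ⟨C, hC⟩ := (hc.fderiv ℝ).exists_bound_of_continuous hk'
  obtain ⟨C', hC'⟩ := hc.exists_bound_of_continuous hk.continuous
  have hm : ∀ x : Eu d, Continuous (fun x' : Eu d => x - x') := fun x =>
    continuous_const.sub continuous_id
  refine hasFDerivAt_integral_of_dominated_of_fderiv_le (F := fun x x' => k (x - x'))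
    (F' := fun x x' => fderiv ℝ k (x - x')) (bound := fun _ => C) (s := univ) univ_mem
    (Eventually.of_forall fun x => (hk.continuous.comp (hm x)).aestronglyMeasurable)
    (Integrable.of_bound (hk.continuous.comp (hm x)).aestronglyMeasurable C'
      (Eventually.of_forall fun x' => hC' _))
    (hk'.comp (hm x)).aestronglyMeasurable
    (Eventually.of_forall fun x' x _ => hC _) (integrable_const C)
    (Eventually.of_forall fun x' x _ => ?_)
  exact ((hk.differentiable one_ne_zero) (x - x')).hasFDerivAt.comp x
    ((hasFDerivAt_id x).sub_const x')

theorem continuous_integral_sub [CompleteSpace F] {k : Eu d → F} (hk : Continuous k)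
    (hc : HasCompactSupport k) (μ : Measure (Eu d)) [IsProbabilityMeasure μ] :
    Continuous (fun x => ∫ x', k (x - x') ∂μ) := by
  obtain ⟨C, hC⟩ := hc.exists_bound_of_continuous hk
  exact continuous_of_dominated (bound := fun _ => C)
    (fun x => (hk.comp (continuous_const.sub continuous_id)).aestronglyMeasurable)
    (fun x => Eventually.of_forall fun x' => hC _) (integrable_const C)
    (Eventually.of_forall fun x' => hk.comp (continuous_id.sub continuous_const))

theorem norm_integral_sub_le_of_bound {k : Eu d → F} {C : ℝ} (hC : ∀ x, ‖k x‖ ≤ C)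
    (μ : Measure (Eu d)) [IsProbabilityMeasure μ] (x : Eu d) : ‖∫ x', k (x - x') ∂μ‖ ≤ C :=
  (norm_integral_le_of_norm_le_const (Eventually.of_forall fun x' => hC _)).trans (by simp)

theorem fderiv_integral_sub [CompleteSpace F] {k : Eu d → F} (hk : ContDiff ℝ 1 k)
    (hc : HasCompactSupport k) (μ : Measure (Eu d)) [IsProbabilityMeasure μ] :
    fderiv ℝ (fun x => ∫ x', k (x - x') ∂μ) = fun x => ∫ x', fderiv ℝ k (x - x') ∂μ :=
  funext fun x => (hasFDerivAt_integral_sub hk hc μ x).fderiv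

theorem contDiff_one_integral_sub [CompleteSpace F] {k : Eu d → F} (hk : ContDiff ℝ 1 k)
    (hc : HasCompactSupport k) (μ : Measure (Eu d)) [IsProbabilityMeasure μ] :
    ContDiff ℝ 1 (fun x => ∫ x', k (x - x') ∂μ) := by
  rw [contDiff_one_iff_fderiv, fderiv_integral_sub hk hc]
  exact ⟨fun x => (hasFDerivAt_integral_sub hk hc μ x).differentiableAt,
    continuous_integral_sub (hk.continuous_fderiv one_ne_zero) (hc.fderiv ℝ) μ⟩

theorem contDiff_two_integral_sub [CompleteSpace F] {k : Eu d → F} (hk : ContDiff ℝ 2 k)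
    (hc : HasCompactSupport k) (μ : Measure (Eu d)) [IsProbabilityMeasure μ] :
    ContDiff ℝ 2 (fun x => ∫ x', k (x - x') ∂μ) := by
  have h : ContDiff ℝ (1 + 1) (fun x => ∫ x', k (x - x') ∂μ) := by
    rw [contDiff_succ_iff_fderiv, fderiv_integral_sub (hk.of_le one_le_two) hc]
    exact ⟨fun x => (hasFDerivAt_integral_sub (hk.of_le one_le_two) hc μ x).differentiableAt,
      by simp, contDiff_one_integral_sub (hk.fderiv_right (by norm_num)) (hc.fderiv ℝ) μ⟩
  exact h.of_le (by norm_num)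

theorem exists_norm_integral_sub_le {k : Eu d → F} (hk : Continuous k)
    (hc : HasCompactSupport k) :
    ∃ C : ℝ, 0 ≤ C ∧ ∀ (μ : Measure (Eu d)) [IsProbabilityMeasure μ],
      ∀ x, ‖∫ x', k (x - x') ∂μ‖ ≤ C := by
  obtain ⟨C, hC⟩ := hc.exists_bound_of_continuous hk
  exact ⟨C, (norm_nonneg _).trans (hC 0), fun μ _ x => norm_integral_sub_le_of_bound hC μ x⟩

theorem exists_norm_fderiv_integral_sub_le [CompleteSpace F] {k : Eu d → F}
    (hk : ContDiff ℝ 1 k) (hc : HasCompactSupport k) :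
    ∃ C : ℝ, 0 ≤ C ∧ ∀ (μ : Measure (Eu d)) [IsProbabilityMeasure μ],
      ∀ x, ‖fderiv ℝ (fun x => ∫ x', k (x - x') ∂μ) x‖ ≤ C := by
  obtain ⟨C, hC0, hC⟩ := exists_norm_integral_sub_le (hk.continuous_fderiv one_ne_zero)
    (hc.fderiv ℝ)
  refine ⟨C, hC0, fun μ _ x => ?_⟩
  rw [fderiv_integral_sub hk hc]
  exact hC μ x

theorem exists_norm_fderiv_fderiv_integral_sub_le [CompleteSpace F] {k : Eu d → F}
    (hk : ContDiff ℝ 2 k) (hc : HasCompactSupport k) :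
    ∃ C : ℝ, 0 ≤ C ∧ ∀ (μ : Measure (Eu d)) [IsProbabilityMeasure μ],
      ∀ x, ‖fderiv ℝ (fderiv ℝ (fun x => ∫ x', k (x - x') ∂μ)) x‖ ≤ C := by
  obtain ⟨C, hC0, hC⟩ := exists_norm_fderiv_integral_sub_le
    (hk.fderiv_right (m := 1) (by norm_num)) (hc.fderiv ℝ)
  refine ⟨C, hC0, fun μ _ x => ?_⟩
  rw [fderiv_integral_sub (hk.of_le one_le_two) hc]
  exact hC μ x

theorem exists_norm_iteratedFDeriv_integral_sub_le [CompleteSpace F] {k : Eu d → F}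
    (hk : ContDiff ℝ 2 k) (hc : HasCompactSupport k) :
    ∃ C : ℝ, 0 ≤ C ∧ ∀ (μ : Measure (Eu d)) [IsProbabilityMeasure μ],
      ∀ j ≤ 2, ∀ x, ‖iteratedFDeriv ℝ j (fun x => ∫ x', k (x - x') ∂μ) x‖ ≤ C := by
  obtain ⟨C₀, hC₀, h0⟩ := exists_norm_integral_sub_le hk.continuous hc
  obtain ⟨C₁, hC₁, h1⟩ := exists_norm_fderiv_integral_sub_le (hk.of_le one_le_two) hc
  obtain ⟨C₂, hC₂, h2⟩ := exists_norm_fderiv_fderiv_integral_sub_le hk hc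
  refine ⟨C₀ + C₁ + C₂, by positivity, fun μ _ j hj x => ?_⟩
  have hcases : j = 0 ∨ j = 1 ∨ j = 2 := by omega
  rcases hcases with rfl | rfl | rfl
  · rw [norm_iteratedFDeriv_zero]
    linarith [h0 μ x]
  · rw [norm_iteratedFDeriv_one]
    linarith [h1 μ x]
  · rw [← norm_fderiv_fderiv_eq]
    linarith [h2 μ x]

/-- Multiplication with a cutoff function turns bounds on a ball into global ones, uniformly over
all fields satisfying the former. -/
theorem exists_c2Bound_smul {χ : Eu d → ℝ} (hχ : ContDiff ℝ 2 χ) {R : ℝ}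
    (hR : tsupport χ ⊆ Metric.closedBall 0 R) {C : ℝ} (hC0 : 0 ≤ C) :
    ∃ L : ℝ, ∀ f : Eu d → F, ContDiff ℝ 2 f →
      (∀ j ≤ 2, ∀ x, ‖x‖ ≤ R → ‖iteratedFDeriv ℝ j f x‖ ≤ C) → C2Bound L (fun x => χ x • f x) := by
  have hχc : HasCompactSupport χ :=
    (isCompact_closedBall (0 : Eu d) R).of_isClosed_subset (isClosed_tsupport χ) hR
  have hb : ∀ j : ℕ, ∃ c : ℝ, j ≤ 2 → ∀ x, ‖iteratedFDeriv ℝ j χ x‖ ≤ c := by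
    intro j
    by_cases hj : j ≤ 2
    · obtain ⟨c, hc⟩ := (hχc.iteratedFDeriv (𝕜 := ℝ) j).exists_bound_of_continuous
        (hχ.continuous_iteratedFDeriv (m := j) (by exact_mod_cast hj))
      exact ⟨c, fun _ => hc⟩
    · exact ⟨0, fun h => absurd h hj⟩
  choose c hc using hb
  set c' := max (c 0) (max (c 1) (c 2)) with hc'
  have hcc : ∀ j ≤ 2, ∀ x, ‖iteratedFDeriv ℝ j χ x‖ ≤ c' := by
    intro j hj x
    refine (hc j hj x).trans ?_
    interval_cases j
    · exact le_max_left _ _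
    · exact (le_max_left _ _).trans (le_max_right _ _)
    · exact (le_max_right _ _).trans (le_max_right _ _)
  have hc'0 : 0 ≤ c' := (norm_nonneg _).trans (hcc 0 (by norm_num) 0)
  refine ⟨4 * (c' * C), fun f hf hfC => ?_⟩
  have hsm : ContDiff ℝ 2 (fun x => χ x • f x) := hχ.smul hf
  have key : ∀ n, 1 ≤ n → n ≤ 2 → ∀ x,
      ‖iteratedFDeriv ℝ n (fun x => χ x • f x) x‖ ≤ 4 * (c' * C) := by
    intro n hn1 hn x
    have h1 := norm_iteratedFDeriv_smul_le (𝕜 := ℝ) hχ hf x (n := n) (by exact_mod_cast hn)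
    refine h1.trans ?_
    have h2 : ∀ i ∈ Finset.range (n + 1), (n.choose i : ℝ) * ‖iteratedFDeriv ℝ i χ x‖ *
        ‖iteratedFDeriv ℝ (n - i) f x‖ ≤ n.choose i * (c' * C) := by
      intro i hi
      have hi2 : i ≤ 2 := by have := Finset.mem_range.1 hi; omega
      rw [mul_assoc]
      refine mul_le_mul_of_nonneg_left ?_ (Nat.cast_nonneg _)
      by_cases hx : ‖x‖ ≤ R
      · exact mul_le_mul (hcc i hi2 x) (hfC _ (by omega) x hx) (norm_nonneg _) hc'0
      · have : iteratedFDeriv ℝ i χ x = 0 := by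
          by_contra hne
          exact hx (by simpa using hR (support_iteratedFDeriv_subset (𝕜 := ℝ) i hne))
        rw [this, norm_zero, zero_mul]
        positivity
    refine (Finset.sum_le_sum h2).trans ?_
    rw [← Finset.sum_mul, ← Nat.cast_sum, Nat.sum_range_choose]
    have : ((2 ^ n : ℕ) : ℝ) ≤ 4 := by
      have : 2 ^ n ≤ 2 ^ 2 := Nat.pow_le_pow_right (by norm_num) hn
      exact_mod_cast this
    gcongr
  refine ⟨hsm, fun x => ?_, fun x y => ?_⟩
  · rw [← norm_iteratedFDeriv_one]
    exact key 1 le_rfl one_le_two x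
  · refine convex_univ.norm_image_sub_le_of_norm_fderiv_le (𝕜 := ℝ)
      (fun x _ => ((hsm.fderiv_right (m := 1) (by norm_num)).differentiable one_ne_zero) x)
      (fun x _ => ?_) (mem_univ y) (mem_univ x)
    rw [norm_fderiv_fderiv_eq]
    exact key 2 one_le_two le_rfl x

end Truncation

/-! ### Uniqueness for the mean-field system -/

section Uniqueness

variable {d m D : ℕ} {S : Data d m D} {T : ℝ} {y0 : Leaders d m}
  {mu0 : ProbabilityMeasure (Eu d)} {u : Control D T S.U} {y : ℝ → Leaders d m}
  {μ : ℝ → ProbabilityMeasure (Eu d)}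

/-- The velocity field of the followers. -/
def Data.velocity (S : Data d m D) (y : ℝ → Leaders d m) (μ : ℝ → ProbabilityMeasure (Eu d))
    (t : ℝ) (x : Eu d) : Eu d :=
  conv S.K (μ t : Measure (Eu d)) x + S.g (y t) x

/-- Bounds for a curve `(y, μ)` on `[0, T]`: continuity of `y` and a common ball containing `y` and
the supports of `μ`. -/
structure IsBoundedCurve (T R : ℝ) (y : ℝ → Leaders d m) (μ : ℝ → ProbabilityMeasure (Eu d)) :
    Prop where
  cont : ContinuousOn y (Icc 0 T)
  norm_le : ∀ t ∈ Icc 0 T, ‖y t‖ ≤ R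
  supp : ∀ t ∈ Icc 0 T, ∀ᵐ x ∂(μ t : Measure (Eu d)), ‖x‖ ≤ R

theorem Data.IsMeanFieldSol.exists_isBoundedCurve (h : S.IsMeanFieldSol T y0 mu0 u y μ) :
    ∃ R, 0 ≤ R ∧ IsBoundedCurve T R y μ := by
  obtain ⟨R₁, h1⟩ := exists_norm_le_of_continuousOn h.y_cont
  obtain ⟨R₂, h2⟩ := h.mu_supp
  refine ⟨max 0 (max R₁ R₂), le_max_left _ _, h.y_cont, fun t ht => (h1 t ht).trans
    ((le_max_left _ _).trans (le_max_right _ _)), fun t ht => ?_⟩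
  have := Measure.support_mem_ae (μ := (μ t : Measure (Eu d)))
  filter_upwards [this] with x hx
  have hx' := mem_ball_zero_iff.1 (h2 t ht hx)
  exact hx'.le.trans ((le_max_right _ _).trans (le_max_right _ _))

variable {R : ℝ}

theorem IsBoundedCurve.exists_lipschitzOnWith (hS : S.HypH) (hb : IsBoundedCurve T R y μ) (R' : ℝ) :
    ∃ L : ℝ≥0, ∀ t ∈ Icc 0 T, LipschitzOnWith L (S.velocity y μ t) (Metric.closedBall 0 R') := by
  obtain ⟨LK, hLK⟩ := exists_lipschitzOnWith_closedBall hS.K_smooth two_ne_zero (R' + R)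
  obtain ⟨Lg, hLg⟩ := hS.g_smooth.exists_lipschitzOnWith (max R R')
  refine ⟨LK + Lg, fun t ht => LipschitzOnWith.of_dist_le_mul fun p hp q hq => ?_⟩
  rw [mem_closedBall_zero_iff] at hp hq
  have h1 := norm_conv_sub_le hS.K_smooth.continuous hLK (hb.supp t ht) hp hq
  have hyt := (hb.norm_le t ht).trans (le_max_left R R')
  have h2 := hLg.dist_le_mul (y t, p)
    (mem_closedBall_zero_iff.2 (norm_prod_le_iff.2 ⟨hyt, hp.trans (le_max_right _ _)⟩)) (y t, q)
    (mem_closedBall_zero_iff.2 (norm_prod_le_iff.2 ⟨hyt, hq.trans (le_max_right _ _)⟩))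
  have e : dist (y t, p) (y t, q) = ‖p - q‖ := by
    rw [Prod.dist_eq, dist_self, dist_eq_norm]; exact max_eq_right (norm_nonneg _)
  rw [e, dist_eq_norm] at h2
  rw [dist_eq_norm, dist_eq_norm, NNReal.coe_add, add_mul]
  have e2 : S.velocity y μ t p - S.velocity y μ t q =
      (conv S.K (μ t : Measure (Eu d)) p - conv S.K (μ t : Measure (Eu d)) q) +
        (S.g (y t) p - S.g (y t) q) := by
    simp only [Data.velocity]; abel
  rw [e2]
  exact (norm_add_le _ _).trans (add_le_add h1 h2)

theorem IsBoundedCurve.continuous_velocity (hS : S.HypH) (hb : IsBoundedCurve T R y μ) {t : ℝ}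
    (ht : t ∈ Icc 0 T) : Continuous (S.velocity y μ t) :=
  continuous_of_lipschitzOnWith_closedBall fun R' =>
    (hb.exists_lipschitzOnWith hS R').imp fun _ h => h t ht

theorem IsBoundedCurve.exists_norm_velocity_le (hS : S.HypH) (hb : IsBoundedCurve T R y μ)
    (hR0 : 0 ≤ R) (R' : ℝ) :
    ∃ B : ℝ, 0 ≤ B ∧ ∀ t ∈ Icc 0 T, ∀ x, ‖x‖ ≤ R' → ‖S.velocity y μ t x‖ ≤ B := by
  obtain ⟨CK, hCK, hK⟩ := hS.K_sublinear
  obtain ⟨C, hC0, hC⟩ := hS.g_smooth.exists_iteratedFDeriv_le (max R R')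
  refine ⟨CK * (1 + |R'| + R) + C, by positivity, fun t ht x hx => ?_⟩
  refine (norm_add_le _ _).trans (add_le_add ?_ ?_)
  · refine (norm_conv_le hCK.le (fun x => (hK x).le) (hb.supp t ht) x).trans ?_
    gcongr
    exact hx.trans (le_abs_self R')
  · have := hC 0 (by norm_num) (y t) ((hb.norm_le t ht).trans (le_max_left _ _)) x
      (hx.trans (le_max_right _ _))
    rwa [norm_iteratedFDeriv_zero] at this

theorem Data.IsMeanFieldSol.isWeakSol (h : S.IsMeanFieldSol T y0 mu0 u y μ)
    (hb : IsBoundedCurve T R y μ) :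
    IsWeakSol (S.velocity y μ) T R (fun t => (μ t : Measure (Eu d))) :=
  ⟨fun _ => inferInstance, hb.supp, fun φ hφ hφc t ht => h.mu_eq φ hφ hφc t ht⟩

/-- The velocity field is continuous in time, uniformly on balls. For the convolution this follows
from the weak equation itself, tested with the components of `K(x - ·)`. -/
theorem Data.IsMeanFieldSol.velocity_equicontinuous (hS : S.HypH)
    (h : S.IsMeanFieldSol T y0 mu0 u y μ)
    (hb : IsBoundedCurve T R y μ) (hR0 : 0 ≤ R) (R' : ℝ) {η : ℝ} (hη : 0 < η) :
    ∃ δ > 0, ∀ r ∈ Icc 0 T, ∀ s ∈ Icc 0 T, |r - s| ≤ δ → ∀ x, ‖x‖ ≤ R' →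
      ‖S.velocity y μ r x - S.velocity y μ s x‖ ≤ η := by
  obtain ⟨B, hB0, hB⟩ := hb.exists_norm_velocity_le hS hR0 R
  obtain ⟨Lg, hLg⟩ := hS.g_smooth.exists_lipschitzOnWith (max R R')
  have hK1 : ContDiff ℝ 1 S.K := hS.K_smooth.of_le one_le_two
  obtain ⟨c, hc⟩ := (isCompact_closedBall (0 : Eu d) (R' + R)).exists_bound_of_continuousOn
    (hK1.continuous_fderiv one_ne_zero).continuousOn
  set c' := max c 0
  have hc' : ∀ z, ‖z‖ ≤ R' + R → ‖fderiv ℝ S.K z‖ ≤ c' := fun z hz =>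
    (hc z (by simpa using hz)).trans (le_max_left _ _)
  have hc'0 : 0 ≤ c' := le_max_right _ _
  have hconv : ∀ r ∈ Icc 0 T, ∀ s ∈ Icc 0 T, ∀ x, ‖x‖ ≤ R' →
      ‖conv S.K (μ r : Measure (Eu d)) x - conv S.K (μ s : Measure (Eu d)) x‖ ≤
        c' * B * |r - s| := by
    intro r hr s hs x hx
    -- Testing with `⟪v, K(x - ·)⟫` for the difference `v` itself bounds `‖v‖²` by a multiple
    -- of `‖v‖`.
    set v := conv S.K (μ r : Measure (Eu d)) x - conv S.K (μ s : Measure (Eu d)) x with hv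
    have hψ : ContDiff ℝ 1 (fun x' => inner ℝ v (S.K (x - x'))) :=
      contDiff_const.inner ℝ (hK1.comp (contDiff_const.sub contDiff_id))
    have hd : ∀ x' : Eu d, ‖x'‖ ≤ R → ‖fderiv ℝ (fun x' => inner ℝ v (S.K (x - x'))) x'‖ ≤
        ‖v‖ * c' := by
      intro x' hx'
      have h1 : HasFDerivAt (fun x' => S.K (x - x'))
          ((fderiv ℝ S.K (x - x')).comp (-ContinuousLinearMap.id ℝ (Eu d))) x' :=
        ((hK1.differentiable one_ne_zero) (x - x')).hasFDerivAt.comp x'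
          ((hasFDerivAt_id x').const_sub x)
      have h2 : HasFDerivAt (fun x' => inner ℝ v (S.K (x - x'))) ((innerSL ℝ v).comp
          ((fderiv ℝ S.K (x - x')).comp (-ContinuousLinearMap.id ℝ (Eu d)))) x' :=
        (innerSL ℝ v).hasFDerivAt.comp x' h1
      rw [h2.fderiv]
      refine (ContinuousLinearMap.opNorm_comp_le _ _).trans ?_
      rw [innerSL_apply_norm]
      gcongr
      refine (ContinuousLinearMap.opNorm_comp_le _ _).trans ?_
      rw [norm_neg]
      have h3 := hc' (x - x') ((norm_sub_le _ _).trans (add_le_add hx hx'))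
      calc _ ≤ c' * 1 := by
            gcongr
            exact ContinuousLinearMap.norm_id_le
        _ = c' := mul_one _
    have key := (h.isWeakSol hb).abs_integral_sub_le hB hψ (by positivity) hd hs hr
    have e : ∀ t ∈ Icc 0 T, ∫ x', inner ℝ v (S.K (x - x')) ∂(μ t : Measure (Eu d)) =
        inner ℝ v (conv S.K (μ t : Measure (Eu d)) x) := fun t ht =>
      integral_inner (integrable_conv hS.K_smooth.continuous (hb.supp t ht) x) v
    rw [e r hr, e s hs, ← inner_sub_right, ← hv, real_inner_self_eq_norm_sq, abs_of_nonneg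
      (sq_nonneg _)] at key
    by_cases hv0 : ‖v‖ = 0
    · rw [hv0]; positivity
    · have hvp : 0 < ‖v‖ := lt_of_le_of_ne (norm_nonneg _) (Ne.symm hv0)
      have : ‖v‖ * ‖v‖ ≤ ‖v‖ * (c' * B * |r - s|) := by nlinarith
      exact le_of_mul_le_mul_left this hvp
  have hu := isCompact_Icc.uniformContinuousOn_of_continuous hb.cont
  obtain ⟨δ₁, hδ₁, h1⟩ := Metric.uniformContinuousOn_iff_le.1 hu (η / (2 * (Lg + 1))) (by positivity)
  refine ⟨min δ₁ (η / (2 * (c' * B + 1))), lt_min hδ₁ (by positivity), fun r hr s hs hrs x hx => ?_⟩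
  have hyr := (hb.norm_le r hr).trans (le_max_left R R')
  have hys := (hb.norm_le s hs).trans (le_max_left R R')
  have hx' := hx.trans (le_max_right R R')
  have h2 := hLg.dist_le_mul (y r, x) (mem_closedBall_zero_iff.2 (norm_prod_le_iff.2 ⟨hyr, hx'⟩))
    (y s, x) (mem_closedBall_zero_iff.2 (norm_prod_le_iff.2 ⟨hys, hx'⟩))
  have e : dist (y r, x) (y s, x) = dist (y r) (y s) := by
    rw [Prod.dist_eq, dist_self]; exact max_eq_left dist_nonneg
  rw [e, dist_eq_norm] at h2
  have h3 := h1 r hr s hs (by rw [Real.dist_eq]; exact hrs.trans (min_le_left _ _))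
  have h4 : (Lg : ℝ) * dist (y r) (y s) ≤ η / 2 := by
    have e1 : (Lg : ℝ) * dist (y r) (y s) ≤ (Lg + 1) * (η / (2 * (Lg + 1))) := by
      gcongr; linarith
    have e2 : ((Lg : ℝ) + 1) * (η / (2 * (Lg + 1))) = η / 2 := by field_simp
    linarith
  have h5 : c' * B * |r - s| ≤ η / 2 := by
    have e0 := hrs.trans (min_le_right _ _)
    have e1 : c' * B * |r - s| ≤ (c' * B + 1) * (η / (2 * (c' * B + 1))) := by
      gcongr; linarith
    have e2 : (c' * B + 1) * (η / (2 * (c' * B + 1))) = η / 2 := by field_simp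
    linarith
  have h6 := hconv r hr s hs x hx
  have e3 : S.velocity y μ r x - S.velocity y μ s x =
      (conv S.K (μ r : Measure (Eu d)) x - conv S.K (μ s : Measure (Eu d)) x) +
        (S.g (y r) x - S.g (y s) x) := by
    simp only [Data.velocity]; abel
  rw [e3]
  exact (norm_add_le _ _).trans (by linarith)

theorem IsBoundedCurve.exists_inner_velocity_le (hS : S.HypH) (hb : IsBoundedCurve T R y μ)
    (hR0 : 0 ≤ R) : ∃ C : ℝ, 0 ≤ C ∧ ∀ t ∈ Icc 0 T, ∀ x N, ‖x‖ ≤ N →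
      inner ℝ (S.velocity y μ t x) x ≤ C * (1 + N ^ 2) := by
  obtain ⟨CK, hCK, hK⟩ := hS.K_sublinear
  obtain ⟨G₁, G₂, G₃, hG⟩ := hS.g_growth
  refine ⟨CK * (2 + R) + |G₁| + |G₂| * R ^ 2 + |G₃|, by positivity, fun t ht x N hx => ?_⟩
  have hx0 := norm_nonneg x
  have hN0 := hx0.trans hx
  have hxN : ‖x‖ ^ 2 ≤ N ^ 2 := by gcongr
  have h1 := norm_conv_le hCK.le (fun x => (hK x).le) (hb.supp t ht) x
  have h2 : inner ℝ (conv S.K (μ t : Measure (Eu d)) x) x ≤ CK * (1 + ‖x‖ + R) * ‖x‖ :=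
    (real_inner_le_norm _ _).trans (by gcongr)
  have h3 := hG (y t) x
  have h4 : G₁ * ‖x‖ ^ 2 ≤ |G₁| * N ^ 2 :=
    mul_le_mul (le_abs_self _) hxN (sq_nonneg _) (abs_nonneg _)
  have hyR : ‖y t‖ ^ 2 ≤ R ^ 2 := by gcongr; exact hb.norm_le t ht
  have h5 : G₂ * ‖y t‖ ^ 2 ≤ |G₂| * R ^ 2 :=
    mul_le_mul (le_abs_self _) hyR (sq_nonneg _) (abs_nonneg _)
  have h6 := le_abs_self G₃
  have h7 : (1 + ‖x‖ + R) * ‖x‖ ≤ (2 + R) * (1 + N ^ 2) := by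
    have e1 : ‖x‖ ≤ 1 + N ^ 2 := by nlinarith [sq_nonneg (‖x‖ - 1)]
    have e2 : ‖x‖ ^ 2 ≤ 1 + N ^ 2 := by linarith
    have e3 := mul_le_mul_of_nonneg_left e1 hR0
    nlinarith
  have h8 : CK * (1 + ‖x‖ + R) * ‖x‖ ≤ CK * (2 + R) * (1 + N ^ 2) := by
    rw [mul_assoc, mul_assoc]
    exact mul_le_mul_of_nonneg_left h7 hCK.le
  have hN2 : 0 ≤ N ^ 2 := sq_nonneg N
  have h9 : 0 ≤ |G₂| * R ^ 2 * N ^ 2 := by positivity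
  have h10 : 0 ≤ |G₃| * N ^ 2 := by positivity
  have h11 := abs_nonneg G₁
  rw [Data.velocity, inner_add_left]
  nlinarith

/-- After multiplication with a cutoff function, the velocity field obeys `C²` bounds that are
uniform in time. -/
theorem IsBoundedCurve.exists_c2Bound (hS : S.HypH) (hb : IsBoundedCurve T R y μ)
    {χ : Eu d → ℝ} (hχ : ContDiff ℝ 2 χ) {R' : ℝ} (hχR : tsupport χ ⊆ Metric.closedBall 0 R') :
    ∃ L, ∀ t ∈ Icc 0 T, C2Bound L (fun x => χ x • S.velocity y μ t x) := by
  let ρ : ContDiffBump (0 : Eu d) :=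
    ⟨|R'| + |R| + 1, |R'| + |R| + 2, by positivity, by linarith⟩
  have hKρ : ContDiff ℝ 2 (fun x => ρ x • S.K x) := ρ.contDiff.smul hS.K_smooth
  have hKρc : HasCompactSupport (fun x => ρ x • S.K x) := ρ.hasCompactSupport.smul_right
  obtain ⟨C₁, hC₁0, hC₁⟩ := exists_norm_iteratedFDeriv_integral_sub_le hKρ hKρc
  obtain ⟨C₂, hC₂0, hC₂⟩ := hS.g_smooth.exists_iteratedFDeriv_le (max R R')
  obtain ⟨L, hL⟩ := exists_c2Bound_smul (F := Eu d) hχ hχR (add_nonneg hC₁0 hC₂0)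
  refine ⟨L, fun t ht => ?_⟩
  -- On the support of `χ`, the kernel `K` may be replaced by a compactly supported one.
  have e : (fun x => χ x • S.velocity y μ t x) = fun x =>
      χ x • ((∫ x', ρ (x - x') • S.K (x - x') ∂(μ t : Measure (Eu d))) + S.g (y t) x) := by
    funext x
    by_cases hx : ‖x‖ ≤ R'
    · have hi : ∫ x', S.K (x - x') ∂(μ t : Measure (Eu d)) =
          ∫ x', ρ (x - x') • S.K (x - x') ∂(μ t : Measure (Eu d)) := by
        refine integral_congr_ae ?_
        filter_upwards [hb.supp t ht] with x' hx'
        rw [ρ.one_of_mem_closedBall, one_smul]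
        rw [mem_closedBall_zero_iff]
        refine (norm_sub_le _ _).trans ?_
        have := le_abs_self R
        have := le_abs_self R'
        change _ ≤ |R'| + |R| + 1
        linarith
      rw [← hi]
      rfl
    · have : χ x = 0 := by
        by_contra hne
        exact hx (by simpa using hχR (subset_tsupport _ hne))
      rw [this, zero_smul, zero_smul]
  rw [e]
  have h1 := contDiff_two_integral_sub hKρ hKρc (μ t : Measure (Eu d))
  have h2 := hS.g_smooth.1 (y t)
  refine hL (fun x => (∫ x', ρ (x - x') • S.K (x - x') ∂(μ t : Measure (Eu d))) + S.g (y t) x)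
    (h1.add h2) fun j hj x hx => ?_
  have hj' : (j : WithTop ℕ∞) ≤ 2 := by exact_mod_cast hj
  have := iteratedFDeriv_add_apply (𝕜 := ℝ) (E := Eu d) (F := Eu d) (i := j) (x := x)
    (f := fun x => ∫ x', ρ (x - x') • S.K (x - x') ∂(μ t : Measure (Eu d))) (g := S.g (y t))
    ((h1.of_le hj').contDiffAt) ((h2.of_le hj').contDiffAt)
  refine (le_of_eq (congrArg norm this)).trans ((norm_add_le _ _).trans
    (add_le_add (hC₁ (μ t : Measure (Eu d)) j hj x) ?_))
  exact hC₂ j hj _ ((hb.norm_le t ht).trans (le_max_left _ _)) x (hx.trans (le_max_right _ _))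

variable {Ω : Type*} [TopologicalSpace Ω] [CompactSpace Ω] [MeasurableSpace Ω] [BorelSpace Ω]

open Classical in
/-- The field `X ↦ b ∘ X` on `C(Ω, Eu d)` (only meaningful for continuous `b`). -/
def compField (b : Eu d → Eu d) (X : C(Ω, Eu d)) : C(Ω, Eu d) :=
  if h : Continuous b then ⟨fun θ => b (X θ), h.comp X.continuous⟩ else 0

theorem compField_apply {b : Eu d → Eu d} (hb : Continuous b) (X : C(Ω, Eu d)) (θ : Ω) :
    compField b X θ = b (X θ) := by
  rw [compField, dif_pos hb]; rfl

theorem Data.IsMeanFieldSol.exists_isTame_compField (hS : S.HypH)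
    (h : S.IsMeanFieldSol T y0 mu0 u y μ) (hb : IsBoundedCurve T R y μ) (hR0 : 0 ≤ R) :
    ∃ C, IsTame (fun t => compField (Ω := Ω) (S.velocity y μ t)) T C := by
  obtain ⟨C, hC0, hC⟩ := hb.exists_inner_velocity_le hS hR0
  refine ⟨C, fun X s hs => ?_, fun R' => ?_, hC0, fun t ht X => ?_⟩
  · refine Metric.tendsto_nhds.2 fun η hη => ?_
    obtain ⟨δ, hδ, hδη⟩ := h.velocity_equicontinuous hS hb hR0 ‖X‖ (half_pos hη)
    filter_upwards [self_mem_nhdsWithin, mem_nhdsWithin_of_mem_nhds (Metric.ball_mem_nhds s hδ)]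
      with r hr hrs
    rw [Metric.mem_ball, Real.dist_eq] at hrs
    refine lt_of_le_of_lt ((ContinuousMap.dist_le (half_pos hη).le).2 fun θ => ?_) (half_lt_self hη)
    rw [compField_apply (hb.continuous_velocity hS hr), compField_apply
      (hb.continuous_velocity hS hs), dist_eq_norm]
    exact hδη r hr s hs hrs.le _ (X.norm_coe_le_norm θ)
  · obtain ⟨L, hL⟩ := hb.exists_lipschitzOnWith hS R'
    refine ⟨L, fun t ht => LipschitzOnWith.of_dist_le_mul fun X hX Y hY => ?_⟩
    rw [mem_closedBall_zero_iff] at hX hY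
    refine (ContinuousMap.dist_le (by positivity)).2 fun θ => ?_
    rw [compField_apply (hb.continuous_velocity hS ht), compField_apply
      (hb.continuous_velocity hS ht)]
    refine ((hL t ht).dist_le_mul _ (by simpa using (X.norm_coe_le_norm θ).trans hX) _
      (by simpa using (Y.norm_coe_le_norm θ).trans hY)).trans ?_
    gcongr
    exact ContinuousMap.dist_apply_le_dist θ
  · refine OutwardBound.continuousMap hC0 fun θ => ?_
    rw [compField_apply (hb.continuous_velocity hS ht)]
    exact hC t ht _ _ (X.norm_coe_le_norm θ)

/-- Any solution of the mean-field system is transported by its characteristics: followers starting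
at the points of `ξ` and moving with the velocity field have the distribution `μ`. Both `μ` and the
image measure solve the same linear continuity equation, which has only one solution. -/
theorem Data.IsMeanFieldSol.exists_isSol [T2Space Ω] (hS : S.HypH) (hT : 0 ≤ T)
    {P : Measure Ω} [IsProbabilityMeasure P] {ξ : C(Ω, Eu d)} (hξ : P.map ξ = mu0)
    (h : S.IsMeanFieldSol T y0 mu0 u y μ) :
    ∃ X : ℝ → C(Ω, Eu d), IsSol (fun _ => meanField hS P) (S.forcing u) (y0, ξ) T
      (fun t => (y t, X t)) ∧ ∀ t ∈ Icc 0 T, (μ t : Measure (Eu d)) = P.map (X t) := by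
  obtain ⟨R, hR0, hb⟩ := h.exists_isBoundedCurve
  obtain ⟨C, hC⟩ := h.exists_isTame_compField (Ω := Ω) hS hb hR0
  obtain ⟨X, hX⟩ := MeanFieldControl.exists_isSol (β := fun _ => 0) ξ hT hC le_rfl rfl (by simp)
  have hVc := hC.continuousOn_comp hX.cont
  have hX0 : X 0 = ξ := by
    have := hX.eq 0 ⟨le_rfl, hT⟩
    simpa using this
  have hXd : ∀ t ∈ Icc 0 T, HasDerivWithinAt X (compField (S.velocity y μ t) (X t))
      (Icc 0 T) t := fun t ht =>
    ((hasDerivWithinAt_integral_Icc hVc ht).const_add ξ).congr_of_mem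
      (fun s hs => by rw [hX.eq s hs, add_zero]) ht
  obtain ⟨RX, hRX⟩ := exists_norm_le_of_continuousOn hX.cont
  set R' := max R RX with hR'
  have hR'0 : 0 ≤ R' := hR0.trans (le_max_left _ _)
  -- The velocity field is cut off outside a ball which neither solution leaves.
  let χ : ContDiffBump (0 : Eu d) := ⟨R' + 1, R' + 2, by positivity, by linarith⟩
  have hχ1 : ∀ x : Eu d, ‖x‖ ≤ R' → χ x = 1 := fun x hx => χ.one_of_mem_closedBall (by
    rw [mem_closedBall_zero_iff]; change _ ≤ R' + 1; linarith)
  obtain ⟨L, hL⟩ := hb.exists_c2Bound hS (χ.contDiff (n := 2)) χ.tsupport_eq.subset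
  obtain ⟨B, hB0, hB⟩ := hb.exists_norm_velocity_le hS hR0 R'
  set b : ℝ → Eu d → Eu d := fun t x => χ x • S.velocity y μ t x with hbdef
  have hbv : ∀ t x, ‖x‖ ≤ R' → b t x = S.velocity y μ t x := fun t x hx => by
    rw [hbdef]; simp only [hχ1 x hx, one_smul]
  have hμ : IsWeakSol b T R' (fun t => (μ t : Measure (Eu d))) := by
    refine ⟨fun _ => inferInstance, fun t ht => (hb.supp t ht).mono fun x hx =>
      hx.trans (le_max_left _ _), fun φ hφ hφc t ht => ?_⟩
    have e : ∫ x, fderiv ℝ φ x (b t x) ∂(μ t : Measure (Eu d)) =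
        ∫ x, fderiv ℝ φ x (S.velocity y μ t x) ∂(μ t : Measure (Eu d)) := by
      refine integral_congr_ae ((hb.supp t ht).mono fun x hx => ?_)
      simp only [hbv t x (hx.trans (le_max_left _ _))]
    rw [e]
    exact h.mu_eq φ hφ hφc t ht
  have hν : IsWeakSol b T R' (fun t => P.map (X t)) := by
    refine ⟨fun _ => inferInstance, fun t ht => (ae_map_norm_le (X t)).mono fun x hx =>
      hx.trans ((hRX t ht).trans (le_max_right _ _)), fun φ hφ hφc t ht => ?_⟩
    have h1 := hasDerivWithinAt_integral_map (P := P) hXd hVc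
      (hφ.of_le (by exact_mod_cast le_top)) ht
    convert! h1 using 1
    rw [integral_map_continuousMap (X t)
      ((hφ.continuous_fderiv (by simp)).clm_apply (hL t ht).contDiff.continuous)]
    refine integral_congr_ae (Eventually.of_forall fun θ => ?_)
    change fderiv ℝ φ (X t θ) (b t (X t θ)) =
      fderiv ℝ φ (X t θ) (compField (S.velocity y μ t) (X t) θ)
    rw [compField_apply (hb.continuous_velocity hS ht), hbv t _
      (((X t).norm_coe_le_norm θ).trans ((hRX t ht).trans (le_max_right _ _)))]
  have heq : ∀ t ∈ Icc 0 T, (μ t : Measure (Eu d)) = P.map (X t) := fun t ht =>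
    hμ.unique hν (L := L) (B := B) (by simp only [h.init_mu, hX0, hξ]) hB0 hL
      (fun t ht x hx => by rw [hbv t x hx]; exact hB t ht x hx)
      (fun η hη => by
        obtain ⟨δ, hδ, hδη⟩ := h.velocity_equicontinuous hS hb hR0 R' hη
        exact ⟨δ, hδ, fun r hr s hs hrs x hx => by
          rw [hbv r x hx, hbv s x hx]; exact hδη r hr s hs hrs x hx⟩) ht
  refine ⟨X, isSol_of_components hS (h.y_cont.prodMk hX.cont) (fun t ht k => ?_) fun t ht θ => ?_,
    heq⟩
  · refine (h.y_eq t ht k).trans ?_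
    congr 1
    refine intervalIntegral.integral_congr fun s hs => ?_
    rw [uIcc_of_le ht.1] at hs
    simp only [heq s ⟨hs.1, hs.2.trans ht.2⟩]
  · have hi : IntervalIntegrable (fun s => compField (S.velocity y μ s) (X s)) volume 0 t :=
      (hVc.mono (Icc_subset_Icc_right ht.2)).intervalIntegrable_of_Icc ht.1
    have h1 := congrArg (ContinuousMap.evalCLM ℝ θ : C(Ω, Eu d) →L[ℝ] Eu d) (hX.eq t ht)
    rw [add_zero, map_add, ← ContinuousLinearMap.intervalIntegral_comp_comm _ hi] at h1
    refine h1.trans ?_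
    congr 1
    refine intervalIntegral.integral_congr fun s hs => ?_
    rw [uIcc_of_le ht.1] at hs
    have hs' : s ∈ Icc 0 T := ⟨hs.1, hs.2.trans ht.2⟩
    simp only [← heq s hs']
    exact compField_apply (hb.continuous_velocity hS hs') (X s) θ

/-- Uniqueness of the mean-field solution: both solutions are flows solving the same Lagrangian
equation. -/
theorem Data.IsMeanFieldSol.unique [T2Space Ω] (hS : S.HypH) (hT : 0 ≤ T)
    {P : Measure Ω} [IsProbabilityMeasure P] {ξ : C(Ω, Eu d)} (hξ : P.map ξ = mu0)
    (h : S.IsMeanFieldSol T y0 mu0 u y μ) {y' : ℝ → Leaders d m}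
    {μ' : ℝ → ProbabilityMeasure (Eu d)} (h' : S.IsMeanFieldSol T y0 mu0 u y' μ') :
    ∀ t ∈ Icc 0 T, y t = y' t ∧ μ t = μ' t := by
  obtain ⟨X, hX, hμ⟩ := h.exists_isSol hS hT hξ
  obtain ⟨X', hX', hμ'⟩ := h'.exists_isSol hS hT hξ
  obtain ⟨C, hC⟩ := exists_isTame_meanField Ω hS T
  intro t ht
  have := hX.eq_of_isTame (hC P) hX' t ht
  rw [Prod.mk.injEq] at this
  exact ⟨this.1, Subtype.ext ((hμ t ht).trans
    ((congrArg (fun X : C(Ω, Eu d) => P.map X) this.2).trans (hμ' t ht).symm))⟩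

end Uniqueness

/-! ### Convergence of the label distributions -/

section Labels

variable {d m D : ℕ} {Ω : Type*} [TopologicalSpace Ω] [CompactSpace Ω] [MeasurableSpace Ω]
  [BorelSpace Ω] {P : Measure Ω} [IsProbabilityMeasure P] {S : Data d m D} {T : ℝ}
  {I : Type*} {l : Filter I} {Q : I → Measure Ω} [∀ i, IsProbabilityMeasure (Q i)]

theorem tendsto_integralC (h : ∀ f : C(Ω, ℝ), Tendsto (fun i => integralC (Q i) f) l
    (𝓝 (integralC P f))) (f : C(Ω, Eu d)) :
    Tendsto (fun i => integralC (Q i) f) l (𝓝 (integralC P f)) := by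
  have hcoord : ∀ (P : Measure Ω) [IsProbabilityMeasure P] (j : Fin d),
      (integralC P f) j = integralC P
        ((⟨EuclideanSpace.proj j, (EuclideanSpace.proj j).continuous⟩ : C(Eu d, ℝ)).comp f) :=
    fun P _ j => ((EuclideanSpace.proj j : Eu d →L[ℝ] ℝ).integral_comp_comm
      (f.continuous.integrable_of_hasCompactSupport (HasCompactSupport.of_compactSpace f))).symm
  refine ((EuclideanSpace.equiv (Fin d) ℝ).toHomeomorph.isInducing.tendsto_nhds_iff).2
    (tendsto_pi_nhds.2 fun j => ?_)
  have := h ((⟨EuclideanSpace.proj j, (EuclideanSpace.proj j).continuous⟩ : C(Eu d, ℝ)).comp f)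
  rw [← hcoord P j] at this
  refine this.congr fun i => (hcoord (Q i) j).symm

theorem tendsto_integralC_of_tendsto {F : Type*} [NormedAddCommGroup F] [NormedSpace ℝ F]
    {f : C(Ω, F)} (h : Tendsto (fun i => integralC (Q i) f) l (𝓝 (integralC P f)))
    {g : I → C(Ω, F)} (hg : Tendsto g l (𝓝 f)) :
    Tendsto (fun i => integralC (Q i) (g i)) l (𝓝 (integralC P f)) := by
  have h1 : Tendsto (fun i => integralC (Q i) (g i - f)) l (𝓝 0) := by
    refine squeeze_zero_norm (fun i => norm_integralC_apply_le _) ?_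
    simpa using (hg.sub_const f).norm
  simpa [map_sub] using h1.add h

theorem tendsto_meanField {Q : ℕ → Measure Ω} [∀ n, IsProbabilityMeasure (Q n)] (hS : S.HypH)
    (h : ∀ f : C(Ω, ℝ), Tendsto (fun n => integralC (Q n) f) atTop (𝓝 (integralC P f)))
    (z : Leaders d m × C(Ω, Eu d)) :
    Tendsto (fun n => meanField hS (Q n) z) atTop (𝓝 (meanField hS P z)) := by
  have hp : ∀ p : Eu d, Tendsto (fun n => conv S.K ((Q n).map z.2) p) atTop
      (𝓝 (conv S.K (P.map z.2) p)) := fun p => by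
    simp_rw [conv_map hS.K_smooth.continuous]
    exact tendsto_integralC h _
  obtain ⟨L, hL⟩ := exists_lipschitzOnWith_closedBall hS.K_smooth two_ne_zero (‖z.2‖ + ‖z.2‖)
  -- The convolutions are uniformly Lipschitz on the compact range of the flow.
  have hlip : ∀ (P : Measure Ω) [IsProbabilityMeasure P],
      LipschitzOnWith L (conv S.K (P.map z.2)) (range z.2) := fun P _ => by
    refine LipschitzOnWith.of_dist_le_mul ?_
    rintro _ ⟨p, rfl⟩ _ ⟨q, rfl⟩
    have := norm_conv_map_sub_le (P := P) hS.K_smooth.continuous hL (X := z.2) (Y := z.2)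
      le_rfl le_rfl (z.2.norm_coe_le_norm p) (z.2.norm_coe_le_norm q)
    rwa [sub_self, norm_zero, add_zero, ← dist_eq_norm, ← dist_eq_norm] at this
  have hu := tendstoUniformlyOn_of_lipschitz (isCompact_range z.2.continuous)
    (fun n => hlip (Q n)) (hlip P) (fun p _ => hp p)
  refine Prod.tendsto_iff _ _ |>.2 ⟨tendsto_pi_nhds.2 fun k => (hp (z.1 k)).add_const _, ?_⟩
  rw [ContinuousMap.tendsto_iff_tendstoUniformly, Metric.tendstoUniformly_iff]
  intro ε hε
  filter_upwards [Metric.tendstoUniformlyOn_iff.1 hu ε hε] with n hn θ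
  have := hn (z.2 θ) (mem_range_self θ)
  change dist (_ + S.g z.1 (z.2 θ)) (_ + S.g z.1 (z.2 θ)) < ε
  rwa [dist_add_right]

end Labels

/-! ### Stability of the solutions -/

section Stability

variable {d m D : ℕ} {Ω : Type*} [TopologicalSpace Ω] [CompactSpace Ω] [MeasurableSpace Ω]
  [BorelSpace Ω] {P : Measure Ω} [IsProbabilityMeasure P] {S : Data d m D} {T : ℝ}

/-- Weak convergence of the controls makes the displacements of the leaders converge. -/
theorem tendsto_forcing {u : Control D T S.U} {v : ℕ → Control D T S.U}
    (hv : Tendsto v atTop (𝓝 u)) {t : ℝ} (ht : t ∈ Icc 0 T) :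
    Tendsto (fun n => S.forcing (Ω := Ω) (v n) t) atTop (𝓝 (S.forcing u t)) := by
  refine Prod.tendsto_iff _ _ |>.2 ⟨tendsto_pi_nhds.2 fun k => ?_, tendsto_const_nhds⟩
  refine ((EuclideanSpace.equiv (Fin d) ℝ).toHomeomorph.isInducing.tendsto_nhds_iff).2
    (tendsto_pi_nhds.2 fun j => ?_)
  have h0 : (0 : ℝ) ∈ Icc 0 T := ⟨le_rfl, ht.1.trans ht.2⟩
  let Λ : Lp (Eu D) 1 (timeMeasure T) →L[ℝ] Eu D :=
    ⟨{ toFun := fun f => ∫ s in Ioc 0 t, f s ∂(timeMeasure T)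
       map_add' := fun f g => by
        rw [← integral_add (L1.integrable_coeFn f).integrableOn
          (L1.integrable_coeFn g).integrableOn]
        exact integral_congr_ae (ae_restrict_of_ae (Lp.coeFn_add f g))
       map_smul' := fun c f => by
        rw [RingHom.id_apply, ← integral_smul]
        exact integral_congr_ae (ae_restrict_of_ae (Lp.coeFn_smul c f)) },
      continuous_setIntegral _⟩
  let Λ' : Lp (Eu D) 1 (timeMeasure T) →L[ℝ] ℝ := (EuclideanSpace.proj j ∘L S.B k) ∘L Λ
  have hΛ : ∀ w : Control D T S.U, (S.forcing (Ω := Ω) w t).1 k j = Λ' w.1 := fun w => by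
    have h1 : ∫ s in (0 : ℝ)..t, w.1 s = Λ w.1 := by
      change _ = ∫ s in Ioc 0 t, w.1 s ∂((volume : Measure ℝ).restrict (Icc 0 T))
      rw [Measure.restrict_restrict measurableSet_Ioc, intervalIntegral.integral_of_le ht.1,
        inter_eq_left.2 (Ioc_subset_Icc_self.trans (Icc_subset_Icc_right ht.2))]
    have h2 : ∫ s in (0 : ℝ)..t, S.B k (w.1 s) = S.B k (∫ s in (0 : ℝ)..t, w.1 s) :=
      (S.B k).intervalIntegral_comp_comm
        ((w.integrableOn.mono_set (ordConnected_Icc.uIcc_subset h0 ht)).intervalIntegrable)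
    change (∫ s in (0 : ℝ)..t, S.B k (w.1 s)) j = S.B k (Λ w.1) j
    rw [h2, h1]
  have h1 : Tendsto (fun n => Λ' (v n).1) atTop (𝓝 (Λ' u.1)) := by
    have h2 : Tendsto (fun n => toWeakSpace ℝ _ (v n).1) atTop (𝓝 (toWeakSpace ℝ _ u.1)) :=
      (continuous_induced_dom.tendsto u).comp hv
    exact ((WeakBilin.eval_continuous _ Λ').tendsto _).comp h2
  rw [← hΛ u] at h1
  exact h1.congr fun n => (hΛ (v n)).symm

theorem tendstoUniformlyOn_forcing (hS : S.HypH) {u : Control D T S.U}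
    {v : ℕ → Control D T S.U} (hv : Tendsto v atTop (𝓝 u)) :
    TendstoUniformlyOn (fun n => S.forcing (Ω := Ω) (v n)) (S.forcing u) atTop (Icc 0 T) := by
  obtain ⟨M, hM0, hM⟩ := hS.exists_forcing_lipschitz Ω T
  have hlip : ∀ w : Control D T S.U,
      LipschitzOnWith M.toNNReal (S.forcing (Ω := Ω) w) (Icc 0 T) := fun w =>
    LipschitzOnWith.of_dist_le_mul fun t ht s hs => by
      rw [dist_eq_norm, Real.dist_eq, Real.coe_toNNReal _ hM0]
      exact hM w s hs t ht
  exact tendstoUniformlyOn_of_lipschitz isCompact_Icc (fun n => hlip (v n)) (hlip u)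
    (fun t ht => tendsto_forcing hv ht)

/-- A bound for all solutions with given initial datum, uniform in the control and in the label
distribution. -/
theorem exists_isSol_norm_le (hS : S.HypH) (T : ℝ) (z0 : Leaders d m × C(Ω, Eu d)) :
    ∃ R : ℝ, ∀ (P : Measure Ω) [IsProbabilityMeasure P] (u : Control D T S.U)
      (z : ℝ → Leaders d m × C(Ω, Eu d)),
      IsSol (fun _ => meanField hS P) (S.forcing u) z0 T z → ∀ t ∈ Icc 0 T, ‖z t‖ ≤ R := by
  obtain ⟨C, hC⟩ := exists_isTame_meanField Ω hS T
  obtain ⟨M, hM0, hM⟩ := hS.exists_forcing_lipschitz Ω T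
  exact ⟨_, fun P _ u z hz => hz.norm_le (hC P) hM0 (Data.forcing_zero u) (hM u)⟩

theorem tendstoUniformlyOn_isSol (hS : S.HypH) {Q : ℕ → Measure Ω}
    [∀ n, IsProbabilityMeasure (Q n)]
    (h : ∀ f : C(Ω, ℝ), Tendsto (fun n => integralC (Q n) f) atTop (𝓝 (integralC P f)))
    {u : Control D T S.U} {v : ℕ → Control D T S.U} (hv : Tendsto v atTop (𝓝 u))
    {z0 : Leaders d m × C(Ω, Eu d)} {z : ℝ → Leaders d m × C(Ω, Eu d)}
    {w : ℕ → ℝ → Leaders d m × C(Ω, Eu d)}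
    (hz : IsSol (fun _ => meanField hS P) (S.forcing u) z0 T z)
    (hw : ∀ n, IsSol (fun _ => meanField hS (Q n)) (S.forcing (v n)) z0 T (w n)) :
    TendstoUniformlyOn w z atTop (Icc 0 T) := by
  obtain ⟨R, hR⟩ := exists_isSol_norm_le hS T z0
  obtain ⟨C, hC⟩ := exists_isTame_meanField Ω hS T
  obtain ⟨L, hL⟩ := exists_lipschitzOnWith_meanField (Ω := Ω) hS R
  have hcomp : IsCompact (z '' Icc 0 T) := isCompact_Icc.image_of_continuousOn hz.cont
  have hsub : z '' Icc 0 T ⊆ Metric.closedBall 0 R := by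
    rintro _ ⟨t, ht, rfl⟩
    simpa using hR P u z hz t ht
  have hA := tendstoUniformlyOn_of_lipschitz hcomp (fun n => (hL (Q n)).mono hsub)
    ((hL P).mono hsub) (fun p _ => tendsto_meanField hS h p)
  have hβ := tendstoUniformlyOn_forcing (Ω := Ω) hS hv
  rw [Metric.tendstoUniformlyOn_iff]
  intro ε hε
  -- The Grönwall bound is small once the perturbations of field and forcing are below `δ`.
  have hlim : Tendsto (fun δ : ℝ => gronwallBound 0 L (L * δ + δ) T + δ) (𝓝 0) (𝓝 0) := by
    have : Continuous (fun δ : ℝ => gronwallBound 0 L (L * δ + δ) T + δ) :=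
      ((gronwallBound_continuous_ε 0 L T).comp (by fun_prop)).add continuous_id
    have h0 := this.tendsto 0
    simpa [gronwallBound_ε0_δ0] using h0
  obtain ⟨δ, hδ, hδ0⟩ := (((hlim.eventually (gt_mem_nhds hε)).filter_mono
    nhdsWithin_le_nhds).and (self_mem_nhdsWithin (s := Ioi (0 : ℝ)))).exists
  have hδ0 : 0 < δ := hδ0
  filter_upwards [Metric.tendstoUniformlyOn_iff.1 hA δ hδ0,
    Metric.tendstoUniformlyOn_iff.1 hβ δ hδ0] with n hn1 hn2 t ht
  have h1 := (hw n).norm_sub_le hz ((hC (Q n)).continuousOn_comp (hw n).cont)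
    ((hC P).continuousOn_comp hz.cont) (hR (Q n) (v n) (w n) (hw n)) (hR P u z hz)
    (fun _ _ => hL (Q n)) (ε := δ) (ε' := δ)
    (fun s hs => by
      have := hn1 (z s) (mem_image_of_mem z hs)
      rw [dist_comm, dist_eq_norm] at this
      exact this.le)
    (fun s hs => by
      have := hn2 s hs
      rw [dist_comm, dist_eq_norm] at this
      exact this.le) t ht
  rw [dist_comm, dist_eq_norm]
  refine h1.trans_lt (lt_of_le_of_lt ?_ hδ)
  have := gronwallBound_le_of_mem_Icc (δ := 0) (K := (L : ℝ)) (ε := L * δ + δ) le_rfl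
    (by positivity) L.2 ht
  linarith

end Stability

/-! ### The state cost -/

section StateCost

variable {d m D : ℕ} {Ω : Type*} [TopologicalSpace Ω] [CompactSpace Ω] [MeasurableSpace Ω]
  [BorelSpace Ω] {P : Measure Ω} [IsProbabilityMeasure P] {S : Data d m D} {T : ℝ}

/-- The cost density `θ ↦ ℓ(y, X(θ), c)` along the followers. -/
def ellAt (hS : S.HypH) (p : (Leaders d m × C(Ω, Eu d)) × Eu d) : C(Ω, ℝ) :=
  ⟨fun θ => S.ell (p.1.1, p.1.2 θ, p.2), hS.ell_smooth.continuous.comp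
    (continuous_const.prodMk (p.1.2.continuous.prodMk continuous_const))⟩

theorem continuous_ellAt [T2Space Ω] (hS : S.HypH) : Continuous (ellAt (Ω := Ω) hS) := by
  refine ContinuousMap.continuous_of_continuous_uncurry _ (hS.ell_smooth.continuous.comp ?_)
  have h1 : Continuous fun q : ((Leaders d m × C(Ω, Eu d)) × Eu d) × Ω => q.1.1.2 q.2 :=
    continuous_eval.comp ((continuous_snd.comp (continuous_fst.comp continuous_fst)).prodMk
      continuous_snd)
  exact (continuous_fst.comp (continuous_fst.comp continuous_fst)).prodMk
    (h1.prodMk (continuous_snd.comp continuous_fst))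

theorem Data.HypH.L_map (hS : S.HypH) (z : Leaders d m × C(Ω, Eu d)) :
    S.L z.1 (P.map z.2) = integralC P (ellAt hS (z, integralC P
      ((⟨S.omega, hS.omega_smooth.continuous⟩ : C(Eu d, Eu d)).comp z.2))) := by
  rw [Data.L, integral_map_continuousMap z.2 hS.omega_smooth.continuous,
    integral_map_continuousMap z.2 (φ := fun x => S.ell (z.1, x, ∫ θ, S.omega (z.2 θ) ∂P))
    (hS.ell_smooth.continuous.comp
      (continuous_const.prodMk (continuous_id.prodMk continuous_const)))]
  rfl

theorem tendsto_L [T2Space Ω] (hS : S.HypH) {I : Type*} {l : Filter I} {Q : I → Measure Ω}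
    [∀ i, IsProbabilityMeasure (Q i)]
    (h : ∀ f : C(Ω, ℝ), Tendsto (fun i => integralC (Q i) f) l (𝓝 (integralC P f)))
    {z : Leaders d m × C(Ω, Eu d)} {w : I → Leaders d m × C(Ω, Eu d)} (hw : Tendsto w l (𝓝 z)) :
    Tendsto (fun i => S.L (w i).1 ((Q i).map (w i).2)) l (𝓝 (S.L z.1 (P.map z.2))) := by
  simp_rw [hS.L_map]
  refine tendsto_integralC_of_tendsto (h _) (((continuous_ellAt hS).tendsto _).comp
    (hw.prodMk_nhds (tendsto_integralC_of_tendsto (tendsto_integralC h _) ?_)))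
  exact ((ContinuousMap.continuous_postcomp _).tendsto _).comp
    ((continuous_snd.tendsto z).comp hw)

theorem continuousOn_L [T2Space Ω] (hS : S.HypH) {s : Set ℝ}
    {z : ℝ → Leaders d m × C(Ω, Eu d)} (hz : ContinuousOn z s) :
    ContinuousOn (fun t => S.L (z t).1 (P.map (z t).2)) s := fun t ht =>
  tendsto_L (Q := fun _ => P) hS (fun _ => tendsto_const_nhds) (hz t ht)

theorem exists_abs_L_le (hS : S.HypH) (R : ℝ) :
    ∃ B : ℝ, ∀ (P : Measure Ω) [IsProbabilityMeasure P] (z : Leaders d m × C(Ω, Eu d)),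
      ‖z‖ ≤ R → |S.L z.1 (P.map z.2)| ≤ B := by
  obtain ⟨M, hM⟩ := (isCompact_closedBall (0 : Eu d) R).exists_bound_of_continuousOn
    hS.omega_smooth.continuous.continuousOn
  obtain ⟨B, hB⟩ := (isCompact_closedBall (0 : Leaders d m × Eu d × Eu d)
    (max R (max R M))).exists_bound_of_continuousOn hS.ell_smooth.continuous.continuousOn
  refine ⟨max B 0, fun P _ z hz => ?_⟩
  have hz1 := (norm_fst_le z).trans hz
  have hz2 := (norm_snd_le z).trans hz
  have hθ : ∀ θ, ‖z.2 θ‖ ≤ R := fun θ => (z.2.norm_coe_le_norm θ).trans hz2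
  have hω : ‖integralC P
      ((⟨S.omega, hS.omega_smooth.continuous⟩ : C(Eu d, Eu d)).comp z.2)‖ ≤ M := by
    rw [integralC_apply]
    exact (norm_integral_le_of_norm_le_const (Eventually.of_forall fun θ =>
      hM _ (by simpa using hθ θ))).trans (by simp)
  rw [hS.L_map, ← Real.norm_eq_abs]
  refine (norm_integralC_apply_le _).trans ((ContinuousMap.norm_le _ (le_max_right _ _)).2
    fun θ => (hB _ ?_).trans (le_max_left _ _))
  rw [mem_closedBall_zero_iff]
  exact norm_prod_le_iff.2 ⟨hz1.trans (le_max_left _ _), (norm_prod_le_iff.2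
    ⟨(hθ θ).trans (le_max_left _ _), hω.trans (le_max_right _ _)⟩).trans (le_max_right _ _)⟩

/-- Convergence of the state costs along weakly convergent controls. -/
theorem tendsto_integral_L [T2Space Ω] (hS : S.HypH) {Q : ℕ → Measure Ω}
    [∀ n, IsProbabilityMeasure (Q n)]
    (h : ∀ f : C(Ω, ℝ), Tendsto (fun n => integralC (Q n) f) atTop (𝓝 (integralC P f)))
    {u : Control D T S.U} {v : ℕ → Control D T S.U} (hv : Tendsto v atTop (𝓝 u))
    {z0 : Leaders d m × C(Ω, Eu d)} {z : ℝ → Leaders d m × C(Ω, Eu d)}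
    {w : ℕ → ℝ → Leaders d m × C(Ω, Eu d)}
    (hz : IsSol (fun _ => meanField hS P) (S.forcing u) z0 T z)
    (hw : ∀ n, IsSol (fun _ => meanField hS (Q n)) (S.forcing (v n)) z0 T (w n)) :
    Tendsto (fun n => ∫ t, S.L (w n t).1 ((Q n).map (w n t).2) ∂(timeMeasure T)) atTop
      (𝓝 (∫ t, S.L (z t).1 (P.map (z t).2) ∂(timeMeasure T))) := by
  obtain ⟨R, hR⟩ := exists_isSol_norm_le hS T z0
  obtain ⟨B, hB⟩ := exists_abs_L_le (Ω := Ω) hS R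
  have hu := tendstoUniformlyOn_isSol hS h hv hz hw
  refine tendsto_integral_of_dominated_convergence (fun _ => B)
    (fun n => (continuousOn_L hS (hw n).cont).aestronglyMeasurable measurableSet_Icc)
    (integrable_const B) (fun n => ?_) ?_
  · exact (ae_restrict_mem measurableSet_Icc).mono fun t ht =>
      hB (Q n) _ (hR (Q n) (v n) (w n) (hw n) t ht)
  · exact (ae_restrict_mem measurableSet_Icc).mono fun t ht =>
      tendsto_L hS h (hu.tendsto_at ht)

theorem integrable_L [T2Space Ω] (hS : S.HypH) {z : ℝ → Leaders d m × C(Ω, Eu d)}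
    (hz : ContinuousOn z (Icc 0 T)) :
    Integrable (fun t => S.L (z t).1 (P.map (z t).2)) (timeMeasure T) :=
  (continuousOn_L hS hz).integrableOn_compact isCompact_Icc

end StateCost

/-! ### Labelling the followers by their initial positions -/

section Initial

variable {d : ℕ}

/-- The inclusion of a set of initial positions, as the initial flow. -/
def inclusion (s : Set (Eu d)) : C(s, Eu d) := ⟨Subtype.val, continuous_subtype_val⟩

theorem tendsto_integralC_unif {s : Set (Eu d)} [CompactSpace s] {P : Measure s}
    [IsProbabilityMeasure P] {ι : ∀ N : ℕ, Fin (N + 1) → s}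
    [∀ N, IsProbabilityMeasure ((unif (N + 1)).map (ι N))]
    (h : ∀ φ : Eu d → ℝ, Continuous φ → HasCompactSupport φ →
      Tendsto (fun N => ∫ x, φ x ∂(empirical fun i => (ι N i : Eu d))) atTop
        (𝓝 (∫ x, φ x ∂(P.map (inclusion s))))) (f : C(s, ℝ)) :
    Tendsto (fun N => integralC ((unif (N + 1)).map (ι N)) f) atTop (𝓝 (integralC P f)) := by
  have hs : IsCompact s := isCompact_iff_compactSpace.2 inferInstance
  obtain ⟨g, hg⟩ := ContinuousMap.exists_restrict_eq hs.isClosed f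
  obtain ⟨R, hR⟩ := hs.isBounded.exists_norm_le
  let χ : ContDiffBump (0 : Eu d) := ⟨|R| + 1, |R| + 2, by positivity, by linarith⟩
  have hφ : Continuous fun x => χ x * g x := χ.continuous.mul g.continuous
  have hφc : HasCompactSupport fun x => χ x * g x := χ.hasCompactSupport.mul_right
  have he : ∀ x : s, χ x * g x = f x := fun x => by
    rw [χ.one_of_mem_closedBall, one_mul, ← hg, ContinuousMap.restrict_apply]
    rw [mem_closedBall_zero_iff]
    refine (hR x x.2).trans ?_
    change R ≤ |R| + 1
    linarith [le_abs_self R]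
  have h1 := h _ hφ hφc
  rw [integral_map_continuousMap (inclusion s) hφ] at h1
  refine (h1.congr fun N => ?_).trans_eq ?_
  · have := map_map_unif (ι N) (inclusion s)
    change _ = empirical fun i => (ι N i : Eu d) at this
    rw [← this, integral_map_continuousMap (inclusion s) hφ]
    exact integral_congr_ae (Eventually.of_forall he)
  · exact congrArg 𝓝 (integral_congr_ae (Eventually.of_forall he))

theorem exists_labels (mu0 : ProbabilityMeasure (Eu d))
    {s : Set (Eu d)} (hs : IsClosed s) (h : (mu0 : Measure (Eu d)).support ⊆ s) :
    ∃ P : Measure s, IsProbabilityMeasure P ∧ P.map (inclusion s) = mu0 := by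
  have he : MeasurableEmbedding (Subtype.val : s → Eu d) :=
    MeasurableEmbedding.subtype_coe hs.measurableSet
  have h1 : ((mu0 : Measure (Eu d)).comap (Subtype.val : s → Eu d)).map Subtype.val = mu0 := by
    rw [he.map_comap, Subtype.range_coe]
    exact Measure.restrict_eq_self_of_ae_mem (mem_of_superset Measure.support_mem_ae h)
  refine ⟨(mu0 : Measure (Eu d)).comap (Subtype.val : s → Eu d), ⟨?_⟩, h1⟩
  have h2 := congrArg (fun μ : Measure (Eu d) => μ univ) h1
  simpa [Measure.map_apply measurable_subtype_coe MeasurableSet.univ] using h2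

end Initial

/-! ### Extended integrals -/

theorem extIntegral_congr_ae {α : Type*} [MeasurableSpace α] {μ : Measure α} {f g : α → ℝ}
    (h : f =ᵐ[μ] g) : extIntegral μ f = extIntegral μ g := by
  rw [extIntegral, extIntegral,
    lintegral_congr_ae (h.mono fun x hx => by simp only [hx] :
      (fun a => ENNReal.ofReal (f a)) =ᵐ[μ] fun a => ENNReal.ofReal (g a)),
    lintegral_congr_ae (h.mono fun x hx => by simp only [hx] :
      (fun a => ENNReal.ofReal (-f a)) =ᵐ[μ] fun a => ENNReal.ofReal (-g a))]

/-- A function with an integrable minorant has an extended integral, which is computed by splitting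
off the minorant. -/
theorem extIntegral_eq_add {α : Type*} [MeasurableSpace α] {μ : Measure α} {f b : α → ℝ}
    (hf : AEMeasurable f μ) (hb : Integrable b μ) (hbf : b ≤ᵐ[μ] f) :
    extIntegral μ f = ((∫ a, b a ∂μ : ℝ) : EReal) +
      ((∫⁻ a, ENNReal.ofReal (f a - b a) ∂μ : ℝ≥0∞) : EReal) := by
  have hbm := hb.aestronglyMeasurable.aemeasurable
  have hfm : AEMeasurable (fun a => -f a) μ := hf.neg
  have key : (∫⁻ a, ENNReal.ofReal (f a) ∂μ) + ∫⁻ a, ENNReal.ofReal (-b a) ∂μ =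
      (∫⁻ a, ENNReal.ofReal (-f a) ∂μ) + (∫⁻ a, ENNReal.ofReal (b a) ∂μ) +
        ∫⁻ a, ENNReal.ofReal (f a - b a) ∂μ := by
    rw [← lintegral_add_left' hf.ennreal_ofReal, ← lintegral_add_left' hfm.ennreal_ofReal,
      ← lintegral_add_left' (f := fun a => ENNReal.ofReal (-f a) + ENNReal.ofReal (b a))
        (hfm.ennreal_ofReal.add hbm.ennreal_ofReal)]
    refine lintegral_congr_ae (hbf.mono fun x hx => ?_)
    have hx0 : 0 ≤ f x - b x := sub_nonneg.2 hx
    have e : ∀ r : ℝ, ENNReal.ofReal r = ENNReal.ofReal (max r 0) := fun r => by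
      rcases le_total r 0 with h | h
      · rw [max_eq_right h, ENNReal.ofReal_zero, ENNReal.ofReal_of_nonpos h]
      · rw [max_eq_left h]
    change ENNReal.ofReal (f x) + ENNReal.ofReal (-b x) =
      ENNReal.ofReal (-f x) + ENNReal.ofReal (b x) + ENNReal.ofReal (f x - b x)
    rw [e (f x), e (-b x), e (-f x), e (b x), ← ENNReal.ofReal_add (le_max_right _ _)
      (le_max_right _ _), ← ENNReal.ofReal_add (le_max_right _ _) (le_max_right _ _),
      ← ENNReal.ofReal_add (add_nonneg (le_max_right _ _) (le_max_right _ _)) hx0]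
    congr 1
    have h1 := max_zero_sub_max_neg_zero_eq_self (f x)
    have h2 := max_zero_sub_max_neg_zero_eq_self (b x)
    linarith
  have hB : ∫⁻ a, ENNReal.ofReal (b a) ∂μ ≠ ⊤ := hb.lintegral_lt_top.ne
  have hB' : ∫⁻ a, ENNReal.ofReal (-b a) ∂μ ≠ ⊤ := hb.neg.lintegral_lt_top.ne
  have hF' : ∫⁻ a, ENNReal.ofReal (-f a) ∂μ ≠ ⊤ := by
    refine ne_top_of_le_ne_top hB' (lintegral_mono_ae (hbf.mono fun x hx => ?_))
    exact ENNReal.ofReal_le_ofReal (neg_le_neg hx)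
  rw [extIntegral, integral_eq_lintegral_pos_part_sub_lintegral_neg_part hb]
  generalize (∫⁻ a, ENNReal.ofReal (f a) ∂μ) = A at *
  generalize (∫⁻ a, ENNReal.ofReal (-f a) ∂μ) = A' at *
  generalize (∫⁻ a, ENNReal.ofReal (b a) ∂μ) = B at *
  generalize (∫⁻ a, ENNReal.ofReal (-b a) ∂μ) = B' at *
  generalize (∫⁻ a, ENNReal.ofReal (f a - b a) ∂μ) = J at *
  lift A' to ℝ≥0 using hF'
  lift B to ℝ≥0 using hB
  lift B' to ℝ≥0 using hB'
  rcases eq_or_ne J ⊤ with rfl | hJ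
  · have hA : A = ⊤ := by
      rw [add_top] at key
      exact (ENNReal.add_eq_top.1 key).resolve_right ENNReal.coe_ne_top
    rw [hA, EReal.coe_ennreal_top, EReal.coe_add_top]
    exact EReal.top_sub_coe _
  · lift J to ℝ≥0 using hJ
    have hA : A ≠ ⊤ := by
      intro hA
      rw [hA, top_add] at key
      exact ENNReal.coe_ne_top (r := A' + B + J) (by push_cast; exact key.symm)
    lift A to ℝ≥0 using hA
    have key' : (A : ℝ) + B' = A' + B + J := by exact_mod_cast key
    have e : ∀ r : ℝ≥0, ((r : ℝ≥0∞) : EReal) = ((r : ℝ) : EReal) := fun r => rfl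
    simp only [e, ENNReal.coe_toReal]
    norm_cast
    linarith

/-! ### The control cost -/

section ControlCost

variable {E α : Type*} [NormedAddCommGroup E] [NormedSpace ℝ E] [MeasurableSpace E] [BorelSpace E]
  [MeasurableSpace α] {μ : Measure α} {U : Set E} {γ : E → ℝ}

theorem aemeasurable_comp_of_lowerSemicontinuousOn (hU : IsClosed U)
    (hγ : LowerSemicontinuousOn γ U) {f : α → E} (hf : AEMeasurable f μ)
    (hfU : ∀ᵐ t ∂μ, f t ∈ U) : AEMeasurable (fun t => γ (f t)) μ := by
  obtain ⟨γ', hγ', he⟩ := (MeasurableEmbedding.subtype_coe hU.measurableSet).exists_measurable_extend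
    (lowerSemicontinuous_restrict_iff.2 hγ).measurable fun _ => inferInstance
  refine (hγ'.comp_aemeasurable hf).congr (hfU.mono fun t ht => ?_)
  exact congrFun he ⟨f t, ht⟩

theorem ofReal_sub_le_liminf (hγ : LowerSemicontinuousOn γ U) (c : ℝ) {x : E} (hx : x ∈ U)
    {v : ℕ → E} (hvU : ∀ n, v n ∈ U) (hv : Tendsto v atTop (𝓝 x)) :
    ENNReal.ofReal (γ x - c) ≤ liminf (fun n => ENNReal.ofReal (γ (v n) - c)) atTop := by
  have h1 : LowerSemicontinuousOn (fun x => ENNReal.ofReal (γ x - c)) U :=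
    (ENNReal.continuous_ofReal.comp (continuous_id.sub continuous_const)).comp_lowerSemicontinuousOn
      hγ fun a b hab => ENNReal.ofReal_le_ofReal (sub_le_sub_right hab c)
  have h2 : Tendsto v atTop (𝓝[U] x) :=
    tendsto_nhdsWithin_iff.2 ⟨hv, Eventually.of_forall hvU⟩
  refine le_of_forall_lt fun a ha => ?_
  obtain ⟨a', haa', ha'⟩ := exists_between ha
  exact haa'.trans_le (le_liminf_of_le (by isBoundedDefault)
    ((h2.eventually (h1 x hx a' ha')).mono fun _ h => h.le))

/-- The `L¹` functions `f` with values in `U` and `∫ (γ(f) - c) dμ ≤ a`, where `c` is meant to be a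
lower bound of `γ` on `U`. -/
def costSublevel (μ : Measure α) (U : Set E) (γ : E → ℝ) (c : ℝ) (a : ℝ≥0∞) : Set (Lp E 1 μ) :=
  {f | (∀ᵐ t ∂μ, f t ∈ U) ∧ ∫⁻ t, ENNReal.ofReal (γ (f t) - c) ∂μ ≤ a}

theorem isClosed_costSublevel (hU : IsClosed U) (hγ : LowerSemicontinuousOn γ U)
    (c : ℝ) (a : ℝ≥0∞) : IsClosed (costSublevel μ U γ c a) := by
  refine IsSeqClosed.isClosed fun f g hf hfg => ?_
  -- Along a subsequence the convergence is almost everywhere, so that Fatou's lemma applies.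
  obtain ⟨ns, -, hae⟩ := (tendstoInMeasure_of_tendsto_Lp hfg).exists_seq_tendsto_ae
  have hU' : ∀ᵐ t ∂μ, ∀ n, f (ns n) t ∈ U := ae_all_iff.2 fun n => (hf (ns n)).1
  have hgU : ∀ᵐ t ∂μ, g t ∈ U := by
    filter_upwards [hae, hU'] with t ht htU
    exact hU.mem_of_tendsto ht (Eventually.of_forall htU)
  refine ⟨hgU, ?_⟩
  have h1 : ∫⁻ t, ENNReal.ofReal (γ (g t) - c) ∂μ ≤
      ∫⁻ t, liminf (fun n => ENNReal.ofReal (γ (f (ns n) t) - c)) atTop ∂μ := by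
    refine lintegral_mono_ae ?_
    filter_upwards [hae, hU', hgU] with t ht htU hgt
    exact ofReal_sub_le_liminf hγ c hgt htU ht
  refine h1.trans ((lintegral_liminf_le' fun n => ?_).trans ?_)
  · exact ((aemeasurable_comp_of_lowerSemicontinuousOn hU hγ
      (Lp.aestronglyMeasurable (f (ns n))).aemeasurable (hf _).1).sub_const c).ennreal_ofReal
  · refine liminf_le_of_le (by isBoundedDefault) fun b hb => ?_
    obtain ⟨n, hn⟩ := hb.exists
    exact hn.trans (hf (ns n)).2

theorem convex_costSublevel (hU : IsClosed U) (hγ : LowerSemicontinuousOn γ U)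
    (hγc : ConvexOn ℝ U γ) (c : ℝ) (a : ℝ≥0∞) : Convex ℝ (costSublevel μ U γ c a) := by
  intro f hf g hg r s hr hs hrs
  have e : (r • f + s • g : Lp E 1 μ) =ᵐ[μ] fun t => r • f t + s • g t := by
    filter_upwards [Lp.coeFn_add (r • f) (s • g), Lp.coeFn_smul r f, Lp.coeFn_smul s g]
      with t h1 h2 h3
    rw [h1, Pi.add_apply, h2, h3, Pi.smul_apply, Pi.smul_apply]
  refine ⟨?_, ?_⟩
  · filter_upwards [e, hf.1, hg.1] with t ht hft hgt
    rw [ht]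
    exact hγc.1 hft hgt hr hs hrs
  have hm : AEMeasurable (fun t => ENNReal.ofReal (γ (f t) - c)) μ :=
    ((aemeasurable_comp_of_lowerSemicontinuousOn hU hγ
      (Lp.aestronglyMeasurable f).aemeasurable hf.1).sub_const c).ennreal_ofReal
  have h1 : ∫⁻ t, ENNReal.ofReal (γ ((r • f + s • g : Lp E 1 μ) t) - c) ∂μ ≤
      ∫⁻ t, (ENNReal.ofReal r * ENNReal.ofReal (γ (f t) - c) +
        ENNReal.ofReal s * ENNReal.ofReal (γ (g t) - c)) ∂μ := by
    refine lintegral_mono_ae ?_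
    filter_upwards [e, hf.1, hg.1] with t ht hft hgt
    rw [ht, ← ENNReal.ofReal_mul hr, ← ENNReal.ofReal_mul hs]
    refine le_trans (ENNReal.ofReal_le_ofReal ?_) ENNReal.ofReal_add_le
    have h2 := hγc.2 hft hgt hr hs hrs
    simp only [smul_eq_mul] at h2
    have h3 : c = r * c + s * c := by rw [← add_mul, hrs, one_mul]
    linarith
  refine h1.trans ?_
  rw [lintegral_add_left' (hm.const_mul _), lintegral_const_mul' _ _ ENNReal.ofReal_ne_top,
    lintegral_const_mul' _ _ ENNReal.ofReal_ne_top]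
  calc _ ≤ ENNReal.ofReal r * a + ENNReal.ofReal s * a := by
        gcongr
        · exact hf.2
        · exact hg.2
    _ = a := by rw [← add_mul, ← ENNReal.ofReal_add hr hs, hrs, ENNReal.ofReal_one, one_mul]

/-- Weak lower semicontinuity of the control cost: its sublevel sets are convex and strongly closed,
hence weakly closed. -/
theorem lintegral_le_liminf_of_tendsto_weak (hU : IsClosed U) (hγ : LowerSemicontinuousOn γ U)
    (hγc : ConvexOn ℝ U γ) (c : ℝ) {f : Lp E 1 μ} {v : ℕ → Lp E 1 μ}
    (hvU : ∀ n, ∀ᵐ t ∂μ, v n t ∈ U)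
    (hv : Tendsto (fun n => toWeakSpace ℝ (Lp E 1 μ) (v n)) atTop (𝓝 (toWeakSpace ℝ _ f))) :
    ∫⁻ t, ENNReal.ofReal (γ (f t) - c) ∂μ ≤
      liminf (fun n => ∫⁻ t, ENNReal.ofReal (γ (v n t) - c) ∂μ) atTop := by
  refine le_of_forall_lt fun a ha => ?_
  obtain ⟨b, hab, hb⟩ := exists_between ha
  refine hab.trans_le (le_liminf_of_le (by isBoundedDefault) ?_)
  by_contra hcon
  have hfreq : ∃ᶠ n in atTop, toWeakSpace ℝ (Lp E 1 μ) (v n) ∈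
      toWeakSpace ℝ (Lp E 1 μ) '' costSublevel μ U γ c b :=
    (not_eventually.1 hcon).mono fun n hn => ⟨v n, ⟨hvU n, (not_le.1 hn).le⟩, rfl⟩
  have hmem := mem_closure_of_frequently_of_tendsto hfreq hv
  rw [← (convex_costSublevel hU hγ hγc c b).toWeakSpace_closure ℝ,
    (isClosed_costSublevel hU hγ c b).closure_eq] at hmem
  obtain ⟨g, hg, hgf⟩ := hmem
  rw [(toWeakSpace ℝ (Lp E 1 μ)).injective hgf] at hg
  exact (hg.2.trans_lt hb).false

end ControlCost

/-! ### The total cost -/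

section TotalCost

variable {d m D : ℕ} {S : Data d m D} {T : ℝ}

theorem Data.HypH.exists_le_gamma (hS : S.HypH) : ∃ c : ℝ, ∀ x ∈ S.U, c ≤ S.gamma x := by
  obtain ⟨c, hc⟩ := hS.gamma_lsc.bddBelow_of_isCompact hS.U_compact
  exact ⟨c, fun x hx => hc (mem_image_of_mem _ hx)⟩

/-- The cost splits into the state cost and the (possibly infinite) control cost. -/
theorem Data.HypH.cost_eq (hS : S.HypH) {c : ℝ} (hc : ∀ x ∈ S.U, c ≤ S.gamma x)
    (u : Control D T S.U) {y : ℝ → Leaders d m} {μ : ℝ → Measure (Eu d)}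
    (hL : Integrable (fun t => S.L (y t) (μ t)) (timeMeasure T)) :
    S.cost T u y μ = ((∫ t, S.L (y t) (μ t) ∂(timeMeasure T) + ∫ _, c ∂(timeMeasure T) : ℝ) : EReal)
      + ((∫⁻ t, ENNReal.ofReal (S.gamma (u.1 t) - c) ∂(timeMeasure T) : ℝ≥0∞) : EReal) := by
  have hγ := aemeasurable_comp_of_lowerSemicontinuousOn hS.U_compact.isClosed hS.gamma_lsc
    (Lp.aestronglyMeasurable u.1).aemeasurable u.2
  have h1 := extIntegral_eq_add (b := fun t => S.L (y t) (μ t) + c)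
    (hL.aestronglyMeasurable.aemeasurable.add hγ) (hL.add (integrable_const c))
    (u.2.mono fun t ht => by simpa using hc _ ht)
  rw [integral_add hL (integrable_const c)] at h1
  refine h1.trans (congrArg _ (congrArg _ (lintegral_congr fun t => ?_)))
  simp only [Pi.add_apply, add_sub_add_left_eq_sub]

theorem Data.cost_congr (u : Control D T S.U) {y y' : ℝ → Leaders d m}
    {μ μ' : ℝ → Measure (Eu d)} (h : ∀ t ∈ Icc 0 T, y t = y' t ∧ μ t = μ' t) :
    S.cost T u y μ = S.cost T u y' μ' :=
  extIntegral_congr_ae ((ae_restrict_mem measurableSet_Icc).mono fun t ht => by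
    simp only [(h t ht).1, (h t ht).2])

theorem Data.F_eq_cost {y0 : Leaders d m} {mu0 : ProbabilityMeasure (Eu d)}
    {u : Control D T S.U} {y : ℝ → Leaders d m} {μ : ℝ → ProbabilityMeasure (Eu d)}
    (h : S.IsMeanFieldSol T y0 mu0 u y μ)
    (huniq : ∀ y' μ', S.IsMeanFieldSol T y0 mu0 u y' μ' →
      ∀ t ∈ Icc 0 T, y' t = y t ∧ μ' t = μ t) :
    S.F T y0 mu0 u = S.cost T u y (fun t => (μ t : Measure (Eu d))) := by
  have hex : ∃ p : (ℝ → Leaders d m) × (ℝ → ProbabilityMeasure (Eu d)),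
      S.IsMeanFieldSol T y0 mu0 u p.1 p.2 := ⟨(y, μ), h⟩
  rw [Data.F, dif_pos hex]
  refine Data.cost_congr u fun t ht => ?_
  have := huniq _ _ hex.choose_spec t ht
  exact ⟨this.1, congrArg _ this.2⟩

theorem Data.FN_eq_cost (hS : S.HypH) {N : ℕ} [NeZero N] {y0 : Leaders d m} {x0 : Fin N → Eu d}
    {u : Control D T S.U} {y : ℝ → Leaders d m} {x : ℝ → Fin N → Eu d}
    (h : S.IsParticleSol T y0 x0 u y x) :
    S.FN T y0 x0 u = S.cost T u y (fun t => empirical (x t)) := by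
  have hex : ∃ p : (ℝ → Leaders d m) × (ℝ → Fin N → Eu d),
      S.IsParticleSol T y0 x0 u p.1 p.2 := ⟨(y, x), h⟩
  rw [Data.FN, dif_pos hex]
  refine Data.cost_congr u fun t ht => ?_
  have := hex.choose_spec.unique hS h t ht
  exact ⟨this.1, congrArg _ this.2⟩

/-- `Γ`-convergence and pointwise convergence of functionals that are sums of a continuously
convergent real part and of a fixed lower semicontinuous part. -/
theorem gammaConverges_add {X : Type*} [TopologicalSpace X] {F : ℕ → X → EReal} {G : X → EReal}
    {a : ℕ → X → ℝ} {b : X → ℝ} {J : X → ℝ≥0∞} (hF : ∀ N u, F N u = (a N u : EReal) + J u)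
    (hG : ∀ u, G u = (b u : EReal) + J u)
    (hab : ∀ (u : X) (v : ℕ → X), Tendsto v atTop (𝓝 u) →
      Tendsto (fun N => a N (v N)) atTop (𝓝 (b u)))
    (hJ : ∀ (u : X) (v : ℕ → X), Tendsto v atTop (𝓝 u) → J u ≤ liminf (fun N => J (v N)) atTop) :
    GammaConverges F G ∧ ∀ u, Tendsto (fun N => F N u) atTop (𝓝 (G u)) := by
  have hbot : ∀ (r : ℝ) (j : ℝ≥0∞), (r : EReal) + j ≠ ⊥ := fun r j =>
    EReal.add_ne_bot_iff.2 ⟨EReal.coe_ne_bot _, EReal.coe_ennreal_ne_bot _⟩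
  have hlim : ∀ u, Tendsto (fun N => F N u) atTop (𝓝 (G u)) := fun u => by
    simp_rw [hF, hG]
    have h1 : Tendsto (fun N => ((a N u : EReal), (J u : EReal))) atTop
        (𝓝 ((b u : EReal), (J u : EReal))) :=
      ((continuous_coe_real_ereal.tendsto _).comp
        (hab u _ tendsto_const_nhds)).prodMk_nhds tendsto_const_nhds
    exact (EReal.continuousAt_add (.inl (EReal.coe_ne_top _)) (.inl (EReal.coe_ne_bot _))).tendsto.comp
      h1
  refine ⟨⟨fun N u => hF N u ▸ hbot _ _, fun u => hG u ▸ hbot _ _, fun u v hv => ?_,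
    fun u => ⟨fun _ => u, tendsto_const_nhds, (hlim u).limsup_eq.le⟩⟩, hlim⟩
  simp_rw [hF, hG]
  have h1 : liminf (fun N => (a N (v N) : EReal)) atTop = b u :=
    ((continuous_coe_real_ereal.tendsto _).comp (hab u v hv)).liminf_eq
  have hmono : Monotone ((↑) : ℝ≥0∞ → EReal) := fun a b h => EReal.coe_ennreal_le_coe_ennreal_iff.2 h
  have h2 : (J u : EReal) ≤ liminf (fun N => (J (v N) : EReal)) atTop :=
    (hmono (hJ u v hv)).trans_eq
      (hmono.map_liminf_of_continuousAt _ continuous_coe_ennreal_ereal.continuousAt)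
  refine le_trans ?_ EReal.le_liminf_add
  rw [h1]
  gcongr

end TotalCost

end MeanFieldControl

end

/-- The `N`-th member of the sequence has `N + 1` followers, so that the number of followers runs
through `1, 2, 3, …`. The first four conclusions say that both systems are well posed, so that the
functionals are well defined; then come the `Γ`-convergence and the fact that constant sequences
are recovery sequences. -/
theorem theorem2p10 {d m D : ℕ} (hd : 0 < d) (hm : 0 < m) (hD : 0 < D)
    (S : MeanFieldControl.Data d m D) (hS : S.HypH)
    (T : ℝ) (hT : 0 < T)
    (y0 : MeanFieldControl.Leaders d m)
    (mu0 : ProbabilityMeasure (MeanFieldControl.Eu d))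
    (hmu0 : IsCompact (mu0 : Measure (MeanFieldControl.Eu d)).support)
    (x0 : ∀ N : ℕ, Fin (N + 1) → MeanFieldControl.Eu d)
    (hx0 : ∀ N i, x0 N i ∈
      (mu0 : Measure (MeanFieldControl.Eu d)).support + Metric.closedBall 0 1)
    (hconv : ∀ φ : MeanFieldControl.Eu d → ℝ, Continuous φ → HasCompactSupport φ →
      Tendsto (fun N => ∫ x, φ x ∂(MeanFieldControl.empirical (x0 N))) atTop
        (𝓝 (∫ x, φ x ∂(mu0 : Measure (MeanFieldControl.Eu d))))) :
    (∀ u : MeanFieldControl.Control D T S.U, ∃ y μ, S.IsMeanFieldSol T y0 mu0 u y μ) ∧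
    (∀ (u : MeanFieldControl.Control D T S.U) y μ y' μ',
      S.IsMeanFieldSol T y0 mu0 u y μ → S.IsMeanFieldSol T y0 mu0 u y' μ' →
        ∀ t ∈ Icc 0 T, y t = y' t ∧ μ t = μ' t) ∧
    (∀ (N : ℕ) (u : MeanFieldControl.Control D T S.U), ∃ y x,
      S.IsParticleSol T y0 (x0 N) u y x) ∧
    (∀ (N : ℕ) (u : MeanFieldControl.Control D T S.U) y x y' x',
      S.IsParticleSol T y0 (x0 N) u y x → S.IsParticleSol T y0 (x0 N) u y' x' →
        ∀ t ∈ Icc 0 T, y t = y' t ∧ x t = x' t) ∧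
    MeanFieldControl.GammaConverges (fun N => S.FN T y0 (x0 N)) (S.F T y0 mu0) ∧
    (∀ u : MeanFieldControl.Control D T S.U,
      Tendsto (fun N => S.FN T y0 (x0 N) u) atTop (𝓝 (S.F T y0 mu0 u))) := by
  open MeanFieldControl in
  -- All initial positions lie in the compact set `s`, which serves as the space of labels.
  set s : Set (Eu d) := (mu0 : Measure (Eu d)).support + Metric.closedBall 0 1 with hs
  have hsc : IsCompact s := hmu0.add (isCompact_closedBall 0 1)
  have hsupp : (mu0 : Measure (Eu d)).support ⊆ s := fun x hx =>
    ⟨x, hx, 0, Metric.mem_closedBall_self zero_le_one, add_zero x⟩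
  have : CompactSpace s := isCompact_iff_compactSpace.1 hsc
  obtain ⟨P, hP, hPmu⟩ := exists_labels mu0 hsc.isClosed hsupp
  let ι : ∀ N : ℕ, Fin (N + 1) → s := fun N i => ⟨x0 N i, hx0 N i⟩
  have : ∀ N, IsProbabilityMeasure ((unif (N + 1)).map (ι N)) := fun N =>
    Measure.isProbabilityMeasure_map (measurable_of_finite _).aemeasurable
  have hlab : ∀ f : C(s, ℝ), Tendsto (fun N => integralC ((unif (N + 1)).map (ι N)) f) atTop
      (𝓝 (integralC P f)) := fun f =>
    tendsto_integralC_unif (ι := ι) (by rw [hPmu]; exact hconv) f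
  have huniq : ∀ (u : Control D T S.U) y μ y' μ',
      S.IsMeanFieldSol T y0 mu0 u y μ → S.IsMeanFieldSol T y0 mu0 u y' μ' →
        ∀ t ∈ Icc 0 T, y t = y' t ∧ μ t = μ' t := fun u y μ y' μ' h h' =>
    h.unique hS hT.le hPmu h'
  choose z hz using fun u : Control D T S.U =>
    exists_isSol_meanField hS hT.le P u (y0, inclusion s)
  choose w hw using fun (N : ℕ) (u : Control D T S.U) =>
    exists_isSol_meanField hS hT.le ((unif (N + 1)).map (ι N)) u (y0, inclusion s)
  have hzM := fun u => (hz u).isMeanFieldSol hT.le hPmu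
  have hwP : ∀ N u, S.IsParticleSol T y0 (x0 N) u (fun t => (w N u t).1)
      fun t i => (w N u t).2 (ι N i) := fun N u => (hw N u).isParticleSol
  obtain ⟨c, hc⟩ := hS.exists_le_gamma
  have hmain := gammaConverges_add (F := fun N => S.FN T y0 (x0 N)) (G := S.F T y0 mu0)
    (a := fun N u => ∫ t, S.L (w N u t).1 (((unif (N + 1)).map (ι N)).map (w N u t).2)
      ∂(timeMeasure T) + ∫ _, c ∂(timeMeasure T))
    (b := fun u => ∫ t, S.L (z u t).1 (P.map (z u t).2) ∂(timeMeasure T) +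
      ∫ _, c ∂(timeMeasure T))
    (J := fun u : Control D T S.U =>
      ∫⁻ t, ENNReal.ofReal (S.gamma (u.1 t) - c) ∂(timeMeasure T))
    (fun N u => by
      rw [Data.FN_eq_cost hS (hwP N u), ← hS.cost_eq hc u (integrable_L hS (hw N u).cont)]
      simp_rw [map_map_unif])
    (fun u => by
      rw [Data.F_eq_cost (hzM u) (fun y' μ' h' => huniq u _ _ _ _ h' (hzM u)),
        ← hS.cost_eq hc u (integrable_L hS (hz u).cont)]
      rfl)
    (fun u v hv => (tendsto_integral_L hS hlab hv (hz u) fun N => hw N (v N)).add_const _)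
    (fun u v hv => lintegral_le_liminf_of_tendsto_weak hS.U_compact.isClosed hS.gamma_lsc
      hS.gamma_strictConvex.convexOn c (fun N => (v N).2)
      ((continuous_induced_dom.tendsto u).comp hv))
  exact ⟨fun u => ⟨_, _, hzM u⟩, huniq, fun N u => ⟨_, _, hwP N u⟩,
    fun N u y x y' x' h h' => h.unique hS h', hmain⟩
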